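/- Let $\mathbb D=\{z\in\mathbb C:|z|<1\}$. For $N\ge 1$ let $U_N$ be an $N\times N$ Haar unitary matrix and $\mathbf U(z)=\log|\det(1-zU_N)|$ for $z\in\mathbb D$. Let $\mathbf G$ be a centered Gaussian field on $\mathbb D$ with $\mathbb E\,\mathbf G(z)\mathbf G(y)=-\tfrac12\log|1-z\bar y|$. Let $d$ be the hyperbolic distance on $\mathbb D$, $d(y,z)=\log\frac{1+|T_y(z)|}{1-|T_y(z)|}$ with $T_y(z)=\frac{z-y}{1-z\bar y}$. For finite sets $\mathbf z,\mathbf y\subset\mathbb D$ and a field $\mathbf F$ on $\mathbb D$ put $\mathfrak B(\mathbf F)=\sum_{z\in\mathbf z}2\mathbf F(z)-\sum_{y\in\mathbf y}2\mathbf F(y)$. Let $k\ge 1$ be an integer. There is a constant $C=C(k)$ such that the following holds for all $N\ge1$ and all disjoint finite sets $\mathbf z,\mathbf y\subset\mathbb D$ with $|\mathbf y|\le|\mathbf z|=k$. The expectations $\mathbb E e^{\mathfrak B(\mathbf U)}$ and $\mathbb E e^{\mathfrak B(\mathbf G)}$ are finite. Define $$\Delta=\max_{z\in\mathbf z}\ e^{-N\exp(-d(0,z))}\prod_{x\in\mathbf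 z,\ x\ne z}\coth\bigl(d(x,z)/2\bigr).$$ Then $$\mathbb E e^{\mathfrak B(\mathbf U)}\ \ge\ \mathbb E e^{\mathfrak B(\mathbf G)}\,\bigl(1-C(\Delta^2+\Delta^{2k})\bigr).$$ Further, let $w\in\mathbf z$, write $\mathbf z'=\mathbf z\setminus\{w\}$, and define $$\Delta'=\max_{z\in\mathbf z'}\ e^{-N\exp(-d(0,z))}\prod_{x\in\mathbf z,\ x\ne z}\coth\bigl(d(x,z)/2\bigr)$$ (with $\Delta'=0$ if $\mathbf z'=\emptyset$). Then $$\frac{\mathbb E e^{\mathfrak B(\mathbf U)}}{\mathbb E e^{\mathfrak B(\mathbf G)}}=1-|w|^{2(N+k-|\mathbf y|)}\,\frac{\prod_{y\in\mathbf y}\tanh^2\bigl(d(w,y)/2\bigr)}{\prod_{z\in\mathbf z'}\tanh^2\bigl(d(w,z)/2\bigr)}+\xi,\qquad |\xi|\le C\,\Delta'(1+\Delta)^{2k-1}.$$ -/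

import Mathlib

open MeasureTheory ProbabilityTheory

open scoped ComplexConjugate

namespace CUEField

/-! ### The Haar unitary matrix and the field `U` -/

/-- The Borel σ-algebra on the unitary group `U(N)`. -/
noncomputable instance instMeasurableSpaceUnitary (N : ℕ) :
    MeasurableSpace (Matrix.unitaryGroup (Fin N) ℂ) := borel _

instance instBorelSpaceUnitary (N : ℕ) : BorelSpace (Matrix.unitaryGroup (Fin N) ℂ) := ⟨rfl⟩

instance instCompactSpaceUnitary (N : ℕ) : CompactSpace (Matrix.unitaryGroup (Fin N) ℂ) := by
  have hclosed : IsClosed (Matrix.unitaryGroup (Fin N) ℂ : Set (Matrix (Fin N) (Fin N) ℂ)) :=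
    isClosed_unitary
  have hK : IsCompact (Set.pi Set.univ fun _ : Fin N =>
      Set.pi Set.univ fun _ : Fin N => Metric.closedBall (0 : ℂ) 1) :=
    isCompact_univ_pi fun _ => isCompact_univ_pi fun _ => isCompact_closedBall 0 1
  refine isCompact_iff_compactSpace.mp (hK.of_isClosed_subset hclosed ?_)
  intro A hA i _ j _
  simpa using entry_norm_bound_of_unitary hA i j

/-- The law of an `N × N` Haar unitary matrix: the Haar measure of the compact group `U(N)`,
normalized to total mass one. -/
noncomputable def haarUnitary (N : ℕ) : Measure (Matrix.unitaryGroup (Fin N) ℂ) :=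
  Measure.haarMeasure ⊤

instance instIsProbabilityMeasureHaarUnitary (N : ℕ) : IsProbabilityMeasure (haarUnitary N) :=
  ⟨by simpa [haarUnitary] using
    Measure.haarMeasure_self (K₀ := (⊤ : TopologicalSpace.PositiveCompacts
      (Matrix.unitaryGroup (Fin N) ℂ)))⟩

/-- The field `U(z) = log |det (1 - z U_N)|` on the open unit disc. -/
noncomputable def fieldU (N : ℕ) (z : Complex.UnitDisc) (A : Matrix.unitaryGroup (Fin N) ℂ) : ℝ :=
  Real.log ‖(1 - (z : ℂ) • (A : Matrix (Fin N) (Fin N) ℂ)).det‖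

/-! ### The Gaussian field `G` -/

/-- `G` is a centered Gaussian field on the open unit disc with covariance
`E[G(z) G(w)] = -(1/2) log |1 - z w̄|`. (In particular `G(0)` has variance zero, so it vanishes
almost surely.) -/
structure IsFieldG {Ω : Type*} [MeasurableSpace Ω] (G : Complex.UnitDisc → Ω → ℝ)
    (P : Measure Ω) : Prop where
  isGaussianProcess : IsGaussianProcess G P
  integral_eq_zero : ∀ z, ∫ ω, G z ω ∂P = 0
  integral_mul : ∀ z w, ∫ ω, G z ω * G w ω ∂P = -Real.log ‖1 - (z : ℂ) * conj (w : ℂ)‖ / 2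

/-! ### Exponential bias -/

/-- The linear functional `B(F) = ∑_{z ∈ 𝐳} 2 F(z) - ∑_{y ∈ 𝐲} 2 F(y)` of a field `F`. -/
noncomputable def bias (z y : Finset Complex.UnitDisc) (F : Complex.UnitDisc → ℝ) : ℝ :=
  ∑ a ∈ z, 2 * F a - ∑ b ∈ y, 2 * F b

/-! ### Hyperbolic distance -/

/-- The modulus of the disc automorphism `T_y(z) = (z - y) / (1 - z ȳ)` gives the hyperbolic
distance `d(y, z) = log ((1 + |T_y(z)|) / (1 - |T_y(z)|))` in the Poincaré disc. -/
noncomputable def hypDist (y z : Complex.UnitDisc) : ℝ :=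
  Real.log ((1 + ‖((z : ℂ) - y) / (1 - (z : ℂ) * conj (y : ℂ))‖) /
    (1 - ‖((z : ℂ) - y) / (1 - (z : ℂ) * conj (y : ℂ))‖))

noncomputable instance instDecidableEqUnitDisc : DecidableEq Complex.UnitDisc :=
  Classical.decEq _

/-- Hyperbolic cotangent. -/
noncomputable def coth (x : ℝ) : ℝ := Real.cosh x / Real.sinh x

/-- `e^{-N exp(-d(0,a))} ∏_{x ∈ 𝐳, x ≠ a} coth(d(x,a)/2)`. -/
noncomputable def weight (N : ℕ) (z : Finset Complex.UnitDisc) (a : Complex.UnitDisc) : ℝ :=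
  Real.exp (-(N : ℝ) * Real.exp (-hypDist 0 a)) * ∏ x ∈ z.erase a, coth (hypDist x a / 2)

/-- The maximum over `a ∈ s` of the weight of `a` relative to `𝐳`; it is `0` if `s = ∅`.
For `s = 𝐳` this is `Δ`, for `s = 𝐳 \ {w}` it is `Δ'`. -/
noncomputable def maxWeight (N : ℕ) (z s : Finset Complex.UnitDisc) : ℝ :=
  ⨆ a : s, weight N z a

end CUEField

/-! Both exponential moments have closed forms, and their ratio is a `k × k` determinant close to 1.

The functional `bias z y` of `G` is a centered Gaussian variable, so its exponential moment is the
exponential of half its variance, a product of powers of `|1 - a conj b|`. The moment of `U` is the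
Haar average of a ratio of squared characteristic polynomials. By Weyl's integration formula it
becomes a torus integral against the squared Vandermonde of the eigenvalues `x`. The denominators
are absorbed into a Bernstein–Szegő weight on each circle variable. The numerators complete the
squared Vandermonde of `x` to that of the `k + N` points `conj z, x`, up to the Vandermonde of `conj
z`. This is, up to a Gram determinant, a determinant of the reproducing kernel of polynomials of
degree below `k + N`. Integrating out the `N` circle variables (`integral_det_kernel`) leaves the
kernel determinant at the points `ζ = conj z`.

For this weight the kernel is explicit (`szegoKernel_eq`): it equals `q(w) conj q(v) (1 - φ(w) conj
φ(v)) / (1 - w conj v)`, where `q` is `szegoPoly` and `φ` is the Blaschke product with zeros at the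
`conj y` and a zero of order `n = N + k - |y|` at the origin. The Cauchy determinant of `ζ`, the
values of `q` and the Gram determinant combine to the Gaussian moment. What remains
(`det_cauchyMatrix_sub`, `integral_haarUnitary_ratio_eq_det`) is `det (1 - conj(Ĉ) E Ĉ conj(E))`,
with `Ĉ` the normalized Szegő kernel, whose entries are at most 1 in modulus, and `E` diagonal with
entries `e_i`, namely `φ(ζ_i)` divided by the Blaschke product of the other points at `ζ_i`.

The modulus of `e_i` is `pointFactor`, which is at most `weight`. The perturbation is quadratic in
`e`, which gives the lower bound. Keeping only the coordinate of `e` at `w` makes the perturbation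
rank one, with determinant `1 - |e_w|^2`: this is the main term of the expansion. Each discarded
product `e_m conj e_j` has an index other than `w`, so the error is linear in `Δ'`.

The Weyl formula is obtained from Laplacians, without a change of variables. On polynomials in power
sums, the Laplacian of the unitary group and the Weyl-weighted Laplacian of the torus are given by
one formal expression that does not raise the weight, and both have integral zero. On the torus its
kernel is the constants, so in finite dimension every monomial is a constant plus a Laplacian; both
averages equal that constant. Uniform approximation reaches exponentials of series of power sums,
which include the ratios. -/

namespace CUEField

/-! ### Formal differential calculus of power sum monomials -/

/-- The product of the values `p m` over the entries `m` of a list of indices. -/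
def powerMonomial (p : ℤ → ℂ) : List ℤ → ℂ
  | [] => 1
  | m :: l => p m * powerMonomial p l

/-- The first derivative of `powerMonomial p l` when `p` has derivative `a`. -/
def powerMonomialDeriv (p a : ℤ → ℂ) : List ℤ → ℂ
  | [] => 0
  | m :: l => a m * powerMonomial p l + p m * powerMonomialDeriv p a l

/-- The second derivative of `powerMonomial p l` when `p` has derivatives `a` and `b`. -/
def powerMonomialDeriv₂ (p a b : ℤ → ℂ) : List ℤ → ℂ
  | [] => 0
  | m :: l => b m * powerMonomial p l + 2 * a m * powerMonomialDeriv p a l +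
      p m * powerMonomialDeriv₂ p a b l

/-- The carré du champ of the power sum `p m` and a power sum monomial. -/
def powerCarre (p : ℤ → ℂ) (m : ℤ) : List ℤ → ℂ
  | [] => 0
  | m' :: l => m * m' * p (m + m') * powerMonomial p l + p m' * powerCarre p m l

/-- The Laplacian of the power sum `p m`. -/
noncomputable def powerLaplacian (p : ℤ → ℂ) (m : ℤ) : ℂ :=
  m.natAbs * ∑ s ∈ Finset.range m.natAbs, p (m.sign * s) * p (m.sign * (m.natAbs - s))

/-- The Laplacian of a power sum monomial. -/
noncomputable def powerMonomialLaplacian (p : ℤ → ℂ) : List ℤ → ℂ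
  | [] => 0
  | m :: l => powerLaplacian p m * powerMonomial p l + 2 * powerCarre p m l +
      p m * powerMonomialLaplacian p l

theorem hasDerivAt_powerMonomial {p : ℝ → ℤ → ℂ} {a : ℤ → ℂ} {t : ℝ}
    (hp : ∀ m, HasDerivAt (fun s => p s m) (a m) t) (l : List ℤ) :
    HasDerivAt (fun s => powerMonomial (p s) l) (powerMonomialDeriv (p t) a l) t := by
  induction l with
  | nil => simpa [powerMonomial, powerMonomialDeriv] using hasDerivAt_const t (1 : ℂ)
  | cons m l ih => exact (hp m).mul ih

theorem hasDerivAt_powerMonomialDeriv {p a : ℝ → ℤ → ℂ} {b : ℤ → ℂ} {t : ℝ}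
    (hp : ∀ m, HasDerivAt (fun s => p s m) (a t m) t)
    (ha : ∀ m, HasDerivAt (fun s => a s m) (b m) t) (l : List ℤ) :
    HasDerivAt (fun s => powerMonomialDeriv (p s) (a s) l)
      (powerMonomialDeriv₂ (p t) (a t) b l) t := by
  induction l with
  | nil => simpa [powerMonomialDeriv, powerMonomialDeriv₂] using hasDerivAt_const t (0 : ℂ)
  | cons m l ih =>
    refine (((ha m).mul (hasDerivAt_powerMonomial hp l)).add ((hp m).mul ih)).congr_deriv ?_
    simp only [powerMonomialDeriv₂]
    ring

theorem continuous_powerMonomial {X : Type*} [TopologicalSpace X] {p : X → ℤ → ℂ}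
    (hp : ∀ m, Continuous fun x => p x m) (l : List ℤ) :
    Continuous fun x => powerMonomial (p x) l := by
  induction l with
  | nil => exact continuous_const
  | cons m l ih => exact (hp m).mul ih

theorem continuous_powerMonomialDeriv {X : Type*} [TopologicalSpace X] {p a : X → ℤ → ℂ}
    (hp : ∀ m, Continuous fun x => p x m) (ha : ∀ m, Continuous fun x => a x m) (l : List ℤ) :
    Continuous fun x => powerMonomialDeriv (p x) (a x) l := by
  induction l with
  | nil => exact continuous_const
  | cons m l ih => exact ((ha m).mul (continuous_powerMonomial hp l)).add ((hp m).mul ih)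

theorem continuous_powerMonomialDeriv₂ {X : Type*} [TopologicalSpace X] {p a b : X → ℤ → ℂ}
    (hp : ∀ m, Continuous fun x => p x m) (ha : ∀ m, Continuous fun x => a x m)
    (hb : ∀ m, Continuous fun x => b x m) (l : List ℤ) :
    Continuous fun x => powerMonomialDeriv₂ (p x) (a x) (b x) l := by
  induction l with
  | nil => exact continuous_const
  | cons m l ih =>
    exact (((hb m).mul (continuous_powerMonomial hp l)).add
      ((continuous_const.mul (ha m)).mul (continuous_powerMonomialDeriv hp ha l))).add
      ((hp m).mul ih)

/-! ### One formula for the Laplacian of the group (weight 1) and of the torus (Weyl weight) -/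

section Sum

variable {ι : Type*} [Fintype ι] {p : ℤ → ℂ} {a b : ι → ℤ → ℂ}

/-- Leibniz rule in the second argument. The hypothesis `haa`, where `i` runs over a frame of
directions, is the only input about the space; group and torus both satisfy it. -/
theorem sum_mul_powerMonomialDeriv (haa : ∀ m m', ∑ i, a i m * a i m' = -(m * m' * p (m + m')))
    (m : ℤ) (l : List ℤ) : ∑ i, a i m * powerMonomialDeriv p (a i) l = -powerCarre p m l := by
  induction l with
  | nil => simp [powerMonomialDeriv, powerCarre]
  | cons m' l ih =>
    have h : ∀ i, a i m * powerMonomialDeriv p (a i) (m' :: l) =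
        (a i m * a i m') * powerMonomial p l +
          p m' * (a i m * powerMonomialDeriv p (a i) l) := fun i => by
      simp only [powerMonomialDeriv]; ring
    simp only [h, Finset.sum_add_distrib, ← Finset.sum_mul, ← Finset.mul_sum, haa, ih, powerCarre]
    ring

/-- A weighted sum of second derivatives, with `c i` the derivative of the weight `W`. -/
theorem sum_weighted_powerMonomialDeriv₂ {W : ℂ} {c : ι → ℂ}
    (haa : ∀ m m', ∑ i, a i m * a i m' = -(m * m' * p (m + m')))
    (hb : ∀ m, ∑ i, (c i * a i m + W * b i m) = -(W * powerLaplacian p m)) (l : List ℤ) :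
    ∑ i, (c i * powerMonomialDeriv p (a i) l + W * powerMonomialDeriv₂ p (a i) (b i) l) =
      -(W * powerMonomialLaplacian p l) := by
  induction l with
  | nil => simp [powerMonomialDeriv, powerMonomialDeriv₂, powerMonomialLaplacian]
  | cons m l ih =>
    have h : ∀ i, c i * powerMonomialDeriv p (a i) (m :: l) +
        W * powerMonomialDeriv₂ p (a i) (b i) (m :: l) =
        (c i * a i m + W * b i m) * powerMonomial p l +
          2 * W * (a i m * powerMonomialDeriv p (a i) l) +
          p m * (c i * powerMonomialDeriv p (a i) l +
            W * powerMonomialDeriv₂ p (a i) (b i) l) := fun i => by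
      simp only [powerMonomialDeriv, powerMonomialDeriv₂]; ring
    rw [Finset.sum_congr rfl fun i _ => h i, Finset.sum_add_distrib, Finset.sum_add_distrib,
      ← Finset.sum_mul, ← Finset.mul_sum, ← Finset.mul_sum, hb, ih, sum_mul_powerMonomialDeriv haa]
    simp only [powerMonomialLaplacian]
    ring

end Sum

/-! ### The span of the power sum monomials of bounded weight -/

section Span

variable {Y : Type*} (P : Y → ℤ → ℂ)

/-- The span of the power sum monomials of weight at most `d`. -/
def powerSpan (d : ℕ) : Submodule ℂ (Y → ℂ) :=
  Submodule.span ℂ ((fun (l : List ℤ) y => powerMonomial (P y) l) ''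
    {l | (l.map Int.natAbs).sum ≤ d})

variable {P}

theorem powerMonomial_mem_powerSpan {d : ℕ} {l : List ℤ} (hl : (l.map Int.natAbs).sum ≤ d) :
    (fun y => powerMonomial (P y) l) ∈ powerSpan P d :=
  Submodule.subset_span ⟨l, hl, rfl⟩

theorem powerSpan_mono {d e : ℕ} (h : d ≤ e) : powerSpan P d ≤ powerSpan P e :=
  Submodule.span_mono (Set.image_mono fun _ hl => le_trans hl h)

theorem mul_mem_powerSpan {d : ℕ} {f : Y → ℂ} (m : ℤ) (hf : f ∈ powerSpan P d) :
    (fun y => P y m * f y) ∈ powerSpan P (m.natAbs + d) := by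
  induction hf using Submodule.span_induction with
  | mem f hf =>
    obtain ⟨l, hl, rfl⟩ := hf
    exact powerMonomial_mem_powerSpan (l := m :: l) (by simpa using hl)
  | zero =>
    convert (powerSpan P (m.natAbs + d)).zero_mem using 1
    ext y
    simp
  | add f g _ _ hf hg => simpa [mul_add, Pi.add_def] using Submodule.add_mem _ hf hg
  | smul c f _ hf =>
    have := Submodule.smul_mem _ c hf
    convert this using 1
    ext y
    simp only [Pi.smul_apply, smul_eq_mul]
    ring

/-- Merging two indices into their sum does not raise the weight, by the triangle inequality. -/
theorem powerCarre_mem_powerSpan {d : ℕ} {m : ℤ} {l : List ℤ}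
    (hl : m.natAbs + (l.map Int.natAbs).sum ≤ d) :
    (fun y => powerCarre (P y) m l) ∈ powerSpan P d := by
  induction l generalizing d with
  | nil => exact (powerSpan P d).zero_mem
  | cons m' l ih =>
    simp only [List.map_cons, List.sum_cons] at hl
    have h1 := powerMonomial_mem_powerSpan (P := P) (d := d) (l := (m + m') :: l) (by
      simp only [List.map_cons, List.sum_cons]
      have := Int.natAbs_add_le m m'
      omega)
    have h2 := powerSpan_mono (P := P) (e := d) (by omega)
      (mul_mem_powerSpan m' (ih (le_refl (m.natAbs + (l.map Int.natAbs).sum))))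
    have := Submodule.add_mem _ (Submodule.smul_mem _ ((m : ℂ) * m') h1) h2
    convert this using 1
    ext y
    simp [powerCarre, powerMonomial]
    ring

/-- The Laplacian either splits an index `m` into two of the same sign with absolute values adding
to `|m|`, or merges two indices. Neither raises the weight, so it acts on a space that is
finite-dimensional by `finiteDimensional_powerSpan`. -/
theorem powerMonomialLaplacian_mem_powerSpan {d : ℕ} {l : List ℤ}
    (hl : (l.map Int.natAbs).sum ≤ d) :
    (fun y => powerMonomialLaplacian (P y) l) ∈ powerSpan P d := by
  induction l generalizing d with
  | nil => exact (powerSpan P d).zero_mem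
  | cons m l ih =>
    simp only [List.map_cons, List.sum_cons] at hl
    have h1 : (fun y => powerLaplacian (P y) m * powerMonomial (P y) l) ∈ powerSpan P d := by
      have : (fun y => powerLaplacian (P y) m * powerMonomial (P y) l) =
          (m.natAbs : ℂ) • ∑ s ∈ Finset.range m.natAbs, fun y =>
            powerMonomial (P y) (m.sign * s :: m.sign * (m.natAbs - s) :: l) := by
        ext y
        simp only [powerLaplacian, powerMonomial, Pi.smul_apply, Finset.sum_apply, smul_eq_mul,
          Finset.mul_sum, Finset.sum_mul]
        refine Finset.sum_congr rfl fun s _ => by ring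
      rw [this]
      refine Submodule.smul_mem _ _ (Submodule.sum_mem _ fun s hs =>
        powerMonomial_mem_powerSpan ?_)
      have hs := Finset.mem_range.1 hs
      have hm : m ≠ 0 := by rintro rfl; simp at hs
      have h3 : ((m.natAbs : ℤ) - s).natAbs = m.natAbs - s := by omega
      simp only [List.map_cons, List.sum_cons, Int.natAbs_mul, Int.natAbs_sign_of_ne_zero hm,
        Int.natAbs_natCast, h3]
      omega
    have h2 := powerCarre_mem_powerSpan (P := P) hl
    have h3 := powerSpan_mono (P := P) (e := d) (by omega) (mul_mem_powerSpan m (ih le_rfl))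
    have := Submodule.add_mem _ (Submodule.add_mem _ h1 (Submodule.smul_mem _ (2 : ℂ) h2)) h3
    exact this

/-- Zero indices have weight 0, so infinitely many lists are admitted; since `P y 0` is a constant,
they can be stripped at the price of a scalar. The remaining lists have at most `d` entries, all in
`[-d, d]`. -/
theorem finiteDimensional_powerSpan {c : ℂ} (hP : ∀ y, P y 0 = c) (d : ℕ) :
    FiniteDimensional ℂ (powerSpan P d) := by
  set F : Set (List ℤ) := {l | (∀ m ∈ l, m ≠ 0) ∧ (l.map Int.natAbs).sum ≤ d} with hF
  have hfin : F.Finite := by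
    have h0 : (Set.range fun l : {l : List (Finset.Icc (-d : ℤ) d) // l.length ≤ d} =>
        l.1.map Subtype.val).Finite := by
      have : Finite {l : List (Finset.Icc (-d : ℤ) d) // l.length ≤ d} :=
        List.finite_length_le _ d
      exact Set.finite_range _
    refine h0.subset fun l hl => ?_
    have h1 : ∀ m ∈ l, m ∈ Finset.Icc (-d : ℤ) d := fun m hm => by
      have := List.single_le_sum (l := l.map Int.natAbs) (by simp) m.natAbs
        (List.mem_map_of_mem hm)
      have := hl.2
      rw [Finset.mem_Icc]
      omega
    have h2 : l.length ≤ (l.map Int.natAbs).sum := by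
      have := List.length_le_sum_of_one_le (l.map Int.natAbs) (fun i hi => by
        obtain ⟨m, hm, rfl⟩ := List.mem_map.1 hi
        have := hl.1 m hm
        omega)
      simpa using this
    refine ⟨⟨l.attach.map fun m => ⟨m.1, h1 m.1 m.2⟩, by simpa using h2.trans hl.2⟩, ?_⟩
    simp [List.map_map, Function.comp_def]
  have key : powerSpan P d ≤ Submodule.span ℂ
      ((fun (l : List ℤ) y => powerMonomial (P y) l) '' F) := by
    refine Submodule.span_le.2 ?_
    rintro _ ⟨l, hl, rfl⟩
    have h1 : ∀ l : List ℤ, ∃ (c' : ℂ) (l' : List ℤ), (∀ m ∈ l', m ≠ 0) ∧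
        (l'.map Int.natAbs).sum = (l.map Int.natAbs).sum ∧
        (fun y => powerMonomial (P y) l) = c' • fun y => powerMonomial (P y) l' := by
      intro l
      induction l with
      | nil => exact ⟨1, [], by simp, rfl, by simp⟩
      | cons m l ih =>
        obtain ⟨c', l', h1, h2, h3⟩ := ih
        by_cases hm : m = 0
        · subst hm
          refine ⟨c * c', l', h1, by simpa using h2, ?_⟩
          ext y
          have := congrFun h3 y
          simp only [Pi.smul_apply, smul_eq_mul, powerMonomial, hP] at this ⊢
          rw [this, mul_assoc]
        · refine ⟨c', m :: l', by simpa [hm] using h1, by simp [h2], ?_⟩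
          ext y
          have := congrFun h3 y
          simp only [Pi.smul_apply, smul_eq_mul, powerMonomial] at this ⊢
          rw [this]; ring
    obtain ⟨c', l', h1, h2, h3⟩ := h1 l
    simp only [SetLike.mem_coe]
    rw [h3]
    exact Submodule.smul_mem _ _ (Submodule.subset_span ⟨l', ⟨h1, h2 ▸ hl⟩, rfl⟩)
  have : FiniteDimensional ℂ (Submodule.span ℂ
      ((fun (l : List ℤ) (y : Y) => powerMonomial (P y) l) '' F)) :=
    FiniteDimensional.span_of_finite ℂ (hfin.image _)
  exact Submodule.finiteDimensional_of_le key

end Span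

/-! ### Integrals of derivatives along measure preserving flows -/

/-- The integral of `F ∘ T t` does not depend on `t`; differentiate it under the integral sign at `t
= 0`. -/
theorem integral_eq_zero_of_flow {X : Type*} [TopologicalSpace X] [CompactSpace X]
    [MeasurableSpace X] [BorelSpace X] {μ : Measure X} [IsFiniteMeasure μ] {T : ℝ → X → X}
    (hT : ∀ t, MeasurePreserving (T t) μ μ) (hT0 : ∀ x, T 0 x = x) {F F' : X → ℂ}
    (hF : Continuous F) (hF' : Continuous F')
    (h : ∀ x t, HasDerivAt (fun s => F (T s x)) (F' (T t x)) t) : ∫ x, F' x ∂μ = 0 := by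
  have hb : ∀ {f : X → ℂ}, Continuous f → ∃ C, ∀ x, ‖f x‖ ≤ C := fun hf => by
    obtain ⟨C, hC⟩ := (isCompact_range hf).isBounded.exists_norm_le
    exact ⟨C, fun x => hC _ ⟨x, rfl⟩⟩
  obtain ⟨C, hC⟩ := hb hF'
  obtain ⟨C', hC'⟩ := hb hF
  have hmeas : ∀ {f : X → ℂ}, Continuous f → ∀ t,
      AEStronglyMeasurable (fun x => f (T t x)) μ := fun hf t =>
    (hf.measurable.comp (hT t).measurable).aestronglyMeasurable
  have key := hasDerivAt_integral_of_dominated_loc_of_deriv_le (μ := μ) (x₀ := (0 : ℝ))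
    (s := Set.univ) (F := fun t x => F (T t x)) (F' := fun t x => F' (T t x))
    (bound := fun _ => C) Filter.univ_mem (Filter.Eventually.of_forall fun t => hmeas hF t)
    (Integrable.of_bound (hmeas hF 0) C' (Filter.Eventually.of_forall fun x => hC' _))
    (hmeas hF' 0) (Filter.Eventually.of_forall fun x t _ => hC _) (integrable_const C)
    (Filter.Eventually.of_forall fun x t _ => h x t)
  have hconst : ∀ t, ∫ x, F (T t x) ∂μ = ∫ x, F x ∂μ := fun t => by
    conv_rhs => rw [← (hT t).map_eq]
    rw [integral_map (hT t).measurable.aemeasurable hF.measurable.aestronglyMeasurable]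
  simp only [hconst, hT0] at key
  exact (key.2.unique (hasDerivAt_const _ _))

/-! ### The Laplacian on the unitary group -/

section UnitaryGroup

open Matrix

variable {N : ℕ}

local notation "𝕌" => Matrix.unitaryGroup (Fin N) ℂ

/-- The power sums of the eigenvalues of a unitary matrix. -/
noncomputable def unitaryPowerSum (A : 𝕌) (m : ℤ) : ℂ :=
  ((A ^ m : 𝕌) : Matrix (Fin N) (Fin N) ℂ).trace

theorem unitaryPowerSum_neg (A : 𝕌) (m : ℤ) :
    unitaryPowerSum A (-m) = conj (unitaryPowerSum A m) := by
  rw [unitaryPowerSum, unitaryPowerSum, _root_.zpow_neg]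
  exact Matrix.trace_conjTranspose _

theorem continuous_coe_zpow (m : ℤ) :
    Continuous fun A : 𝕌 => ((A ^ m : 𝕌) : Matrix (Fin N) (Fin N) ℂ) :=
  continuous_subtype_val.comp (continuous_zpow m)

theorem continuous_unitaryPowerSum (m : ℤ) : Continuous fun A : 𝕌 => unitaryPowerSum A m :=
  (continuous_coe_zpow m).matrix_trace

theorem exp_smul_mem_unitaryGroup {X : Matrix (Fin N) (Fin N) ℂ} (hX : Xᴴ = -X) (t : ℝ) :
    NormedSpace.exp (t • X) ∈ Matrix.unitaryGroup (Fin N) ℂ := by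
  rw [Matrix.mem_unitaryGroup_iff, star_eq_conjTranspose, ← Matrix.exp_conjTranspose,
    conjTranspose_smul, hX, ← Matrix.exp_add_of_commute]
  · simp
  · simp [Commute, SemiconjBy]

/-- The flow `A ↦ exp (t X) A` on the unitary group, for `X` skew-Hermitian. -/
noncomputable def unitaryFlow {X : Matrix (Fin N) (Fin N) ℂ} (hX : Xᴴ = -X) (t : ℝ) (A : 𝕌) : 𝕌 :=
  ⟨NormedSpace.exp (t • X), exp_smul_mem_unitaryGroup hX t⟩ * A

/-- The derivative of the power sums in the direction `X`. -/
noncomputable def unitaryPowerSumDeriv (X : Matrix (Fin N) (Fin N) ℂ) (A : 𝕌) (m : ℤ) : ℂ :=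
  m * (X * ((A ^ m : 𝕌) : Matrix (Fin N) (Fin N) ℂ)).trace

/-- The second derivative of the power sums of nonnegative index in the direction `X`. -/
noncomputable def unitaryPowerSumDeriv₂Nat (X : Matrix (Fin N) (Fin N) ℂ) (A : 𝕌) (n : ℕ) : ℂ :=
  n * ∑ s ∈ Finset.range n, (X * (((A : Matrix (Fin N) (Fin N) ℂ) ^ s) *
    X * (A : Matrix (Fin N) (Fin N) ℂ) ^ (n - s))).trace

/-- The second derivative of the power sums in the direction `X`. -/
noncomputable def unitaryPowerSumDeriv₂ (X : Matrix (Fin N) (Fin N) ℂ) (A : 𝕌) (m : ℤ) : ℂ :=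
  if 0 ≤ m then unitaryPowerSumDeriv₂Nat X A m.natAbs
    else conj (unitaryPowerSumDeriv₂Nat X A m.natAbs)

/-- Skew-Hermiticity of `X` makes conjugation exchange the indices `m` and `-m`, so derivatives need
only be computed for natural powers. -/
theorem unitaryPowerSumDeriv_neg {X : Matrix (Fin N) (Fin N) ℂ} (hX : Xᴴ = -X) (A : 𝕌) (m : ℤ) :
    unitaryPowerSumDeriv X A (-m) = conj (unitaryPowerSumDeriv X A m) := by
  have h : ((A ^ (-m) : 𝕌) : Matrix (Fin N) (Fin N) ℂ) =
      ((A ^ m : 𝕌) : Matrix (Fin N) (Fin N) ℂ)ᴴ := by rw [_root_.zpow_neg]; rfl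
  have h2 : conj ((X * ((A ^ m : 𝕌) : Matrix (Fin N) (Fin N) ℂ)).trace) =
      ((X * ((A ^ m : 𝕌) : Matrix (Fin N) (Fin N) ℂ))ᴴ).trace :=
    (Matrix.trace_conjTranspose _).symm
  rw [unitaryPowerSumDeriv, unitaryPowerSumDeriv, map_mul, h2, conjTranspose_mul, hX,
    Matrix.mul_neg, trace_neg, h, Matrix.trace_mul_comm]
  simp

/-! ### Derivatives of traces of powers along one-parameter flows -/

section Deriv

open scoped Matrix.Norms.Operator

/-- `X` need not commute with `B`: it is inserted in front of each of the `n` factors in turn, so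
`s` runs below `n` and the right-hand power is never zero. -/
theorem hasDerivAt_matrix_pow {B : ℝ → Matrix (Fin N) (Fin N) ℂ} {X : Matrix (Fin N) (Fin N) ℂ}
    {t : ℝ} (h : HasDerivAt B (X * B t) t) (n : ℕ) :
    HasDerivAt (fun s => B s ^ n) (∑ s ∈ Finset.range n, B t ^ s * X * B t ^ (n - s)) t := by
  induction n with
  | zero =>
    simp only [pow_zero, Finset.range_zero, Finset.sum_empty]
    exact hasDerivAt_const t (1 : Matrix (Fin N) (Fin N) ℂ)
  | succ n ih =>
    simp only [pow_succ (B _) n]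
    refine (ih.mul h).congr_deriv ?_
    rw [Finset.sum_range_succ, Finset.sum_mul]
    congr 1
    · refine Finset.sum_congr rfl fun s hs => ?_
      rw [Nat.succ_sub (Finset.mem_range.1 hs).le, pow_succ, mul_assoc _ (B t ^ (n - s)) (B t)]
    · simp [mul_assoc]

theorem hasDerivAt_trace {B : ℝ → Matrix (Fin N) (Fin N) ℂ} {B' : Matrix (Fin N) (Fin N) ℂ}
    {t : ℝ} (h : HasDerivAt B B' t) : HasDerivAt (fun s => (B s).trace) B'.trace t :=
  (LinearMap.toContinuousLinearMap (Matrix.traceLinearMap (Fin N) ℝ ℂ)).hasFDerivAt.comp_hasDerivAt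
    t h

theorem hasDerivAt_unitaryFlow {X : Matrix (Fin N) (Fin N) ℂ} (hX : Xᴴ = -X) (A : 𝕌) (t : ℝ) :
    HasDerivAt (fun s => (unitaryFlow hX s A : Matrix (Fin N) (Fin N) ℂ))
      (X * (unitaryFlow hX t A : Matrix (Fin N) (Fin N) ℂ)) t := by
  have := (hasDerivAt_exp_smul_const' (𝕂 := ℝ) X t).mul_const (A : Matrix (Fin N) (Fin N) ℂ)
  rw [mul_assoc] at this
  exact this

theorem coe_zpow_natCast (A : 𝕌) (n : ℕ) :
    ((A ^ (n : ℤ) : 𝕌) : Matrix (Fin N) (Fin N) ℂ) = (A : Matrix (Fin N) (Fin N) ℂ) ^ n := by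
  rw [zpow_natCast]; rfl

theorem hasDerivAt_unitaryPowerSum_nat {X : Matrix (Fin N) (Fin N) ℂ} (hX : Xᴴ = -X) (A : 𝕌)
    (t : ℝ) (n : ℕ) : HasDerivAt (fun s => unitaryPowerSum (unitaryFlow hX s A) n)
      (unitaryPowerSumDeriv X (unitaryFlow hX t A) n) t := by
  simp only [unitaryPowerSum, unitaryPowerSumDeriv, coe_zpow_natCast]
  refine (hasDerivAt_trace (hasDerivAt_matrix_pow (hasDerivAt_unitaryFlow hX A t) n)).congr_deriv ?_
  rw [trace_sum]
  -- By cyclicity of the trace all `n` insertions contribute the same term.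
  rw [Finset.sum_congr rfl fun s hs => by
    rw [mul_assoc, Matrix.trace_mul_comm, mul_assoc, ← pow_add,
      Nat.sub_add_cancel (Finset.mem_range.1 hs).le]]
  simp

theorem hasDerivAt_unitaryPowerSumDeriv_nat {X : Matrix (Fin N) (Fin N) ℂ} (hX : Xᴴ = -X) (A : 𝕌)
    (t : ℝ) (n : ℕ) : HasDerivAt (fun s => unitaryPowerSumDeriv X (unitaryFlow hX s A) n)
      (unitaryPowerSumDeriv₂Nat X (unitaryFlow hX t A) n) t := by
  simp only [unitaryPowerSumDeriv, unitaryPowerSumDeriv₂Nat, coe_zpow_natCast]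
  have := (hasDerivAt_trace ((hasDerivAt_matrix_pow
    (hasDerivAt_unitaryFlow hX A t) n).const_mul X)).const_mul (n : ℂ)
  refine (this.congr_deriv ?_)
  rw [Finset.mul_sum, trace_sum]

theorem hasDerivAt_unitaryPowerSum {X : Matrix (Fin N) (Fin N) ℂ} (hX : Xᴴ = -X) (A : 𝕌) (t : ℝ)
    (m : ℤ) : HasDerivAt (fun s => unitaryPowerSum (unitaryFlow hX s A) m)
      (unitaryPowerSumDeriv X (unitaryFlow hX t A) m) t := by
  obtain ⟨n, rfl | rfl⟩ := m.eq_nat_or_neg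
  · exact hasDerivAt_unitaryPowerSum_nat hX A t n
  · simp only [unitaryPowerSum_neg, unitaryPowerSumDeriv_neg hX]
    exact (hasDerivAt_unitaryPowerSum_nat hX A t n).star

theorem hasDerivAt_unitaryPowerSumDeriv {X : Matrix (Fin N) (Fin N) ℂ} (hX : Xᴴ = -X) (A : 𝕌)
    (t : ℝ) (m : ℤ) : HasDerivAt (fun s => unitaryPowerSumDeriv X (unitaryFlow hX s A) m)
      (unitaryPowerSumDeriv₂ X (unitaryFlow hX t A) m) t := by
  by_cases hm : 0 ≤ m
  · obtain ⟨n, rfl⟩ := Int.eq_ofNat_of_zero_le hm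
    simpa [unitaryPowerSumDeriv₂] using hasDerivAt_unitaryPowerSumDeriv_nat hX A t n
  · obtain ⟨n, hn⟩ := Int.eq_ofNat_of_zero_le (a := -m) (by omega)
    obtain rfl : m = -(n : ℤ) := by omega
    simp only [unitaryPowerSumDeriv_neg hX, unitaryPowerSumDeriv₂, hm, if_false, Int.natAbs_neg,
      Int.natAbs_natCast]
    exact (hasDerivAt_unitaryPowerSumDeriv_nat hX A t n).star

end Deriv

theorem continuous_unitaryPowerSumDeriv (X : Matrix (Fin N) (Fin N) ℂ) (m : ℤ) :
    Continuous fun A : 𝕌 => unitaryPowerSumDeriv X A m :=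
  continuous_const.mul (continuous_const.matrix_mul (continuous_coe_zpow m)).matrix_trace

theorem continuous_unitaryPowerSumDeriv₂ (X : Matrix (Fin N) (Fin N) ℂ) (m : ℤ) :
    Continuous fun A : 𝕌 => unitaryPowerSumDeriv₂ X A m := by
  have h : ∀ n, Continuous fun A : 𝕌 => unitaryPowerSumDeriv₂Nat X A n := fun n => by
    have : Continuous fun A : 𝕌 => (A : Matrix (Fin N) (Fin N) ℂ) := continuous_subtype_val
    refine continuous_const.mul (continuous_finsetSum _ fun s _ => ?_)
    exact (continuous_const.matrix_mul (((this.pow s).matrix_mul continuous_const).matrix_mul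
      (this.pow (n - s)))).matrix_trace
  by_cases hm : 0 ≤ m
  · simpa only [unitaryPowerSumDeriv₂, hm, if_true] using h _
  · simpa only [unitaryPowerSumDeriv₂, hm, if_false, Function.comp_def] using
      Complex.continuous_conj.comp (h m.natAbs)

/-- A family of skew-Hermitian matrices whose Casimir element is that of the unitary group. -/
noncomputable def skewFamily : (Fin N × Fin N) × Bool → Matrix (Fin N) (Fin N) ℂ
  | (⟨a, b⟩, true) => (2⁻¹ : ℂ) • (single a b 1 - single b a 1)
  | (⟨a, b⟩, false) => (Complex.I / 2) • (single a b 1 + single b a 1)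

theorem conjTranspose_skewFamily (i : (Fin N × Fin N) × Bool) :
    (skewFamily i)ᴴ = -skewFamily i := by
  obtain ⟨⟨a, b⟩, _ | _⟩ := i
  · simp only [skewFamily, conjTranspose_smul, conjTranspose_add, conjTranspose_single, star_one]
    rw [← neg_smul, add_comm]
    simp [neg_div]
  · simp only [skewFamily, conjTranspose_smul, conjTranspose_sub, conjTranspose_single, star_one]
    rw [← smul_neg, neg_sub]
    simp

/-- For each ordered pair the square terms of the real and imaginary elements cancel and the mixed
terms add up. Every unordered pair occurs twice, which the factors `1/2` in `skewFamily` compensate.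
-/
theorem sum_skewFamily (β : LinearMap.BilinForm ℂ (Matrix (Fin N) (Fin N) ℂ)) :
    ∑ i, β (skewFamily i) (skewFamily i) = -∑ a, ∑ b, β (single a b 1) (single b a 1) := by
  rw [Fintype.sum_prod_type, Fintype.sum_prod_type]
  have h1 : ∑ a, ∑ b, β (single b a (1 : ℂ)) (single a b 1) =
      ∑ a, ∑ b, β (single a b (1 : ℂ)) (single b a 1) := Finset.sum_comm
  have h : ∀ a b : Fin N, ∑ c : Bool, β (skewFamily ((a, b), c)) (skewFamily ((a, b), c)) =
      -(2⁻¹ * β (single a b 1) (single b a 1) + 2⁻¹ * β (single b a 1) (single a b 1)) := by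
    intro a b
    have hI : Complex.I / 2 * (Complex.I / 2) = -(1 / 4) := by
      rw [div_mul_div_comm, Complex.I_mul_I]; norm_num
    simp only [Fintype.sum_bool, skewFamily, map_smul, map_add, map_sub, LinearMap.smul_apply,
      LinearMap.add_apply, LinearMap.sub_apply, smul_eq_mul]
    linear_combination (β (single a b 1) (single a b 1) + β (single a b 1) (single b a 1) +
      β (single b a 1) (single a b 1) + β (single b a 1) (single b a 1)) * hI
  simp only [h, Finset.sum_neg_distrib, Finset.sum_add_distrib, ← Finset.mul_sum, h1]
  ring

/-- First contraction rule: two traces merge into one. In the second,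
`sum_skewFamily_trace_mul_mul`, one trace splits into two. They yield the carré du champ and the
Laplacian of power sums respectively. -/
theorem sum_skewFamily_trace_mul_trace (P Q : Matrix (Fin N) (Fin N) ℂ) :
    ∑ i, (skewFamily i * P).trace * (skewFamily i * Q).trace = -(P * Q).trace := by
  have := sum_skewFamily (N := N) (LinearMap.mk₂ ℂ
    (fun X Y => (X * P).trace * (Y * Q).trace) (by intros; simp [add_mul])
    (by intros; simp [mul_assoc]) (by intros; simp [add_mul, mul_add])
    (by intros; simp [mul_left_comm]))
  simp only [LinearMap.mk₂_apply] at this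
  rw [this, Matrix.trace, Finset.sum_comm]
  simp [Matrix.trace_single_mul, Matrix.mul_apply, mul_comm]

theorem sum_skewFamily_trace_mul_mul (P Q : Matrix (Fin N) (Fin N) ℂ) :
    ∑ i, (skewFamily i * (P * skewFamily i * Q)).trace = -(P.trace * Q.trace) := by
  have := sum_skewFamily (N := N) (LinearMap.mk₂ ℂ
    (fun X Y => (X * (P * Y * Q)).trace) (by intros; simp [add_mul])
    (by intros; simp) (by intros; simp [add_mul, mul_add])
    (by intros; simp))
  simp only [LinearMap.mk₂_apply] at this
  rw [this]
  have h : ∀ a b : Fin N, (single a b (1 : ℂ) * (P * single b a 1 * Q)).trace = P b b * Q a a := by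
    intro a b
    rw [Matrix.trace_single_mul, one_smul, mul_assoc, Matrix.mul_apply, Finset.sum_eq_single b]
    · simp
    · intro c _ hc
      simp [Matrix.single_mul_apply_of_ne, hc]
    · simp
  simp only [h]
  rw [Finset.sum_comm, Matrix.trace, Matrix.trace, Finset.sum_mul_sum]
  rfl

theorem sum_unitaryPowerSumDeriv (A : 𝕌) (m m' : ℤ) :
    ∑ i, unitaryPowerSumDeriv (skewFamily i) A m * unitaryPowerSumDeriv (skewFamily i) A m' =
      -(m * m' * unitaryPowerSum A (m + m')) := by
  have h : ∀ i, unitaryPowerSumDeriv (skewFamily i) A m * unitaryPowerSumDeriv (skewFamily i) A m' =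
      (m * m') * ((skewFamily i * ((A ^ m : 𝕌) : Matrix (Fin N) (Fin N) ℂ)).trace *
        (skewFamily i * ((A ^ m' : 𝕌) : Matrix (Fin N) (Fin N) ℂ)).trace) := fun i => by
    simp only [unitaryPowerSumDeriv]; ring
  rw [Finset.sum_congr rfl fun i _ => h i, ← Finset.mul_sum, sum_skewFamily_trace_mul_trace,
    unitaryPowerSum, _root_.zpow_add, mul_neg]
  rfl

theorem sum_unitaryPowerSumDeriv₂ (A : 𝕌) (m : ℤ) :
    ∑ i, unitaryPowerSumDeriv₂ (skewFamily i) A m = -powerLaplacian (unitaryPowerSum A) m := by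
  have h : ∀ n : ℕ, ∑ i, unitaryPowerSumDeriv₂Nat (skewFamily i) A n =
      -(n * ∑ s ∈ Finset.range n, unitaryPowerSum A s * unitaryPowerSum A (n - s)) := fun n => by
    simp only [unitaryPowerSumDeriv₂Nat, ← Finset.mul_sum]
    rw [Finset.sum_comm, ← mul_neg, ← Finset.sum_neg_distrib]
    congr 1
    refine Finset.sum_congr rfl fun s hs => ?_
    rw [sum_skewFamily_trace_mul_mul, ← Nat.cast_sub (Finset.mem_range.1 hs).le]
    simp only [unitaryPowerSum, coe_zpow_natCast]
  rcases lt_trichotomy m 0 with hm | rfl | hm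
  · simp only [unitaryPowerSumDeriv₂, not_le.2 hm, if_false]
    rw [← map_sum, h]
    simp only [powerLaplacian, Int.sign_eq_neg_one_of_neg hm, map_neg, map_mul, map_sum,
      neg_one_mul, unitaryPowerSum_neg, Complex.conj_natCast]
  · simp [unitaryPowerSumDeriv₂, unitaryPowerSumDeriv₂Nat, powerLaplacian]
  · simp only [unitaryPowerSumDeriv₂, hm.le, if_true, h, powerLaplacian,
      Int.sign_eq_one_of_pos hm, one_mul]

theorem sum_powerMonomialDeriv₂_unitary (A : 𝕌) (l : List ℤ) :
    ∑ i, powerMonomialDeriv₂ (unitaryPowerSum A) (unitaryPowerSumDeriv (skewFamily i) A)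
      (unitaryPowerSumDeriv₂ (skewFamily i) A) l =
      -powerMonomialLaplacian (unitaryPowerSum A) l := by
  have := sum_weighted_powerMonomialDeriv₂ (p := unitaryPowerSum A) (W := 1) (c := fun _ => 0)
    (a := fun i => unitaryPowerSumDeriv (skewFamily i) A)
    (b := fun i => unitaryPowerSumDeriv₂ (skewFamily i) A) (sum_unitaryPowerSumDeriv A)
    (fun m => by simpa using sum_unitaryPowerSumDeriv₂ A m) l
  simpa using this

theorem measurePreserving_unitaryFlow {X : Matrix (Fin N) (Fin N) ℂ} (hX : Xᴴ = -X) (t : ℝ) :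
    MeasurePreserving (unitaryFlow hX t) (haarUnitary N) (haarUnitary N) := by
  have : (haarUnitary N).IsMulLeftInvariant := by
    unfold haarUnitary; infer_instance
  exact measurePreserving_mul_left (haarUnitary N) _

/-- The Laplacian of a power sum monomial has Haar integral zero. -/
theorem integral_haarUnitary_powerMonomialLaplacian (l : List ℤ) :
    ∫ A, powerMonomialLaplacian (unitaryPowerSum A) l ∂haarUnitary N = 0 := by
  have hc : ∀ i, Continuous fun A : 𝕌 => powerMonomialDeriv₂ (unitaryPowerSum A)
      (unitaryPowerSumDeriv (skewFamily i) A) (unitaryPowerSumDeriv₂ (skewFamily i) A) l :=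
    fun i => continuous_powerMonomialDeriv₂ continuous_unitaryPowerSum
      (continuous_unitaryPowerSumDeriv _) (continuous_unitaryPowerSumDeriv₂ _) l
  have h : ∀ i, ∫ A : 𝕌, powerMonomialDeriv₂ (unitaryPowerSum A)
      (unitaryPowerSumDeriv (skewFamily i) A) (unitaryPowerSumDeriv₂ (skewFamily i) A) l
      ∂haarUnitary N = 0 := fun i =>
    integral_eq_zero_of_flow (T := unitaryFlow (conjTranspose_skewFamily i))
      (measurePreserving_unitaryFlow _) (fun A => by simp [unitaryFlow])
      (continuous_powerMonomialDeriv continuous_unitaryPowerSum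
        (continuous_unitaryPowerSumDeriv (skewFamily i)) l) (hc i)
      fun A t => hasDerivAt_powerMonomialDeriv (hasDerivAt_unitaryPowerSum _ A t)
        (hasDerivAt_unitaryPowerSumDeriv _ A t) l
  have h2 := integral_finsetSum (μ := haarUnitary N) Finset.univ fun i _ =>
    (hc i).integrable_of_hasCompactSupport (HasCompactSupport.of_compactSpace _)
  simp only [h, Finset.sum_const_zero, sum_powerMonomialDeriv₂_unitary, integral_neg] at h2
  exact neg_eq_zero.1 h2

end UnitaryGroup

/-! ### The torus and the Weyl density -/

section Torus

variable {N : ℕ}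

/-- The uniform probability measure on the torus. -/
noncomputable def torusMeasure (N : ℕ) : Measure (Fin N → UnitAddCircle) :=
  Measure.pi fun _ => AddCircle.haarAddCircle

instance instIsProbabilityMeasureTorusMeasure (N : ℕ) : IsProbabilityMeasure (torusMeasure N) := by
  unfold torusMeasure; infer_instance

instance instIsOpenPosMeasureTorusMeasure (N : ℕ) : (torusMeasure N).IsOpenPosMeasure := by
  unfold torusMeasure; infer_instance

/-- A point of the circle as a complex number. -/
noncomputable def circlePoint (θ : UnitAddCircle) : ℂ := AddCircle.toCircle θ

theorem norm_circlePoint (θ : UnitAddCircle) : ‖circlePoint θ‖ = 1 := Circle.norm_coe _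

theorem circlePoint_ne_zero (θ : UnitAddCircle) : circlePoint θ ≠ 0 := Circle.coe_ne_zero _

theorem conj_circlePoint (θ : UnitAddCircle) : conj (circlePoint θ) = (circlePoint θ)⁻¹ :=
  (Circle.coe_inv_eq_conj _).symm

theorem continuous_circlePoint : Continuous circlePoint :=
  continuous_subtype_val.comp AddCircle.continuous_toCircle

theorem circlePoint_injective : Function.Injective circlePoint :=
  Subtype.val_injective.comp (AddCircle.injective_toCircle one_ne_zero)

theorem continuous_circlePoint_apply_zpow (i : Fin N) (m : ℤ) :
    Continuous fun x : Fin N → UnitAddCircle => circlePoint (x i) ^ m :=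
  (continuous_circlePoint.comp (continuous_apply i)).zpow₀ m fun _ => Or.inl (circlePoint_ne_zero _)

/-- The power sums of a point of the torus. -/
noncomputable def torusPowerSum (x : Fin N → UnitAddCircle) (m : ℤ) : ℂ :=
  ∑ i, circlePoint (x i) ^ m

/-- The rotation flow in the coordinate `k`. -/
noncomputable def torusFlow (k : Fin N) (t : ℝ) (x : Fin N → UnitAddCircle) :
    Fin N → UnitAddCircle :=
  -- `UnitAddCircle` has period 1; dividing by `2π` makes the flow rotate at unit angular speed.
  (Pi.single k ((t / (2 * Real.pi) : ℝ) : UnitAddCircle)) + x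

theorem measurePreserving_torusFlow (k : Fin N) (t : ℝ) :
    MeasurePreserving (torusFlow k t) (torusMeasure N) (torusMeasure N) := by
  have : (torusMeasure N).IsAddLeftInvariant := by unfold torusMeasure; infer_instance
  exact measurePreserving_add_left (torusMeasure N) _

theorem torusFlow_zero (k : Fin N) (x : Fin N → UnitAddCircle) : torusFlow k 0 x = x := by
  simp [torusFlow]

theorem circlePoint_torusFlow (k : Fin N) (t : ℝ) (x : Fin N → UnitAddCircle) (i : Fin N) :
    circlePoint (torusFlow k t x i) =
      Complex.exp ((if i = k then Complex.I else 0) * t) * circlePoint (x i) := by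
  by_cases h : i = k
  · subst h
    have : 2 * Real.pi / 1 * (t / (2 * Real.pi)) = t := by
      have := Real.pi_pos; field_simp
    simp only [torusFlow, Pi.add_apply, Pi.single_eq_same, circlePoint, AddCircle.toCircle_add,
      AddCircle.toCircle_apply_mk, this, if_true, Circle.coe_mul, Circle.coe_exp]
    rw [mul_comm Complex.I]
  · simp [torusFlow, h]

theorem hasDerivAt_circlePoint_zpow (k : Fin N) (x : Fin N → UnitAddCircle) (t : ℝ) (i : Fin N)
    (m : ℤ) : HasDerivAt (fun s => circlePoint (torusFlow k s x i) ^ m)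
      ((if i = k then Complex.I else 0) * m * circlePoint (torusFlow k t x i) ^ m) t := by
  simp only [circlePoint_torusFlow, mul_zpow, ← Complex.exp_int_mul]
  have h1 : HasDerivAt (fun s : ℝ => (m : ℂ) * ((if i = k then Complex.I else 0) * (s : ℂ)))
      (m * ((if i = k then Complex.I else 0) * 1)) t :=
    ((Complex.ofRealCLM.hasDerivAt (x := t)).const_mul _).const_mul _
  refine (h1.cexp.mul_const (circlePoint (x i) ^ m)).congr_deriv ?_
  ring

/-- The derivative of the power sums in the coordinate `k`. -/
noncomputable def torusPowerSumDeriv (k : Fin N) (x : Fin N → UnitAddCircle) (m : ℤ) : ℂ :=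
  Complex.I * m * circlePoint (x k) ^ m

/-- The second derivative of the power sums in the coordinate `k`. -/
noncomputable def torusPowerSumDeriv₂ (k : Fin N) (x : Fin N → UnitAddCircle) (m : ℤ) : ℂ :=
  -(m ^ 2 * circlePoint (x k) ^ m)

theorem continuous_torusPowerSum (m : ℤ) :
    Continuous fun x : Fin N → UnitAddCircle => torusPowerSum x m :=
  continuous_finsetSum _ fun i _ => continuous_circlePoint_apply_zpow i m

theorem continuous_torusPowerSumDeriv (k : Fin N) (m : ℤ) :
    Continuous fun x : Fin N → UnitAddCircle => torusPowerSumDeriv k x m :=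
  continuous_const.mul (continuous_circlePoint_apply_zpow k m)

theorem continuous_torusPowerSumDeriv₂ (k : Fin N) (m : ℤ) :
    Continuous fun x : Fin N → UnitAddCircle => torusPowerSumDeriv₂ k x m :=
  (continuous_const.mul (continuous_circlePoint_apply_zpow k m)).neg

theorem hasDerivAt_torusPowerSum (k : Fin N) (x : Fin N → UnitAddCircle) (t : ℝ) (m : ℤ) :
    HasDerivAt (fun s => torusPowerSum (torusFlow k s x) m)
      (torusPowerSumDeriv k (torusFlow k t x) m) t := by
  refine (HasDerivAt.fun_sum fun i _ => hasDerivAt_circlePoint_zpow k x t i m).congr_deriv ?_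
  rw [Finset.sum_eq_single k]
  · simp [torusPowerSumDeriv]
  · intro i _ hi; simp [hi]
  · simp

theorem hasDerivAt_torusPowerSumDeriv (k : Fin N) (x : Fin N → UnitAddCircle) (t : ℝ) (m : ℤ) :
    HasDerivAt (fun s => torusPowerSumDeriv k (torusFlow k s x) m)
      (torusPowerSumDeriv₂ k (torusFlow k t x) m) t := by
  refine ((hasDerivAt_circlePoint_zpow k x t k m).const_mul (Complex.I * m)).congr_deriv ?_
  simp only [if_true, torusPowerSumDeriv₂]
  linear_combination (m ^ 2 * circlePoint (torusFlow k t x k) ^ m : ℂ) * Complex.I_mul_I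

/-- The pairs of indices `i < j`. -/
def ltPairs (N : ℕ) : Finset (Fin N × Fin N) := Finset.univ.filter fun q => q.1 < q.2

/-- The factor `|z_i - z_j|²` of the Weyl density, as a Laurent polynomial. -/
noncomputable def weylFactor (x : Fin N → UnitAddCircle) (q : Fin N × Fin N) : ℂ :=
  2 - circlePoint (x q.1) ^ (1 : ℤ) * circlePoint (x q.2) ^ (-1 : ℤ) -
    circlePoint (x q.2) ^ (1 : ℤ) * circlePoint (x q.1) ^ (-1 : ℤ)

/-- The derivative of `weylFactor` in the first of its two coordinates. -/
noncomputable def weylFactorDeriv (x : Fin N → UnitAddCircle) (q : Fin N × Fin N) : ℂ :=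
  Complex.I * (circlePoint (x q.2) ^ (1 : ℤ) * circlePoint (x q.1) ^ (-1 : ℤ) -
    circlePoint (x q.1) ^ (1 : ℤ) * circlePoint (x q.2) ^ (-1 : ℤ))

/-- The Weyl density `∏_{i < j} |z_i - z_j|²` on the torus. -/
noncomputable def weylDensity (x : Fin N → UnitAddCircle) : ℂ := ∏ q ∈ ltPairs N, weylFactor x q

/-- The derivative of the Weyl density in the coordinate `k`. -/
noncomputable def weylDensityDeriv (k : Fin N) (x : Fin N → UnitAddCircle) : ℂ :=
  ∑ q ∈ ltPairs N, (∏ r ∈ (ltPairs N).erase q, weylFactor x r) *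
    (((if q.1 = k then 1 else 0) - (if q.2 = k then 1 else 0)) * weylFactorDeriv x q)

theorem weylFactor_eq (x : Fin N → UnitAddCircle) (q : Fin N × Fin N) :
    weylFactor x q = ((‖circlePoint (x q.1) - circlePoint (x q.2)‖ ^ 2 : ℝ) : ℂ) := by
  have h1 := circlePoint_ne_zero (x q.1)
  have h2 := circlePoint_ne_zero (x q.2)
  rw [← Complex.normSq_eq_norm_sq, ← Complex.mul_conj, map_sub, conj_circlePoint,
    conj_circlePoint, weylFactor, zpow_one, zpow_one, zpow_neg_one, zpow_neg_one]
  field_simp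
  ring

theorem weylDensity_eq (x : Fin N → UnitAddCircle) : weylDensity x =
    ((∏ q ∈ ltPairs N, ‖circlePoint (x q.1) - circlePoint (x q.2)‖ ^ 2 : ℝ) : ℂ) := by
  rw [weylDensity, Complex.ofReal_prod]
  exact Finset.prod_congr rfl fun q _ => weylFactor_eq x q

theorem continuous_weylFactor (q : Fin N × Fin N) :
    Continuous fun x : Fin N → UnitAddCircle => weylFactor x q :=
  (continuous_const.sub ((continuous_circlePoint_apply_zpow _ _).mul
    (continuous_circlePoint_apply_zpow _ _))).sub
    ((continuous_circlePoint_apply_zpow _ _).mul (continuous_circlePoint_apply_zpow _ _))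

theorem continuous_weylDensity : Continuous (weylDensity (N := N)) :=
  continuous_finsetProd _ fun _ _ => continuous_weylFactor _

theorem continuous_weylDensityDeriv (k : Fin N) : Continuous (weylDensityDeriv k) :=
  continuous_finsetSum _ fun _ _ => (continuous_finsetProd _ fun r _ =>
    continuous_weylFactor r).mul (continuous_const.mul (continuous_const.mul
      (((continuous_circlePoint_apply_zpow _ _).mul (continuous_circlePoint_apply_zpow _ _)).sub
        ((continuous_circlePoint_apply_zpow _ _).mul (continuous_circlePoint_apply_zpow _ _)))))

theorem hasDerivAt_weylFactor (k : Fin N) (x : Fin N → UnitAddCircle) (t : ℝ)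
    (q : Fin N × Fin N) : HasDerivAt (fun s => weylFactor (torusFlow k s x) q)
      (((if q.1 = k then 1 else 0) - (if q.2 = k then 1 else 0)) *
        weylFactorDeriv (torusFlow k t x) q) t := by
  have h := hasDerivAt_circlePoint_zpow k x t
  refine (((hasDerivAt_const t (2 : ℂ)).sub ((h q.1 1).mul (h q.2 (-1)))).sub
    ((h q.2 1).mul (h q.1 (-1)))).congr_deriv ?_
  simp only [weylFactorDeriv]
  split_ifs <;> push_cast <;> ring

theorem hasDerivAt_weylDensity (k : Fin N) (x : Fin N → UnitAddCircle) (t : ℝ) :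
    HasDerivAt (fun s => weylDensity (torusFlow k s x)) (weylDensityDeriv k (torusFlow k t x)) t :=
  HasDerivAt.fun_finsetProd fun q _ => hasDerivAt_weylFactor k x t q

/-- The logarithmic derivative of `|u - v|^2` has a pole at `u = v`, which the difference `u ^ n - v
^ n` cancels through the geometric sum. This keeps the weighted Laplacian of a power sum a
polynomial in power sums. -/
theorem mul_pow_sub_pow_eq_sum {u v : ℂ} (hu : u ≠ 0) (hv : v ≠ 0) (n : ℕ) :
    (v * u⁻¹ - u * v⁻¹) * (u ^ n - v ^ n) = (2 - u * v⁻¹ - v * u⁻¹) *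
      ∑ s ∈ Finset.range n, (u ^ (n - s) * v ^ s + u ^ s * v ^ (n - s)) := by
  have h1 : ∑ s ∈ Finset.range n, u ^ s * v ^ (n - s) =
      v * ∑ s ∈ Finset.range n, u ^ s * v ^ (n - 1 - s) := by
    rw [Finset.mul_sum]
    refine Finset.sum_congr rfl fun s hs => ?_
    have : n - s = (n - 1 - s) + 1 := by have := Finset.mem_range.1 hs; omega
    rw [this, pow_succ]; ring
  have h2 : ∑ s ∈ Finset.range n, u ^ (n - s) * v ^ s =
      u * ∑ s ∈ Finset.range n, v ^ s * u ^ (n - 1 - s) := by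
    rw [Finset.mul_sum]
    refine Finset.sum_congr rfl fun s hs => ?_
    have : n - s = (n - 1 - s) + 1 := by have := Finset.mem_range.1 hs; omega
    rw [this, pow_succ]; ring
  have h3 := geom_sum₂_mul u v n
  have h4 := geom_sum₂_mul v u n
  have hv' : v * v⁻¹ = 1 := mul_inv_cancel₀ hv
  have hu' : u * u⁻¹ = 1 := mul_inv_cancel₀ hu
  rw [Finset.sum_add_distrib, h1, h2]
  set a := ∑ s ∈ Finset.range n, u ^ s * v ^ (n - 1 - s)
  set b := ∑ s ∈ Finset.range n, v ^ s * u ^ (n - 1 - s)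
  field_simp
  linear_combination (u - v) * v * h3 - (u - v) * u * h4

theorem weylFactorDeriv_mul (x : Fin N → UnitAddCircle) (q : Fin N × Fin N) (m : ℤ) :
    Complex.I * m * weylFactorDeriv x q * (circlePoint (x q.1) ^ m - circlePoint (x q.2) ^ m) =
      -(m.natAbs * weylFactor x q * ∑ s ∈ Finset.range m.natAbs,
        (circlePoint (x q.1) ^ (m.sign * (m.natAbs - s)) * circlePoint (x q.2) ^ (m.sign * s) +
          circlePoint (x q.2) ^ (m.sign * (m.natAbs - s)) *
            circlePoint (x q.1) ^ (m.sign * s))) := by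
  simp only [weylFactorDeriv, weylFactor, zpow_one, zpow_neg_one]
  have hu := circlePoint_ne_zero (x q.1)
  have hv := circlePoint_ne_zero (x q.2)
  set u := circlePoint (x q.1)
  set v := circlePoint (x q.2)
  have hs : ∀ (n s : ℕ), s ∈ Finset.range n → ((n : ℤ) - s) = ((n - s : ℕ) : ℤ) := fun n s hs => by
    rw [Nat.cast_sub (Finset.mem_range.1 hs).le]
  rcases lt_trichotomy m 0 with hm | rfl | hm
  · obtain ⟨n, hn⟩ := Int.eq_ofNat_of_zero_le (a := -m) (by omega)
    obtain rfl : m = -(n : ℤ) := by omega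
    -- Negative indices are the same identity at the inverse points.
    have h := mul_pow_sub_pow_eq_sum (inv_ne_zero hu) (inv_ne_zero hv) n
    rw [Int.sign_eq_neg_one_of_neg hm]
    simp only [Int.natAbs_neg, Int.natAbs_natCast, neg_one_mul, zpow_neg, ← inv_zpow]
    rw [Finset.sum_congr rfl fun s h' => by rw [hs n s h']]
    simp only [zpow_natCast, inv_inv] at h ⊢
    rw [Finset.sum_congr rfl fun s _ => by rw [mul_comm (v⁻¹ ^ (n - s))]]
    push_cast
    linear_combination -(n : ℂ) * h - n * (v * u⁻¹ - u * v⁻¹) * (u⁻¹ ^ n - v⁻¹ ^ n) *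
      Complex.I_mul_I
  · simp
  · obtain ⟨n, rfl⟩ := Int.eq_ofNat_of_zero_le hm.le
    have h := mul_pow_sub_pow_eq_sum hu hv n
    rw [Int.sign_eq_one_of_pos hm]
    simp only [Int.natAbs_natCast, one_mul]
    rw [Finset.sum_congr rfl fun s h' => by rw [hs n s h']]
    simp only [zpow_natCast, Int.cast_natCast]
    rw [Finset.sum_congr rfl fun s _ => by rw [mul_comm (v ^ (n - s))]]
    linear_combination -(n : ℂ) * h + n * (v * u⁻¹ - u * v⁻¹) * (u ^ n - v ^ n) *
      Complex.I_mul_I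

theorem sum_ltPairs_add_swap (F : Fin N → Fin N → ℂ) :
    ∑ q ∈ ltPairs N, (F q.1 q.2 + F q.2 q.1) = ∑ i, ∑ j, F i j - ∑ i, F i i := by
  have h1 : ∀ G : Fin N → Fin N → ℂ, ∑ q ∈ ltPairs N, G q.1 q.2 =
      ∑ i, ∑ j, if i < j then G i j else 0 := fun G => by
    rw [ltPairs, Finset.sum_filter, Fintype.sum_prod_type]
  rw [Finset.sum_add_distrib, h1, h1 fun i j => F j i, Finset.sum_comm (f := fun i j =>
    if i < j then F j i else 0), ← Finset.sum_add_distrib, ← Finset.sum_sub_distrib]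
  refine Finset.sum_congr rfl fun i _ => ?_
  have h2 : F i i = ∑ j, if i = j then F i j else 0 := by simp
  rw [h2, ← Finset.sum_add_distrib, ← Finset.sum_sub_distrib]
  refine Finset.sum_congr rfl fun j _ => ?_
  rcases lt_trichotomy i j with h | h | h
  · simp [h, h.ne, h.not_gt]
  · simp [h]
  · simp [h, h.ne', h.not_gt]

theorem sum_torusPowerSumDeriv (x : Fin N → UnitAddCircle) (m m' : ℤ) :
    ∑ k, torusPowerSumDeriv k x m * torusPowerSumDeriv k x m' =
      -(m * m' * torusPowerSum x (m + m')) := by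
  rw [torusPowerSum, Finset.mul_sum, ← Finset.sum_neg_distrib]
  refine Finset.sum_congr rfl fun k _ => ?_
  rw [zpow_add₀ (circlePoint_ne_zero _)]
  simp only [torusPowerSumDeriv]
  linear_combination (m * m' * circlePoint (x k) ^ m * circlePoint (x k) ^ m' : ℂ) *
    Complex.I_mul_I

/-- The drift of the Weyl density produces the products of power sums over pairs of distinct
coordinates only; the subtracted `torusPowerSum x m` is their diagonal part. -/
theorem sum_weylDensityDeriv_mul (x : Fin N → UnitAddCircle) (m : ℤ) :
    ∑ k, weylDensityDeriv k x * torusPowerSumDeriv k x m =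
      -(weylDensity x * m.natAbs * ∑ s ∈ Finset.range m.natAbs,
        (torusPowerSum x (m.sign * s) * torusPowerSum x (m.sign * (m.natAbs - s)) -
          torusPowerSum x m)) := by
  have h1 : ∀ q : Fin N × Fin N, ∑ k, ((if q.1 = k then (1 : ℂ) else 0) -
      (if q.2 = k then 1 else 0)) * circlePoint (x k) ^ m =
      circlePoint (x q.1) ^ m - circlePoint (x q.2) ^ m := fun q => by
    simp [sub_mul, Finset.sum_sub_distrib]
  have h2 : ∑ k, weylDensityDeriv k x * torusPowerSumDeriv k x m =
      ∑ q ∈ ltPairs N, (∏ r ∈ (ltPairs N).erase q, weylFactor x r) *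
        (Complex.I * m * weylFactorDeriv x q *
          (circlePoint (x q.1) ^ m - circlePoint (x q.2) ^ m)) := by
    simp only [weylDensityDeriv, Finset.sum_mul]
    rw [Finset.sum_comm]
    refine Finset.sum_congr rfl fun q _ => ?_
    rw [← h1, Finset.mul_sum, Finset.mul_sum]
    refine Finset.sum_congr rfl fun k _ => ?_
    simp only [torusPowerSumDeriv]
    ring
  rw [h2]
  have h3 : ∀ q ∈ ltPairs N, (∏ r ∈ (ltPairs N).erase q, weylFactor x r) *
        (Complex.I * m * weylFactorDeriv x q *
          (circlePoint (x q.1) ^ m - circlePoint (x q.2) ^ m)) =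
      -(weylDensity x * m.natAbs * ∑ s ∈ Finset.range m.natAbs,
        (circlePoint (x q.1) ^ (m.sign * (m.natAbs - s)) * circlePoint (x q.2) ^ (m.sign * s) +
          circlePoint (x q.2) ^ (m.sign * (m.natAbs - s)) *
            circlePoint (x q.1) ^ (m.sign * s))) := fun q hq => by
    rw [weylFactorDeriv_mul, weylDensity, ← Finset.mul_prod_erase _ _ hq]
    ring
  rw [Finset.sum_congr rfl h3, Finset.sum_neg_distrib, ← Finset.mul_sum, Finset.sum_comm]
  congr 2
  refine Finset.sum_congr rfl fun s _ => ?_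
  rw [sum_ltPairs_add_swap fun i j => circlePoint (x i) ^ (m.sign * (m.natAbs - s)) *
    circlePoint (x j) ^ (m.sign * s), mul_comm (torusPowerSum x _), torusPowerSum, torusPowerSum,
    Finset.sum_mul_sum]
  congr 1
  refine Finset.sum_congr rfl fun i _ => ?_
  rw [← zpow_add₀ (circlePoint_ne_zero _), ← mul_add, sub_add_cancel, Int.sign_mul_natAbs]

/-- The diagonal part missing from the drift is exactly the `m ^ 2` term of the plain second
derivatives. The outcome is the same formal Laplacian as in `sum_powerMonomialDeriv₂_unitary`, the
coincidence on which the Weyl formula rests. -/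
theorem sum_powerMonomialDeriv₂_torus (x : Fin N → UnitAddCircle) (l : List ℤ) :
    ∑ k, (weylDensityDeriv k x * powerMonomialDeriv (torusPowerSum x) (torusPowerSumDeriv k x) l +
      weylDensity x * powerMonomialDeriv₂ (torusPowerSum x) (torusPowerSumDeriv k x)
        (torusPowerSumDeriv₂ k x) l) =
      -(weylDensity x * powerMonomialLaplacian (torusPowerSum x) l) := by
  refine sum_weighted_powerMonomialDeriv₂ (sum_torusPowerSumDeriv x) (fun m => ?_) l
  have h : (m.natAbs : ℂ) * m.natAbs = m ^ 2 := by
    rw [← sq, ← Int.cast_natCast, ← Int.cast_pow, Int.natAbs_sq, Int.cast_pow]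
  rw [Finset.sum_add_distrib, sum_weylDensityDeriv_mul, ← Finset.mul_sum]
  simp only [torusPowerSumDeriv₂, Finset.sum_neg_distrib, ← Finset.mul_sum,
    Finset.sum_sub_distrib, Finset.sum_const, Finset.card_range, nsmul_eq_mul, powerLaplacian]
  rw [← torusPowerSum]
  linear_combination (weylDensity x * torusPowerSum x m) * h

end Torus

/-! ### Eigenvalues of unitary matrices -/

section Eigenvalues

open Matrix

variable {N : ℕ}

theorem exists_circlePoint_eq {c : ℂ} (hc : ‖c‖ = 1) : ∃ θ, circlePoint θ = c := by
  obtain ⟨θ, hθ⟩ := (AddCircle.homeomorphCircle (T := 1) one_ne_zero).surjective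
    ⟨c, mem_sphere_zero_iff_norm.2 hc⟩
  refine ⟨θ, ?_⟩
  rw [AddCircle.homeomorphCircle_apply] at hθ
  exact congrArg Subtype.val hθ

/-- Cayley transform: for `ζ` on the unit circle outside the spectrum, `H = i (ζ + A) (ζ - A)⁻¹` is
Hermitian. The spectral theorem diagonalizes `H`, and an eigenvalue `λ` of `H` corresponds to the
eigenvalue `ζ (λ - i) / (λ + i)` of `A`, of modulus one since `λ` is real. -/
theorem exists_unitary_diagonalization (A : Matrix.unitaryGroup (Fin N) ℂ) :
    ∃ (V W : Matrix (Fin N) (Fin N) ℂ) (c : Fin N → ℂ), W * V = 1 ∧ (∀ i, ‖c i‖ = 1) ∧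
      (A : Matrix (Fin N) (Fin N) ℂ) = V * diagonal c * W := by
  obtain ⟨A, hA⟩ := A
  have hA1 : A * Aᴴ = 1 := Matrix.mem_unitaryGroup_iff.1 hA
  have hA2 : Aᴴ * A = 1 := Matrix.mem_unitaryGroup_iff'.1 hA
  obtain ⟨ζ, hζ, hdet⟩ : ∃ ζ : ℂ, ‖ζ‖ = 1 ∧ (ζ • (1 : Matrix (Fin N) (Fin N) ℂ) - A).det ≠ 0 := by
    have hinf : (Metric.sphere (0 : ℂ) 1).Infinite :=
      (isPreconnected_sphere (by rw [Complex.rank_real_complex]; norm_num) (0 : ℂ)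
        1).infinite_of_nontrivial ⟨1, by simp, -1, by simp, by norm_num⟩
    obtain ⟨ζ, hζ, hroot⟩ := hinf.exists_notMem_finset A.charpoly.roots.toFinset
    refine ⟨ζ, by simpa using hζ, fun h => hroot ?_⟩
    rw [Multiset.mem_toFinset, Polynomial.mem_roots (Matrix.charpoly_monic A).ne_zero,
      Polynomial.IsRoot, Matrix.eval_charpoly, ← h, Matrix.scalar_apply, smul_one_eq_diagonal]
  have hζ1 : ζ * conj ζ = 1 := by rw [Complex.mul_conj, Complex.normSq_eq_norm_sq, hζ]; simp
  set B := ζ • (1 : Matrix (Fin N) (Fin N) ℂ) - A with hB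
  have hBu : IsUnit B.det := isUnit_iff_ne_zero.2 hdet
  obtain ⟨H, hHB⟩ : ∃ H : Matrix (Fin N) (Fin N) ℂ,
      H * B = Complex.I • (ζ • (1 : Matrix (Fin N) (Fin N) ℂ) + A) :=
    ⟨Complex.I • ((ζ • (1 : Matrix (Fin N) (Fin N) ℂ) + A) * B⁻¹), by
      rw [smul_mul_assoc, mul_assoc, Matrix.nonsing_inv_mul _ hBu, mul_one]⟩
  have hherm : H.IsHermitian := by
    have h1 : Bᴴ * Hᴴ * B = Bᴴ * (H * B) := by
      rw [← conjTranspose_mul, hHB, hB]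
      have e1 : (conj ζ • 1 + Aᴴ) * (ζ • 1 - A) = ζ • Aᴴ - conj ζ • A := by
        simp only [add_mul, mul_sub, smul_mul_assoc, mul_smul_comm, mul_one, one_mul, smul_add,
          smul_smul, one_smul, hζ1, hA2]
        abel
      have e2 : (conj ζ • 1 - Aᴴ) * (ζ • 1 + A) = conj ζ • A - ζ • Aᴴ := by
        simp only [sub_mul, mul_add, smul_mul_assoc, mul_smul_comm, mul_one, one_mul, smul_sub,
          smul_smul, one_smul, hζ1, hA2]
        abel
      simp only [conjTranspose_smul, conjTranspose_sub, conjTranspose_add, conjTranspose_one,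
        Complex.star_def, Complex.conj_I, smul_mul_assoc, mul_smul_comm, e1, e2]
      module
    rw [mul_assoc] at h1
    have hBHu : IsUnit Bᴴ := by
      rw [Matrix.isUnit_iff_isUnit_det, det_conjTranspose]
      exact hBu.star
    have h2 := hBHu.mul_left_cancel h1
    exact ((Matrix.isUnit_iff_isUnit_det B).2 hBu).mul_right_cancel h2
  have hAH : A * (H + Complex.I • (1 : Matrix (Fin N) (Fin N) ℂ)) =
      ζ • (H - Complex.I • (1 : Matrix (Fin N) (Fin N) ℂ)) := by
    refine ((Matrix.isUnit_iff_isUnit_det B).2 hBu).mul_right_cancel ?_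
    rw [mul_assoc, add_mul, smul_mul_assoc ζ, sub_mul, hHB, hB]
    simp only [smul_mul_assoc, one_mul, smul_sub, smul_add, mul_add, mul_sub, mul_smul_comm,
      mul_one, smul_smul, mul_comm ζ]
    abel
  set V := (hherm.eigenvectorUnitary).1 with hV
  have hVV : Vᴴ * V = 1 := Matrix.mem_unitaryGroup_iff'.1 hherm.eigenvectorUnitary.2
  have hVV' : V * Vᴴ = 1 := Matrix.mem_unitaryGroup_iff.1 hherm.eigenvectorUnitary.2
  have hspec : Vᴴ * H * V = diagonal fun i => (hherm.eigenvalues i : ℂ) := by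
    have h1 : H = V * diagonal (fun i => (hherm.eigenvalues i : ℂ)) * Vᴴ := by
      have := hherm.spectral_theorem
      rw [Unitary.conjStarAlgAut_apply] at this
      exact this
    conv_lhs => rw [h1, ← mul_assoc, ← mul_assoc, hVV, one_mul, mul_assoc, hVV, mul_one]
  have hD : Vᴴ * A * V * diagonal (fun i => (hherm.eigenvalues i : ℂ) + Complex.I) =
      diagonal (fun i => ζ * ((hherm.eigenvalues i : ℂ) - Complex.I)) := by
    have e1 : diagonal (fun i => (hherm.eigenvalues i : ℂ) + Complex.I) =
        Vᴴ * (H + Complex.I • (1 : Matrix (Fin N) (Fin N) ℂ)) * V := by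
      rw [mul_add, add_mul, mul_smul_comm, smul_mul_assoc, mul_one, hVV, hspec]
      rw [smul_one_eq_diagonal, diagonal_add]
    have e2 : diagonal (fun i => ζ * ((hherm.eigenvalues i : ℂ) - Complex.I)) =
        Vᴴ * (ζ • (H - Complex.I • (1 : Matrix (Fin N) (Fin N) ℂ))) * V := by
      rw [mul_smul_comm, smul_mul_assoc, mul_sub, sub_mul, mul_smul_comm, smul_mul_assoc, mul_one,
        hVV, hspec]
      rw [smul_one_eq_diagonal, diagonal_sub, ← diagonal_smul]
      rfl
    rw [e1, e2, ← hAH]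
    simp only [mul_assoc]
    rw [← mul_assoc V, hVV', one_mul]
  have hne : ∀ r : ℝ, (r : ℂ) + Complex.I ≠ 0 := fun r h => by
    simpa using congrArg Complex.im h
  refine ⟨V, Vᴴ, fun i => ζ * ((hherm.eigenvalues i : ℂ) - Complex.I) /
    ((hherm.eigenvalues i : ℂ) + Complex.I), hVV, fun i => ?_, ?_⟩
  · have : conj ((hherm.eigenvalues i : ℂ) + Complex.I) = (hherm.eigenvalues i : ℂ) - Complex.I := by
      simp [sub_eq_add_neg]
    rw [norm_div, norm_mul, hζ, one_mul, ← this, Complex.norm_conj]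
    exact div_self (norm_ne_zero_iff.2 (hne _))
  · have h3 : Vᴴ * A * V = diagonal (fun i => ζ * ((hherm.eigenvalues i : ℂ) - Complex.I) /
        ((hherm.eigenvalues i : ℂ) + Complex.I)) := by
      ext i j
      have := congrFun (congrFun hD i) j
      rw [mul_diagonal] at this
      rw [eq_div_of_mul_eq (hne _) this]
      by_cases hij : i = j
      · subst hij; simp
      · simp [hij]
    rw [← h3]
    simp only [mul_assoc]
    rw [hVV', mul_one, ← mul_assoc, hVV', one_mul]

/-- Transfers pointwise identities in power sums from the torus to the group; the same point `x`
also computes the characteristic polynomial. -/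
theorem exists_torus_eigenvalues (A : Matrix.unitaryGroup (Fin N) ℂ) :
    ∃ x : Fin N → UnitAddCircle, unitaryPowerSum A = torusPowerSum x ∧
      ∀ z : ℂ, (1 - z • (A : Matrix (Fin N) (Fin N) ℂ)).det =
        ∏ i, (1 - z * circlePoint (x i)) := by
  obtain ⟨V, W, c, hWV, hc, hA⟩ := exists_unitary_diagonalization A
  choose x hx using fun i => exists_circlePoint_eq (hc i)
  have hnat : ∀ n : ℕ, unitaryPowerSum A n = torusPowerSum x n := fun n => by
    have h1 : (A : Matrix (Fin N) (Fin N) ℂ) ^ n = V * diagonal c ^ n * W := by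
      induction n with
      | zero => simp [mul_eq_one_comm.1 hWV]
      | succ n ih =>
        rw [pow_succ, ih, pow_succ, hA]
        simp only [mul_assoc]
        rw [← mul_assoc W, hWV, one_mul]
    rw [unitaryPowerSum, coe_zpow_natCast, h1, Matrix.trace_mul_comm, ← mul_assoc, hWV, one_mul,
      diagonal_pow, trace_diagonal, torusPowerSum]
    simp [hx]
  refine ⟨x, ?_, fun z => ?_⟩
  · ext m
    obtain ⟨n, rfl | rfl⟩ := m.eq_nat_or_neg
    · exact hnat n
    · rw [unitaryPowerSum_neg, hnat, torusPowerSum, torusPowerSum, map_sum]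
      refine Finset.sum_congr rfl fun i _ => ?_
      rw [map_zpow₀, conj_circlePoint, _root_.inv_zpow, _root_.zpow_neg]
  · have h1 : 1 - z • (A : Matrix (Fin N) (Fin N) ℂ) =
        V * diagonal (fun i => 1 - z * circlePoint (x i)) * W := by
      have : diagonal (fun i => 1 - z * circlePoint (x i)) = 1 - z • diagonal c := by
        simp only [hx]
        rw [← diagonal_one, ← diagonal_smul, diagonal_sub]
        rfl
      rw [this, mul_sub, sub_mul, mul_one, mul_eq_one_comm.1 hWV, mul_smul_comm, smul_mul_assoc, hA]
    rw [h1, det_mul_comm, ← mul_assoc, hWV, one_mul, det_diagonal]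

end Eigenvalues

/-! ### The Weyl integration formula -/

section WeylIntegration

variable {N : ℕ}

theorem nontrivial_unitAddCircle : Nontrivial UnitAddCircle := by
  refine ⟨((1 / 2 : ℝ) : UnitAddCircle), 0, fun h => ?_⟩
  obtain ⟨n, hn⟩ := (AddCircle.coe_eq_zero_iff (p := (1 : ℝ))).1 h
  rw [zsmul_eq_mul, mul_one] at hn
  have h2 : ((2 * n : ℤ) : ℝ) = (1 : ℤ) := by push_cast; linarith
  have := Int.cast_injective h2
  omega

/-- A finite intersection of open sets `x i ≠ x j`, each dense because the circle has no isolated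
point and one coordinate can be moved. -/
theorem dense_weylDensity_ne_zero : Dense {x : Fin N → UnitAddCircle | weylDensity x ≠ 0} := by
  have : Nontrivial UnitAddCircle := nontrivial_unitAddCircle
  have h1 : Dense (⋂ q : ltPairs N, {x : Fin N → UnitAddCircle | x q.1.1 ≠ x q.1.2}) := by
    refine dense_iInter_of_isOpen (fun q => ?_) fun q x => ?_
    · exact isOpen_ne_fun (continuous_apply _) (continuous_apply _)
    · have hq := (Finset.mem_filter.1 q.2).2
      have : (nhdsWithin (x q.1.2) {x q.1.2}ᶜ).NeBot :=
        ConnectedSpace.neBot_nhdsWithin_compl_of_nontrivial_of_t1space _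
      by_cases hx : x q.1.1 = x q.1.2
      · have hc : Continuous fun u => Function.update x q.1.1 u :=
          continuous_const.update _ continuous_id
        have ht : Filter.Tendsto (fun u => Function.update x q.1.1 u)
            (nhdsWithin (x q.1.2) {x q.1.2}ᶜ) (nhds x) := by
          have := hc.tendsto (x q.1.2)
          rw [← hx, Function.update_eq_self, hx] at this
          exact this.mono_left nhdsWithin_le_nhds
        refine mem_closure_of_tendsto ht ?_
        filter_upwards [self_mem_nhdsWithin] with u hu
        simp only [Function.update_self, Function.update_of_ne hq.ne']
        exact hu
      · exact subset_closure hx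
  refine h1.mono fun x hx => ?_
  rw [Set.mem_ofPred_eq, weylDensity, Finset.prod_ne_zero_iff]
  intro q hq
  rw [weylFactor_eq]
  have := Set.mem_iInter.1 hx ⟨q, hq⟩
  have h2 : circlePoint (x q.1) - circlePoint (x q.2) ≠ 0 :=
    sub_ne_zero.2 fun h => this (circlePoint_injective h)
  simp [h2]

theorem integrable_torus {f : (Fin N → UnitAddCircle) → ℂ} (hf : Continuous f) :
    Integrable f (torusMeasure N) :=
  hf.integrable_of_hasCompactSupport (HasCompactSupport.of_compactSpace _)

theorem integrable_haarUnitary {f : Matrix.unitaryGroup (Fin N) ℂ → ℂ} (hf : Continuous f) :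
    Integrable f (haarUnitary N) :=
  hf.integrable_of_hasCompactSupport (HasCompactSupport.of_compactSpace _)

/-- A nonnegative continuous function against the Weyl density has zero integral only if it
vanishes identically. -/
theorem eq_zero_of_integral_normSq_mul_weylDensity {ι : Type*} [Fintype ι]
    {f : ι → (Fin N → UnitAddCircle) → ℂ} (hf : ∀ i, Continuous (f i))
    (h : ∫ x, ∑ i, conj (f i x) * f i x * weylDensity x ∂torusMeasure N = 0) (i : ι) (x) :
    f i x = 0 := by
  set w : (Fin N → UnitAddCircle) → ℝ := fun x =>
    ∏ q ∈ ltPairs N, ‖circlePoint (x q.1) - circlePoint (x q.2)‖ ^ 2 with hw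
  have hw0 : ∀ x, 0 ≤ w x := fun x => Finset.prod_nonneg fun _ _ => sq_nonneg _
  have hwc : Continuous w := continuous_finsetProd _ fun q _ =>
    ((continuous_circlePoint.comp (continuous_apply q.1)).sub
      (continuous_circlePoint.comp (continuous_apply q.2))).norm.pow 2
  set g : (Fin N → UnitAddCircle) → ℝ := fun x => ∑ i, ‖f i x‖ ^ 2 * w x with hg
  have hgc : Continuous g := continuous_finsetSum _ fun i _ => ((hf i).norm.pow 2).mul hwc
  have hgf : ∀ x, ∑ i, conj (f i x) * f i x * weylDensity x = (g x : ℂ) := fun x => by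
    simp only [hg, weylDensity_eq, Complex.conj_mul', Complex.ofReal_sum, Complex.ofReal_mul,
      Complex.ofReal_pow]
    rfl
  simp only [hgf, integral_complex_ofReal, Complex.ofReal_eq_zero] at h
  have hg0 : ∀ x, 0 ≤ g x := fun x => Finset.sum_nonneg fun i _ =>
    mul_nonneg (sq_nonneg _) (hw0 x)
  rw [integral_eq_zero_iff_of_nonneg hg0
    (hgc.integrable_of_hasCompactSupport (HasCompactSupport.of_compactSpace _)),
    show (0 : (Fin N → UnitAddCircle) → ℝ) = fun _ => (0 : ℝ) from rfl,
    Continuous.ae_eq_iff_eq _ hgc continuous_const] at h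
  refine congrFun (Continuous.ext_on dense_weylDensity_ne_zero (hf i) continuous_const
    fun y hy => ?_) x
  have hy' : w y ≠ 0 := fun h0 => hy (by rw [weylDensity_eq]; exact_mod_cast h0)
  have h1 := (Finset.sum_eq_zero_iff_of_nonneg fun i _ =>
    mul_nonneg (sq_nonneg _) (hw0 y)).1 (congrFun h y) i (Finset.mem_univ i)
  simpa [hy'] using h1

/-- The function associated with a formal combination of power sum monomials. -/
noncomputable def formalEval {Y : Type*} (E : List ℤ → Y → ℂ) : (List ℤ →₀ ℂ) →ₗ[ℂ] (Y → ℂ) :=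
  Finsupp.linearCombination ℂ E

theorem formalEval_apply {Y : Type*} (E : List ℤ → Y → ℂ) (c : List ℤ →₀ ℂ) (y : Y) :
    formalEval E c y = ∑ l ∈ c.support, c l * E l y := by
  simp [formalEval, Finsupp.linearCombination_apply, Finsupp.sum, Finset.sum_apply]

theorem continuous_formalEval {Y : Type*} [TopologicalSpace Y] {E : List ℤ → Y → ℂ}
    (hE : ∀ l, Continuous (E l)) (c : List ℤ →₀ ℂ) : Continuous (formalEval E c) := by
  simp only [funext (formalEval_apply E c)]
  exact continuous_finsetSum _ fun l _ => continuous_const.mul (hE l)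

theorem hasDerivAt_formalEval {Y : Type*} {E E' : List ℤ → Y → ℂ} {T : ℝ → Y} {t : ℝ}
    (h : ∀ l, HasDerivAt (fun s => E l (T s)) (E' l (T t)) t) (c : List ℤ →₀ ℂ) :
    HasDerivAt (fun s => formalEval E c (T s)) (formalEval E' c (T t)) t := by
  simp only [formalEval_apply]
  exact HasDerivAt.fun_sum fun l _ => (h l).const_mul _

/-- Evaluation of formal combinations on the torus. -/
noncomputable def torusEval (N : ℕ) :=
  formalEval fun l (x : Fin N → UnitAddCircle) => powerMonomial (torusPowerSum x) l

/-- Evaluation of derivatives of formal combinations on the torus. -/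
noncomputable def torusEvalDeriv (k : Fin N) :=
  formalEval fun l x => powerMonomialDeriv (torusPowerSum x) (torusPowerSumDeriv k x) l

/-- Evaluation of second derivatives of formal combinations on the torus. -/
noncomputable def torusEvalDeriv₂ (k : Fin N) := formalEval fun l x =>
  powerMonomialDeriv₂ (torusPowerSum x) (torusPowerSumDeriv k x) (torusPowerSumDeriv₂ k x) l

/-- Evaluation of Laplacians of formal combinations on the torus. -/
noncomputable def torusEvalLaplacian (N : ℕ) :=
  formalEval fun l (x : Fin N → UnitAddCircle) => powerMonomialLaplacian (torusPowerSum x) l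

theorem continuous_torusEval (c : List ℤ →₀ ℂ) : Continuous (torusEval N c) :=
  continuous_formalEval (fun l => continuous_powerMonomial continuous_torusPowerSum l) c

theorem continuous_torusEvalDeriv (k : Fin N) (c : List ℤ →₀ ℂ) :
    Continuous (torusEvalDeriv k c) :=
  continuous_formalEval (fun l => continuous_powerMonomialDeriv continuous_torusPowerSum
    (continuous_torusPowerSumDeriv k) l) c

theorem continuous_torusEvalDeriv₂ (k : Fin N) (c : List ℤ →₀ ℂ) :
    Continuous (torusEvalDeriv₂ k c) :=
  continuous_formalEval (fun l => continuous_powerMonomialDeriv₂ continuous_torusPowerSum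
    (continuous_torusPowerSumDeriv k) (continuous_torusPowerSumDeriv₂ k) l) c

theorem hasDerivAt_torusEval (k : Fin N) (c : List ℤ →₀ ℂ) (x : Fin N → UnitAddCircle) (t : ℝ) :
    HasDerivAt (fun s => torusEval N c (torusFlow k s x)) (torusEvalDeriv k c (torusFlow k t x)) t :=
  hasDerivAt_formalEval (fun l => hasDerivAt_powerMonomial (hasDerivAt_torusPowerSum k x t) l) c

theorem hasDerivAt_torusEvalDeriv (k : Fin N) (c : List ℤ →₀ ℂ) (x : Fin N → UnitAddCircle)
    (t : ℝ) : HasDerivAt (fun s => torusEvalDeriv k c (torusFlow k s x))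
      (torusEvalDeriv₂ k c (torusFlow k t x)) t :=
  hasDerivAt_formalEval (fun l => hasDerivAt_powerMonomialDeriv (hasDerivAt_torusPowerSum k x t)
    (hasDerivAt_torusPowerSumDeriv k x t) l) c

theorem sum_torusEvalDeriv₂ (c : List ℤ →₀ ℂ) (x : Fin N → UnitAddCircle) :
    ∑ k, (weylDensityDeriv k x * torusEvalDeriv k c x + weylDensity x * torusEvalDeriv₂ k c x) =
      -(weylDensity x * torusEvalLaplacian N c x) := by
  simp only [torusEvalDeriv, torusEvalDeriv₂, torusEvalLaplacian, formalEval_apply, Finset.mul_sum,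
    ← Finset.sum_add_distrib]
  rw [Finset.sum_comm, ← Finset.sum_neg_distrib]
  refine Finset.sum_congr rfl fun l _ => ?_
  have := congrArg (c l * ·) (sum_powerMonomialDeriv₂_torus x l)
  simp only [Finset.mul_sum] at this
  rw [mul_left_comm, ← mul_neg, ← mul_neg] 
  rw [mul_neg] at this
  simp only [mul_neg]
  rw [← this]
  exact Finset.sum_congr rfl fun k _ => by ring

/-- Integration by parts on the torus with respect to the Weyl density. -/
theorem integral_conj_mul_torusEvalLaplacian (b c : List ℤ →₀ ℂ) :
    ∫ x, conj (torusEval N b x) * torusEvalLaplacian N c x * weylDensity x ∂torusMeasure N =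
      ∫ x, ∑ k, conj (torusEvalDeriv k b x) * torusEvalDeriv k c x * weylDensity x
        ∂torusMeasure N := by
  have hb := continuous_torusEval (N := N) b
  have hb' := fun k : Fin N => continuous_torusEvalDeriv k b
  have hc' := fun k : Fin N => continuous_torusEvalDeriv k c
  have hc'' := fun k : Fin N => continuous_torusEvalDeriv₂ k c
  have hw := continuous_weylDensity (N := N)
  have hw' := continuous_weylDensityDeriv (N := N)
  have hcont : ∀ k : Fin N, Continuous fun x => conj (torusEvalDeriv k b x) *
      (weylDensity x * torusEvalDeriv k c x) + conj (torusEval N b x) *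
      (weylDensityDeriv k x * torusEvalDeriv k c x + weylDensity x * torusEvalDeriv₂ k c x) :=
    fun k => ((Complex.continuous_conj.comp (hb' k)).mul (hw.mul (hc' k))).add
      ((Complex.continuous_conj.comp hb).mul (((hw' k).mul (hc' k)).add (hw.mul (hc'' k))))
  have h0 : ∀ k : Fin N, ∫ x, (conj (torusEvalDeriv k b x) *
      (weylDensity x * torusEvalDeriv k c x) + conj (torusEval N b x) *
      (weylDensityDeriv k x * torusEvalDeriv k c x + weylDensity x * torusEvalDeriv₂ k c x))
      ∂torusMeasure N = 0 := fun k =>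
    integral_eq_zero_of_flow (T := torusFlow k) (measurePreserving_torusFlow k) (torusFlow_zero k)
      (F := fun x => conj (torusEval N b x) * (weylDensity x * torusEvalDeriv k c x))
      ((Complex.continuous_conj.comp hb).mul (hw.mul (hc' k))) (hcont k)
      fun x t => ((hasDerivAt_torusEval k b x t).star).mul
        ((hasDerivAt_weylDensity k x t).mul (hasDerivAt_torusEvalDeriv k c x t))
  have h1 := integral_finsetSum (μ := torusMeasure N) Finset.univ fun k _ =>
    integrable_torus (hcont k)
  simp only [h0, Finset.sum_const_zero] at h1
  have h2 : ∀ x, conj (torusEval N b x) * torusEvalLaplacian N c x * weylDensity x =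
      ∑ k, conj (torusEvalDeriv k b x) * torusEvalDeriv k c x * weylDensity x -
      ∑ k, (conj (torusEvalDeriv k b x) *
      (weylDensity x * torusEvalDeriv k c x) + conj (torusEval N b x) *
      (weylDensityDeriv k x * torusEvalDeriv k c x + weylDensity x * torusEvalDeriv₂ k c x)) :=
    fun x => by
      rw [Finset.sum_add_distrib, ← Finset.mul_sum, sum_torusEvalDeriv₂,
        Finset.sum_congr rfl fun k _ => mul_assoc (conj (torusEvalDeriv k b x)) _ _]
      simp only [mul_comm (weylDensity x)]
      ring
  simp only [h2]
  rw [integral_sub, h1, sub_zero]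
  · exact integrable_torus (continuous_finsetSum _ fun k _ =>
      ((Complex.continuous_conj.comp (hb' k)).mul (hc' k)).mul hw)
  · exact integrable_torus (continuous_finsetSum _ fun k _ => hcont k)

/-- The coordinate rotations together act transitively: the point `x` is reached from `0` one
coordinate at a time, without changing the value. -/
theorem eq_of_torusEvalDeriv_eq_zero {c : List ℤ →₀ ℂ}
    (h : ∀ (k : Fin N) x, torusEvalDeriv k c x = 0) (x : Fin N → UnitAddCircle) :
    torusEval N c x = torusEval N c 0 := by
  have h1 : ∀ (k : Fin N) x (θ : UnitAddCircle),
      torusEval N c (Pi.single k θ + x) = torusEval N c x := fun k x θ => by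
    have h2 : ∀ t, HasDerivAt (fun s => torusEval N c (torusFlow k s x)) 0 t := fun t => by
      simpa [h] using hasDerivAt_torusEval k c x t
    obtain ⟨r, rfl⟩ := QuotientAddGroup.mk_surjective θ
    -- The time `2πr` undoes the normalization of `torusFlow` and moves the coordinate by `r`.
    have h3 := is_const_of_deriv_eq_zero (fun t => (h2 t).differentiableAt)
      (fun t => (h2 t).deriv) (r * (2 * Real.pi)) 0
    rw [torusFlow_zero, torusFlow, mul_div_cancel_right₀ _ (by positivity)] at h3
    exact h3
  have h2 : ∀ s : Finset (Fin N), torusEval N c (∑ k ∈ s, Pi.single k (x k)) = torusEval N c 0 := by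
    intro s
    induction s using Finset.induction_on with
    | empty => simp
    | insert k s hk ih => rw [Finset.sum_insert hk, h1, ih]
  rw [← h2 Finset.univ, Finset.univ_sum_single]

theorem integral_weylDensity_ne_zero : ∫ x, weylDensity x ∂torusMeasure N ≠ 0 := fun h => by
  have := eq_zero_of_integral_normSq_mul_weylDensity (N := N) (ι := Unit) (f := fun _ _ => 1)
    (fun _ => continuous_const) (by simpa using h) () 0
  exact one_ne_zero this

end WeylIntegration

/-! ### Solving the Poisson equation on the torus, and passage from monomials to exponentials -/

section WeylIntegration

variable {N : ℕ}

/-- Fredholm alternative in finite dimension: `T` maps into `ker φ` and is injective there, hence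
onto it. -/
theorem exists_apply_eq_of_injOn_ker {K V : Type*} [Field K] [AddCommGroup V] [Module K V]
    [FiniteDimensional K V] (T : V →ₗ[K] V) (φ : V →ₗ[K] K) (hT : ∀ v, φ (T v) = 0)
    (hinj : ∀ v, φ v = 0 → T v = 0 → v = 0) {v : V} (hv : φ v = 0) : ∃ u, T u = v := by
  let T' : LinearMap.ker φ →ₗ[K] LinearMap.ker φ := T.restrict fun v _ => hT v
  have h1 : Function.Injective T' := (injective_iff_map_eq_zero T').2 fun u hu =>
    Subtype.ext (hinj u.1 u.2 (congrArg Subtype.val hu))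
  obtain ⟨u, hu⟩ := LinearMap.surjective_of_injective h1 ⟨v, hv⟩
  exact ⟨u.1, congrArg Subtype.val hu⟩

/-- The Laplacian is onto the monomials of bounded weight, modulo constants. -/
theorem exists_torusEvalLaplacian_eq (l : List ℤ) : ∃ (a : ℂ) (c : List ℤ →₀ ℂ),
    ∀ x : Fin N → UnitAddCircle,
      powerMonomial (torusPowerSum x) l = a + torusEvalLaplacian N c x := by
  set d := (l.map Int.natAbs).sum with hd
  set L : Set (List ℤ) := {l | (l.map Int.natAbs).sum ≤ d} with hL
  set S := powerSpan (torusPowerSum (N := N)) d with hS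
  have hfin : FiniteDimensional ℂ S :=
    finiteDimensional_powerSpan (c := (N : ℂ)) (fun x => by simp [torusPowerSum]) d
  have hmap : Submodule.map (torusEval N) (Finsupp.supported ℂ ℂ L) = S :=
    (Finsupp.span_image_eq_map_linearCombination ℂ L).symm
  have hlap : ∀ c ∈ Finsupp.supported ℂ ℂ L, torusEvalLaplacian N c ∈ S := fun c hc => by
    have h1 : torusEvalLaplacian N c = ∑ l ∈ c.support, c l •
        fun x : Fin N → UnitAddCircle => powerMonomialLaplacian (torusPowerSum x) l :=
      Finsupp.linearCombination_apply ℂ c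
    rw [h1]
    exact Submodule.sum_mem _ fun l hl => Submodule.smul_mem _ _
      (powerMonomialLaplacian_mem_powerSpan ((Finsupp.mem_supported ℂ c).1 hc hl))
  -- a linear section of the evaluation map
  obtain ⟨σ, hσ⟩ : ∃ σ : S →ₗ[ℂ] Finsupp.supported ℂ ℂ L, ∀ f : S, torusEval N (σ f).1 = f.1 := by
    let E : Finsupp.supported ℂ ℂ L →ₗ[ℂ] S := ((torusEval N).domRestrict _).codRestrict S
      fun c => hmap ▸ Submodule.mem_map_of_mem c.2
    have hE : LinearMap.range E = ⊤ := LinearMap.range_eq_top.2 fun f => by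
      have h1 : f.1 ∈ Submodule.map (torusEval N) (Finsupp.supported ℂ ℂ L) := hmap.symm ▸ f.2
      obtain ⟨c, hc, h⟩ := h1
      exact ⟨⟨c, hc⟩, Subtype.ext h⟩
    obtain ⟨σ, hσ⟩ := LinearMap.exists_rightInverse_of_surjective E hE
    exact ⟨σ, fun f => congrArg Subtype.val (LinearMap.congr_fun hσ f)⟩
  have hcont : ∀ f ∈ S, Continuous f := fun f hf => by
    obtain ⟨c, -, rfl⟩ := (hmap.symm ▸ hf : f ∈ Submodule.map (torusEval N) _)
    exact continuous_torusEval c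
  have hint : ∀ f ∈ S, Integrable (fun x => f x * weylDensity x) (torusMeasure N) := fun f hf =>
    integrable_torus ((hcont f hf).mul continuous_weylDensity)
  -- the subspace of functions of mean zero
  let mean : S →ₗ[ℂ] ℂ :=
    { toFun := fun f => ∫ x, f.1 x * weylDensity x ∂torusMeasure N
      map_add' := fun f g => by
        simp only [Submodule.coe_add, Pi.add_apply, add_mul]
        exact integral_add (hint _ f.2) (hint _ g.2)
      map_smul' := fun c f => by
        simp only [Submodule.coe_smul, Pi.smul_apply, smul_eq_mul, mul_assoc, RingHom.id_apply]
        exact integral_const_mul c _ }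
  -- Integration by parts against the empty monomial, the constant 1, all of whose derivatives
  -- vanish.
  have hmean : ∀ c : List ℤ →₀ ℂ,
      ∫ x, torusEvalLaplacian N c x * weylDensity x ∂torusMeasure N = 0 := fun c => by
    have h1 := integral_conj_mul_torusEvalLaplacian (N := N) (Finsupp.single [] 1) c
    have h2 : ∀ x : Fin N → UnitAddCircle, torusEval N (Finsupp.single [] 1) x = 1 := fun x => by
      simp [torusEval, formalEval, powerMonomial]
    have h3 : ∀ (k : Fin N) x, torusEvalDeriv k (Finsupp.single [] 1) x = 0 := fun k x => by
      simp [torusEvalDeriv, formalEval, powerMonomialDeriv]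
    simpa [h2, h3] using h1
  -- The Laplacian is defined on formal combinations, and different combinations may give the same
  -- function; choosing representatives by `σ` avoids proving independence of the choice.
  let Δ : S →ₗ[ℂ] S :=
    { toFun := fun f => ⟨torusEvalLaplacian N (σ f).1, hlap _ (σ f).2⟩
      map_add' := fun f g => by ext; simp
      map_smul' := fun c f => by ext; simp }
  -- Energy argument: integrating `conj f · Δ f` by parts gives the weighted sum of the `|∂_k f|^2`,
  -- so `Δ f = 0` forces `f` to be constant, and mean zero makes that constant vanish.
  have hinj : ∀ f : S, mean f = 0 → Δ f = 0 → f = 0 := fun f hf0 hf => by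
    have h1 : torusEvalLaplacian N (σ f).1 = 0 :=
      congrArg Subtype.val hf
    have h2 := integral_conj_mul_torusEvalLaplacian (N := N) (σ f).1 (σ f).1
    simp only [h1, Pi.zero_apply, mul_zero, zero_mul, integral_zero] at h2
    have h3 := eq_of_torusEvalDeriv_eq_zero fun k x =>
      eq_zero_of_integral_normSq_mul_weylDensity
        (fun k => continuous_torusEvalDeriv k (σ f).1) h2.symm k x
    rw [hσ] at h3
    have h4 : ∫ x, f.1 x * weylDensity x ∂torusMeasure N = 0 := hf0
    rw [funext fun x => congrArg (· * weylDensity x) (h3 x), integral_const_mul] at h4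
    have h5 := (mul_eq_zero.1 h4).resolve_right integral_weylDensity_ne_zero
    ext x
    rw [h3, h5]
    rfl
  have hone : (fun _ : Fin N → UnitAddCircle => (1 : ℂ)) ∈ S :=
    powerMonomial_mem_powerSpan (P := torusPowerSum) (l := []) (by simp)
  set Z := ∫ x, weylDensity x ∂torusMeasure N with hZ
  let f : S := ⟨_, powerMonomial_mem_powerSpan (P := torusPowerSum) (l := l) le_rfl⟩
  set a := mean f / Z with ha
  have hf : mean (f - a • (⟨_, hone⟩ : S)) = 0 := by
    have h1 : mean ⟨_, hone⟩ = Z := by simp [mean, hZ]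
    rw [map_sub, map_smul, h1, smul_eq_mul, ha,
      div_mul_cancel₀ _ integral_weylDensity_ne_zero, sub_self]
  obtain ⟨g, hg⟩ := exists_apply_eq_of_injOn_ker Δ mean (fun f => hmean _) hinj hf
  refine ⟨a, (σ g).1, fun x => ?_⟩
  have h1 : torusEvalLaplacian N (σ g).1 x = powerMonomial (torusPowerSum x) l - a * 1 :=
    congrArg (fun g : S => g.1 x) hg
  rw [h1]
  ring

/-- The Weyl integration formula for power sum monomials. -/
theorem integral_haarUnitary_powerMonomial (l : List ℤ) :
    (∫ A, powerMonomial (unitaryPowerSum A) l ∂haarUnitary N) *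
        ∫ x, weylDensity x ∂torusMeasure N =
      ∫ x, powerMonomial (torusPowerSum x) l * weylDensity x ∂torusMeasure N := by
  obtain ⟨a, c, h⟩ := exists_torusEvalLaplacian_eq (N := N) l
  -- Both sides involve power sums only, so the torus identity, read at the eigenvalues of `A`,
  -- holds on the group.
  have hG : ∀ A : Matrix.unitaryGroup (Fin N) ℂ, powerMonomial (unitaryPowerSum A) l =
      a + ∑ l ∈ c.support, c l * powerMonomialLaplacian (unitaryPowerSum A) l := fun A => by
    obtain ⟨x, hx, -⟩ := exists_torus_eigenvalues A
    rw [hx, h, torusEvalLaplacian, formalEval_apply]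
  have hcl : ∀ l, Continuous fun A : Matrix.unitaryGroup (Fin N) ℂ =>
      powerMonomialLaplacian (unitaryPowerSum A) l := fun l => by
    have h1 : (fun A : Matrix.unitaryGroup (Fin N) ℂ => powerMonomialLaplacian
        (unitaryPowerSum A) l) = fun A => -∑ i, powerMonomialDeriv₂ (unitaryPowerSum A)
          (unitaryPowerSumDeriv (skewFamily i) A) (unitaryPowerSumDeriv₂ (skewFamily i) A) l := by
      ext A
      rw [sum_powerMonomialDeriv₂_unitary, neg_neg]
    rw [h1]
    exact (continuous_finsetSum _ fun i _ => continuous_powerMonomialDeriv₂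
      continuous_unitaryPowerSum (continuous_unitaryPowerSumDeriv _)
      (continuous_unitaryPowerSumDeriv₂ _) l).neg
  have hGint : ∫ A, powerMonomial (unitaryPowerSum A) l ∂haarUnitary N = a := by
    have h1 : ∀ l ∈ c.support, Integrable (fun A : Matrix.unitaryGroup (Fin N) ℂ =>
        c l * powerMonomialLaplacian (unitaryPowerSum A) l) (haarUnitary N) := fun l _ =>
      (integrable_haarUnitary (hcl l)).const_mul _
    simp only [hG]
    rw [integral_add (integrable_const _) (integrable_finsetSum _ h1), integral_finsetSum _ h1]
    simp [integral_const_mul, integral_haarUnitary_powerMonomialLaplacian]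
  have h1 := integral_conj_mul_torusEvalLaplacian (N := N) (Finsupp.single [] 1) c
  have h2 : ∀ x : Fin N → UnitAddCircle, torusEval N (Finsupp.single [] 1) x = 1 := fun x => by
    simp [torusEval, formalEval, powerMonomial]
  have h3 : ∀ (k : Fin N) x, torusEvalDeriv k (Finsupp.single [] 1) x = 0 := fun k x => by
    simp [torusEvalDeriv, formalEval, powerMonomialDeriv]
  simp only [h2, h3, map_one, one_mul, map_zero, zero_mul, Finset.sum_const_zero,
    integral_zero] at h1
  have h4 : Continuous fun x => torusEvalLaplacian N c x := by
    have : (fun x => torusEvalLaplacian N c x) = fun x => torusEval N (Finsupp.single l 1) x - a := by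
      ext x
      simp [torusEval, formalEval, h]
    rw [this]
    exact (continuous_torusEval _).sub continuous_const
  rw [hGint, ← integral_const_mul, ← add_zero (∫ x, a * weylDensity x ∂_), ← h1, ← integral_add]
  · simp only [h, add_mul]
  · exact integrable_torus (continuous_const.mul continuous_weylDensity)
  · exact integrable_torus (h4.mul continuous_weylDensity)

/-- The Weyl integration formula for exponentials of series of power sums. -/
theorem integral_haarUnitary_exp {h : ℤ → ℂ} (hh : Summable fun m => ‖h m‖) :
    (∫ A, Complex.exp (∑' m, h m * unitaryPowerSum A m) ∂haarUnitary N) *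
        ∫ x, weylDensity x ∂torusMeasure N =
      ∫ x, Complex.exp (∑' m, h m * torusPowerSum x m) * weylDensity x ∂torusMeasure N := by
  -- the two evaluations as continuous functions on the disjoint union
  set Y := Matrix.unitaryGroup (Fin N) ℂ ⊕ (Fin N → UnitAddCircle)
  let p : Y → ℤ → ℂ := Sum.elim unitaryPowerSum torusPowerSum
  have hp : ∀ m, Continuous fun y => p y m := fun m => by
    refine continuous_sum_dom.2 ⟨continuous_unitaryPowerSum m, continuous_torusPowerSum m⟩
  let P : ℤ → C(Y, ℂ) := fun m => ⟨fun y => p y m, hp m⟩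
  have hPn : ∀ m, ‖P m‖ ≤ N := fun m => by
    have hT : ∀ x : Fin N → UnitAddCircle, ‖torusPowerSum x m‖ ≤ N := fun x =>
      (norm_sum_le _ _).trans (by simp [norm_circlePoint])
    refine (ContinuousMap.norm_le _ (Nat.cast_nonneg N)).2 ?_
    rintro (A | x)
    · obtain ⟨x, hx, -⟩ := exists_torus_eigenvalues A
      change ‖unitaryPowerSum A m‖ ≤ N
      rw [hx]
      exact hT x
    · exact hT x
  let 𝒜 : Subalgebra ℂ C(Y, ℂ) := Algebra.adjoin ℂ (Set.range P)
  have hmono : ∀ l : List ℤ, ∃ f : C(Y, ℂ), ∀ y, f y = powerMonomial (p y) l := fun l =>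
    ⟨⟨_, continuous_powerMonomial hp l⟩, fun _ => rfl⟩
  -- The defect in the Weyl formula is a continuous linear functional. It vanishes on products of
  -- power sums, hence on the closed algebra they generate, and that algebra contains the
  -- exponential of the series.
  let Φ : C(Y, ℂ) → ℂ := fun f =>
    (∫ A, f (Sum.inl A) ∂haarUnitary N) * (∫ x, weylDensity x ∂torusMeasure N) -
      ∫ x, f (Sum.inr x) * weylDensity x ∂torusMeasure N
  have hinl : ∀ f : C(Y, ℂ), Integrable (fun A => f (Sum.inl A)) (haarUnitary N) := fun f =>
    integrable_haarUnitary (f.continuous.comp continuous_inl)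
  have hinr : ∀ f : C(Y, ℂ), Integrable (fun x => f (Sum.inr x) * weylDensity x)
      (torusMeasure N) := fun f =>
    integrable_torus ((f.continuous.comp continuous_inr).mul continuous_weylDensity)
  have hΦadd : ∀ f g, Φ (f + g) = Φ f + Φ g := fun f g => by
    simp only [Φ, ContinuousMap.add_apply, add_mul]
    rw [integral_add (hinl f) (hinl g), integral_add (hinr f) (hinr g)]
    ring
  have hΦsmul : ∀ (c : ℂ) f, Φ (c • f) = c * Φ f := fun c f => by
    simp only [Φ, ContinuousMap.smul_apply, smul_eq_mul, mul_assoc]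
    rw [integral_const_mul, integral_const_mul]
    ring
  obtain ⟨M, hM⟩ : ∃ M, ∀ x : Fin N → UnitAddCircle, ‖weylDensity x‖ ≤ M := by
    obtain ⟨C, hC⟩ := (isCompact_range (continuous_weylDensity (N := N))).isBounded.exists_norm_le
    exact ⟨C, fun x => hC _ ⟨x, rfl⟩⟩
  have hΦcont : Continuous Φ := by
    let Ψ : C(Y, ℂ) →+ ℂ := ⟨⟨Φ, by simp [Φ]⟩, hΦadd⟩
    refine AddMonoidHomClass.continuous_of_bound Ψ
      (‖∫ x, weylDensity x ∂torusMeasure N‖ + M) fun f => ?_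
    have h1 : ‖∫ A, f (Sum.inl A) ∂haarUnitary N‖ ≤ ‖f‖ := by
      simpa using norm_integral_le_of_norm_le_const (μ := haarUnitary N)
        (Filter.Eventually.of_forall fun A => f.norm_coe_le_norm (Sum.inl A))
    have h2 : ‖∫ x, f (Sum.inr x) * weylDensity x ∂torusMeasure N‖ ≤ ‖f‖ * M := by
      simpa using norm_integral_le_of_norm_le_const (μ := torusMeasure N)
        (Filter.Eventually.of_forall fun x => by
          rw [norm_mul]
          exact mul_le_mul (f.norm_coe_le_norm (Sum.inr x)) (hM x) (norm_nonneg _) (norm_nonneg _))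
    calc ‖Φ f‖ ≤ ‖∫ A, f (Sum.inl A) ∂haarUnitary N‖ * ‖∫ x, weylDensity x ∂torusMeasure N‖ +
          ‖∫ x, f (Sum.inr x) * weylDensity x ∂torusMeasure N‖ := by
          rw [← norm_mul]; exact norm_sub_le _ _
      _ ≤ ‖f‖ * ‖∫ x, weylDensity x ∂torusMeasure N‖ + ‖f‖ * M :=
          add_le_add (mul_le_mul_of_nonneg_right h1 (norm_nonneg _)) h2
      _ = (‖∫ x, weylDensity x ∂torusMeasure N‖ + M) * ‖f‖ := by ring
  have hΦmono : ∀ f ∈ Submonoid.closure (Set.range P), Φ f = 0 := fun f hf => by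
    obtain ⟨l, hl⟩ : ∃ l : List ℤ, ∀ y, f y = powerMonomial (p y) l := by
      induction hf using Submonoid.closure_induction_left with
      | one => exact ⟨[], fun _ => rfl⟩
      | mul_left g hg f _ ih =>
        obtain ⟨l, hl⟩ := ih
        obtain ⟨m, rfl⟩ := hg
        exact ⟨m :: l, fun y => by rw [ContinuousMap.mul_apply, hl]; rfl⟩
    simp only [Φ, hl]
    exact sub_eq_zero.2 (integral_haarUnitary_powerMonomial l)
  have hΦ𝒜 : ∀ f ∈ 𝒜, Φ f = 0 := fun f hf => by
    rw [← Subalgebra.mem_toSubmodule, Algebra.adjoin_eq_span] at hf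
    induction hf using Submodule.span_induction with
    | mem f hf => exact hΦmono f hf
    | zero => simp [Φ]
    | add f g _ _ hf hg => rw [hΦadd, hf, hg, add_zero]
    | smul c f _ hf => rw [hΦsmul, hf, mul_zero]
  have hΦcl : ∀ f ∈ 𝒜.topologicalClosure, Φ f = 0 := fun f hf =>
    closure_minimal (s := (𝒜 : Set C(Y, ℂ))) (t := {f | Φ f = 0}) hΦ𝒜
      (isClosed_eq hΦcont continuous_const) hf
  have hsum : Summable fun m => h m • P m := by
    refine Summable.of_norm_bounded (hh.mul_right (N : ℝ)) fun m => ?_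
    rw [norm_smul]
    exact mul_le_mul_of_nonneg_left (hPn m) (norm_nonneg _)
  set H := ∑' m, h m • P m with hH
  have hHmem : H ∈ 𝒜.topologicalClosure :=
    𝒜.isClosed_topologicalClosure.mem_of_tendsto hsum.hasSum (Filter.Eventually.of_forall fun s =>
      𝒜.le_topologicalClosure (Subalgebra.sum_mem _ fun m _ =>
        Subalgebra.smul_mem _ (Algebra.subset_adjoin (Set.mem_range_self m)) _))
  have hexp : NormedSpace.exp H ∈ 𝒜.topologicalClosure :=
    𝒜.isClosed_topologicalClosure.mem_of_tendsto (NormedSpace.exp_series_hasSum_exp' (𝕂 := ℂ) H)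
      (Filter.Eventually.of_forall fun s => Subalgebra.sum_mem _ fun n _ =>
        Subalgebra.smul_mem _ (Subalgebra.pow_mem _ hHmem _) _)
  have hHy : ∀ y, H y = ∑' m, h m * p y m := fun y => by
    exact (ContinuousMap.evalCLM ℂ y).map_tsum hsum
  have hexpy : ∀ y, NormedSpace.exp H y = Complex.exp (∑' m, h m * p y m) := fun y => by
    have h1 := (NormedSpace.exp_series_hasSum_exp' (𝕂 := ℂ) H)
    have h2 := (ContinuousMap.evalCLM ℂ y).hasSum h1
    have h3 := NormedSpace.exp_series_hasSum_exp' (𝕂 := ℂ) (H y)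
    rw [Complex.exp_eq_exp_ℂ, ← hHy]
    exact h2.unique h3
  have := hΦcl _ hexp
  simp only [Φ, hexpy] at this
  exact sub_eq_zero.1 this

end WeylIntegration

/-! ### Moments of characteristic polynomials as torus integrals -/

section Ratio

variable {N : ℕ}

/-- The Fourier coefficients of `x ↦ -2 log |1 - z x|` on the unit circle. -/
noncomputable def logCoeff (z : ℂ) (m : ℤ) : ℂ :=
  -- At `m = 0` this is `1 / 0 = 0`, so there is no constant term, as required.
  (if 0 ≤ m then z else conj z) ^ m.natAbs / m.natAbs

theorem norm_logCoeff_le (z : ℂ) (m : ℤ) : ‖logCoeff z m‖ ≤ ‖z‖ ^ m.natAbs := by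
  have h1 : ‖logCoeff z m‖ = ‖z‖ ^ m.natAbs / m.natAbs := by
    rw [logCoeff, norm_div, norm_pow]
    split_ifs <;> simp
  rw [h1]
  rcases Nat.eq_zero_or_pos m.natAbs with h | h
  · simp [h]
  · exact div_le_self (by positivity) (by exact_mod_cast h)

theorem summable_norm_logCoeff {z : ℂ} (hz : ‖z‖ < 1) : Summable fun m => ‖logCoeff z m‖ := by
  refine Summable.of_nonneg_of_le (fun _ => norm_nonneg _) (norm_logCoeff_le z) ?_
  have h := summable_geometric_of_lt_one (norm_nonneg z) hz
  refine Summable.of_nat_of_neg ?_ ?_ <;> simpa using h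

theorem hasSum_logCoeff {z x : ℂ} (hz : ‖z‖ < 1) (hx : ‖x‖ = 1) :
    HasSum (fun m => logCoeff z m * x ^ m)
      (-Complex.log (1 - z * x) + -Complex.log (1 - conj z * x⁻¹)) := by
  have h1 : HasSum (fun n : ℕ => logCoeff z n * x ^ (n : ℤ)) (-Complex.log (1 - z * x)) := by
    have := Complex.hasSum_taylorSeries_neg_log (z := z * x) (by rwa [norm_mul, hx, mul_one])
    refine this.congr_fun fun n => ?_
    simp [logCoeff, mul_pow, mul_div_right_comm]
  have h2 : HasSum (fun n : ℕ => logCoeff z (-(n + 1 : ℤ)) * x ^ (-(n + 1 : ℤ)))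
      (-Complex.log (1 - conj z * x⁻¹)) := by
    have := Complex.hasSum_taylorSeries_neg_log (z := conj z * x⁻¹)
      (by rwa [norm_mul, norm_inv, hx, inv_one, mul_one, Complex.norm_conj])
    rw [← hasSum_nat_add_iff' 1] at this
    simp only [Finset.range_one, Finset.sum_singleton, Nat.cast_zero, div_zero, sub_zero] at this
    refine this.congr_fun fun n => ?_
    have h3 : ¬ (0 : ℤ) ≤ -(n + 1 : ℤ) := by omega
    have h4 : (-(n + 1 : ℤ)).natAbs = n + 1 := by omega
    have h5 : x ^ (-(n + 1 : ℤ)) = x⁻¹ ^ (n + 1) := by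
      rw [zpow_neg, ← inv_zpow]; exact_mod_cast zpow_natCast x⁻¹ (n + 1)
    rw [logCoeff, if_neg h3, h4, h5, mul_pow]
    ring
  exact HasSum.of_nat_of_neg_add_one h1 h2

theorem exp_log_add_log {z x : ℂ} (hz : ‖z‖ < 1) (hx : ‖x‖ = 1) :
    Complex.exp (-Complex.log (1 - z * x) + -Complex.log (1 - conj z * x⁻¹)) =
      ((‖1 - z * x‖ ^ 2)⁻¹ : ℝ) := by
  have h1 : 1 - z * x ≠ 0 := fun h => by
    have h2 : ‖z * x‖ = 1 := by rw [← sub_eq_zero.1 h, norm_one]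
    rw [norm_mul, hx, mul_one] at h2
    exact hz.ne h2
  have h2 : conj (1 - z * x) = 1 - conj z * x⁻¹ := by
    rw [map_sub, map_mul, map_one, Complex.inv_def, Complex.normSq_eq_norm_sq, hx]
    simp
  have h3 : 1 - conj z * x⁻¹ ≠ 0 := by rw [← h2]; exact (map_ne_zero _).2 h1
  rw [Complex.exp_add, Complex.exp_neg, Complex.exp_neg, Complex.exp_log h1, Complex.exp_log h3,
    ← mul_inv, ← h2, Complex.mul_conj, Complex.normSq_eq_norm_sq]
  simp

variable {ι κ : Type*} [Fintype ι] [Fintype κ]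

/-- The real Weyl density `∏_{i < j} |z_i - z_j|²`. -/
noncomputable def weylDensityReal (x : Fin N → UnitAddCircle) : ℝ :=
  ∏ q ∈ ltPairs N, ‖circlePoint (x q.1) - circlePoint (x q.2)‖ ^ 2

/-- `logCoeff` expands minus the logarithm, so the denominators enter with a plus sign. The
logarithm series turn the ratio into an exponential to which `integral_haarUnitary_exp` applies. -/
theorem exp_tsum_logCoeff_torus {z : ι → ℂ} {b : κ → ℂ} (hz : ∀ i, ‖z i‖ < 1)
    (hb : ∀ j, ‖b j‖ < 1) (x : Fin N → UnitAddCircle) :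
    Complex.exp (∑' m, (∑ j, logCoeff (b j) m - ∑ i, logCoeff (z i) m) * torusPowerSum x m) =
      ((∏ r, ((∏ i, ‖1 - z i * circlePoint (x r)‖ ^ 2) /
        ∏ j, ‖1 - b j * circlePoint (x r)‖ ^ 2) : ℝ) : ℂ) := by
  set S : ℂ → ℂ → ℂ := fun z x => -Complex.log (1 - z * x) + -Complex.log (1 - conj z * x⁻¹)
  have h1 : HasSum (fun m => (∑ j, logCoeff (b j) m - ∑ i, logCoeff (z i) m) * torusPowerSum x m)
      (∑ r, (∑ j, S (b j) (circlePoint (x r)) - ∑ i, S (z i) (circlePoint (x r)))) := by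
    simp only [torusPowerSum, Finset.mul_sum]
    refine hasSum_sum fun r _ => ?_
    simp only [sub_mul, Finset.sum_mul]
    exact (hasSum_sum fun j _ => hasSum_logCoeff (hb j) (norm_circlePoint _)).sub
      (hasSum_sum fun i _ => hasSum_logCoeff (hz i) (norm_circlePoint _))
  rw [h1.tsum_eq, Complex.exp_sum, Complex.ofReal_prod]
  refine Finset.prod_congr rfl fun r _ => ?_
  rw [Complex.exp_sub, Complex.exp_sum, Complex.exp_sum]
  simp only [S, exp_log_add_log (hb _) (norm_circlePoint _),
    exp_log_add_log (hz _) (norm_circlePoint _)]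
  push_cast
  rw [Finset.prod_inv_distrib, Finset.prod_inv_distrib, div_inv_eq_mul, mul_comm, div_eq_mul_inv]

theorem exp_tsum_logCoeff_unitary {z : ι → ℂ} {b : κ → ℂ} (hz : ∀ i, ‖z i‖ < 1)
    (hb : ∀ j, ‖b j‖ < 1) (A : Matrix.unitaryGroup (Fin N) ℂ) :
    Complex.exp (∑' m, (∑ j, logCoeff (b j) m - ∑ i, logCoeff (z i) m) * unitaryPowerSum A m) =
      (((∏ i, ‖(1 - z i • (A : Matrix (Fin N) (Fin N) ℂ)).det‖ ^ 2) /
        ∏ j, ‖(1 - b j • (A : Matrix (Fin N) (Fin N) ℂ)).det‖ ^ 2 : ℝ) : ℂ) := by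
  obtain ⟨x, hx, hdet⟩ := exists_torus_eigenvalues A
  rw [hx, exp_tsum_logCoeff_torus hz hb]
  congr 1
  simp only [hdet, norm_prod, Finset.prod_div_distrib, ← Finset.prod_pow]
  rw [Finset.prod_comm, Finset.prod_comm (f := fun j r => ‖1 - b j * circlePoint (x r)‖ ^ 2)]

theorem det_one_sub_smul_ne_zero {z : ℂ} (hz : ‖z‖ < 1) (A : Matrix.unitaryGroup (Fin N) ℂ) :
    (1 - z • (A : Matrix (Fin N) (Fin N) ℂ)).det ≠ 0 := by
  obtain ⟨x, -, hdet⟩ := exists_torus_eigenvalues A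
  rw [hdet, Finset.prod_ne_zero_iff]
  intro r _ h
  have h2 : ‖z * circlePoint (x r)‖ = 1 := by rw [← sub_eq_zero.1 h, norm_one]
  rw [norm_mul, norm_circlePoint, mul_one] at h2
  exact hz.ne h2

/-- The Weyl integration formula for ratios of characteristic polynomials. -/
theorem integral_haarUnitary_ratio {z : ι → ℂ} {b : κ → ℂ} (hz : ∀ i, ‖z i‖ < 1)
    (hb : ∀ j, ‖b j‖ < 1) :
    (∫ A : Matrix.unitaryGroup (Fin N) ℂ,
        (∏ i, ‖(1 - z i • (A : Matrix (Fin N) (Fin N) ℂ)).det‖ ^ 2) /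
          ∏ j, ‖(1 - b j • (A : Matrix (Fin N) (Fin N) ℂ)).det‖ ^ 2 ∂haarUnitary N) *
        ∫ x, weylDensityReal x ∂torusMeasure N =
      ∫ x, (∏ r, ((∏ i, ‖1 - z i * circlePoint (x r)‖ ^ 2) /
        ∏ j, ‖1 - b j * circlePoint (x r)‖ ^ 2)) * weylDensityReal x ∂torusMeasure N := by
  have hs : Summable fun m => ‖∑ j, logCoeff (b j) m - ∑ i, logCoeff (z i) m‖ := by
    refine Summable.of_nonneg_of_le (fun _ => norm_nonneg _) (fun m => (norm_sub_le _ _).trans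
      (add_le_add (norm_sum_le _ _) (norm_sum_le _ _)))
      ((summable_sum fun j _ => summable_norm_logCoeff (hb j)).add
        (summable_sum fun i _ => summable_norm_logCoeff (hz i)))
  have h := integral_haarUnitary_exp (N := N) hs
  simp only [exp_tsum_logCoeff_torus hz hb, exp_tsum_logCoeff_unitary hz hb, weylDensity_eq] at h
  rw [integral_complex_ofReal, integral_complex_ofReal] at h
  simp only [← Complex.ofReal_mul, integral_complex_ofReal] at h
  exact_mod_cast h

theorem continuous_ratio_unitary {z : ι → ℂ} {b : κ → ℂ} (hb : ∀ j, ‖b j‖ < 1) :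
    Continuous fun A : Matrix.unitaryGroup (Fin N) ℂ =>
      (∏ i, ‖(1 - z i • (A : Matrix (Fin N) (Fin N) ℂ)).det‖ ^ 2) /
        ∏ j, ‖(1 - b j • (A : Matrix (Fin N) (Fin N) ℂ)).det‖ ^ 2 := by
  have h : ∀ z : ℂ, Continuous fun A : Matrix.unitaryGroup (Fin N) ℂ =>
      ‖(1 - z • (A : Matrix (Fin N) (Fin N) ℂ)).det‖ ^ 2 := fun z =>
    ((continuous_const.sub (continuous_subtype_val.const_smul z)).matrix_det.norm).pow 2
  refine (continuous_finsetProd _ fun i _ => h (z i)).div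
    (continuous_finsetProd _ fun j _ => h (b j)) fun A => Finset.prod_ne_zero_iff.2 fun j _ => ?_
  exact pow_ne_zero 2 (norm_ne_zero_iff.2 (det_one_sub_smul_ne_zero (hb j) A))

end Ratio

/-! ### Integrals of determinants of projection kernels -/

section Mehta

open Matrix

/-- For invertible `A` this is the Schur complement. The form with the adjugate is continuous in
`A`, and `A + t` is invertible for all but finitely many `t`, so the identity extends to singular
`A`. -/
theorem det_bordered {ι : Type*} [Fintype ι] [DecidableEq ι] (A : Matrix ι ι ℂ) (u v : ι → ℂ)
    (d : ℂ) : (Matrix.fromBlocks A (Matrix.of fun i (_ : Unit) => u i)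
      (Matrix.of fun _ j => v j) (Matrix.of fun _ _ => d)).det =
      d * A.det - ∑ i, ∑ j, v i * A.adjugate i j * u j := by
  have h1 : ∀ A : Matrix ι ι ℂ, A.det ≠ 0 → (Matrix.fromBlocks A
      (Matrix.of fun i (_ : Unit) => u i) (Matrix.of fun _ j => v j)
      (Matrix.of fun _ _ => d)).det = d * A.det - ∑ i, ∑ j, v i * A.adjugate i j * u j := by
    intro A hA
    have := A.invertibleOfIsUnitDet (isUnit_iff_ne_zero.2 hA)
    rw [Matrix.det_fromBlocks₁₁, Matrix.det_unique (n := Unit), Matrix.invOf_eq_nonsing_inv]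
    simp only [Matrix.sub_apply, Matrix.mul_apply, Matrix.of_apply, mul_sub, Finset.sum_mul,
      Finset.mul_sum]
    rw [mul_comm A.det, Finset.sum_comm]
    congr 1
    refine Finset.sum_congr rfl fun i _ => Finset.sum_congr rfl fun j _ => ?_
    rw [Matrix.inv_def, Matrix.smul_apply, smul_eq_mul, Ring.inverse_eq_inv']
    field_simp
  have hdense : Dense {t : ℂ | (A + t • (1 : Matrix ι ι ℂ)).det ≠ 0} := by
    have h2 : {t : ℂ | (A + t • (1 : Matrix ι ι ℂ)).det ≠ 0}ᶜ ⊆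
        ((-A).charpoly.roots.toFinset : Set ℂ) := fun t ht => by
      rw [Finset.mem_coe, Multiset.mem_toFinset,
        Polynomial.mem_roots (Matrix.charpoly_monic (-A)).ne_zero, Polynomial.IsRoot,
        Matrix.eval_charpoly]
      have h3 := not_not.1 ht
      rw [← h3, Matrix.scalar_apply, smul_one_eq_diagonal, sub_neg_eq_add, add_comm]
    have h4 := (((-A).charpoly.roots.toFinset.finite_toSet.subset h2).countable).dense_compl ℂ
    rwa [compl_compl] at h4
  have hct : Continuous fun t : ℂ => A + t • (1 : Matrix ι ι ℂ) :=
    continuous_const.add (continuous_id.smul continuous_const)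
  have h5 := Continuous.ext_on (f := fun t : ℂ => (Matrix.fromBlocks (A + t • (1 : Matrix ι ι ℂ))
      (Matrix.of fun i (_ : Unit) => u i) (Matrix.of fun _ j => v j)
      (Matrix.of fun _ _ => d)).det) (g := fun t => d * (A + t • (1 : Matrix ι ι ℂ)).det -
        ∑ i, ∑ j, v i * (A + t • (1 : Matrix ι ι ℂ)).adjugate i j * u j) hdense
    (hct.matrix_fromBlocks continuous_const continuous_const continuous_const).matrix_det
    ((continuous_const.mul hct.matrix_det).sub (continuous_finsetSum _ fun i _ =>
      continuous_finsetSum _ fun j _ => (continuous_const.mul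
        (hct.matrix_adjugate.matrix_elem i j)).mul continuous_const)) fun t ht => h1 _ ht
  simpa using congrFun h5 0

theorem integral_torus_succ {n : ℕ} {f : (Fin (n + 1) → UnitAddCircle) → ℂ} (hf : Continuous f) :
    ∫ x, f x ∂torusMeasure (n + 1) =
      ∫ θ, ∫ x, f (Fin.cons θ x) ∂torusMeasure n ∂AddCircle.haarAddCircle := by
  have h1 := (measurePreserving_piFinSuccAbove (n := n)
    (fun _ => (AddCircle.haarAddCircle : Measure UnitAddCircle)) 0).symm
  rw [torusMeasure, ← h1.integral_comp' f]
  have h2 : ∀ q : UnitAddCircle × (Fin n → UnitAddCircle),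
      (MeasurableEquiv.piFinSuccAbove (fun _ => UnitAddCircle) 0).symm q = Fin.cons q.1 q.2 :=
    fun q => Fin.insertNth_zero' q.1 q.2
  rw [integral_congr_ae (Filter.Eventually.of_forall fun q => congrArg f (h2 q)), integral_prod]
  · rfl
  · exact (hf.comp (continuous_fst.finCons continuous_snd)).integrable_of_hasCompactSupport
      (HasCompactSupport.of_compactSpace _)

/-- Successive integration of the determinants of a projection kernel of rank `M`. -/
theorem integral_det_kernel {ρ : UnitAddCircle → ℂ} (hρ : Continuous ρ) {K : ℂ → ℂ → ℂ}
    (hK : Continuous fun q : ℂ × ℂ => K q.1 q.2) {M : ℂ}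
    (hrep : ∀ p r, ∫ θ, K p (circlePoint θ) * K (circlePoint θ) r * ρ θ ∂AddCircle.haarAddCircle =
      K p r)
    (htr : ∫ θ, K (circlePoint θ) (circlePoint θ) * ρ θ ∂AddCircle.haarAddCircle = M) (n : ℕ) :
    ∀ {ι : Type} [Fintype ι] [DecidableEq ι] (z : ι → ℂ),
      ∫ x, (Matrix.of fun s t : ι ⊕ Fin n => K (Sum.elim z (circlePoint ∘ x) s)
        (Sum.elim z (circlePoint ∘ x) t)).det * ∏ r, ρ (x r) ∂torusMeasure n =
      (∏ j ∈ Finset.range n, (M - Fintype.card ι - j)) * (Matrix.of fun s t => K (z s) (z t)).det := by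
  have hKc : ∀ {X : Type} [TopologicalSpace X] {f g : X → ℂ}, Continuous f → Continuous g →
      Continuous fun x => K (f x) (g x) := fun hf hg => hK.comp (hf.prodMk hg)
  -- One integration. In the bordered expansion the corner entry contributes `M det A`; by the
  -- reproducing property the adjugate sum becomes the trace of `adjugate A * A`, that is `|ι| det
  -- A`.
  have hone : ∀ {ι : Type} [Fintype ι] [DecidableEq ι] (z : ι → ℂ),
      ∫ θ, (Matrix.of fun s t : ι ⊕ Unit => K (Sum.elim z (fun _ => circlePoint θ) s)
        (Sum.elim z (fun _ => circlePoint θ) t)).det * ρ θ ∂AddCircle.haarAddCircle =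
      (M - Fintype.card ι) * (Matrix.of fun s t => K (z s) (z t)).det := by
    intro ι _ _ z
    set A : Matrix ι ι ℂ := Matrix.of fun s t => K (z s) (z t) with hA
    have h1 : ∀ θ, (Matrix.of fun s t : ι ⊕ Unit => K (Sum.elim z (fun _ => circlePoint θ) s)
        (Sum.elim z (fun _ => circlePoint θ) t)).det * ρ θ =
        A.det * (K (circlePoint θ) (circlePoint θ) * ρ θ) - ∑ i, ∑ j, A.adjugate i j *
          (K (z j) (circlePoint θ) * K (circlePoint θ) (z i) * ρ θ) := fun θ => by
      have h2 : (Matrix.of fun s t : ι ⊕ Unit => K (Sum.elim z (fun _ => circlePoint θ) s)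
        (Sum.elim z (fun _ => circlePoint θ) t)) = Matrix.fromBlocks A
          (Matrix.of fun i (_ : Unit) => K (z i) (circlePoint θ))
          (Matrix.of fun _ j => K (circlePoint θ) (z j))
          (Matrix.of fun _ _ => K (circlePoint θ) (circlePoint θ)) := by
        ext (s | s) (t | t) <;> rfl
      rw [h2, det_bordered, sub_mul, Finset.sum_mul]
      congr 1
      · ring
      · refine Finset.sum_congr rfl fun i _ => ?_
        rw [Finset.sum_mul]
        exact Finset.sum_congr rfl fun j _ => by ring
    have hint : ∀ {f : UnitAddCircle → ℂ}, Continuous f → Integrable f AddCircle.haarAddCircle :=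
      fun hf => hf.integrable_of_hasCompactSupport (HasCompactSupport.of_compactSpace _)
    have hc1 : Continuous fun θ => K (circlePoint θ) (circlePoint θ) * ρ θ :=
      (hKc continuous_circlePoint continuous_circlePoint).mul hρ
    have hc2 : ∀ i j, Continuous fun θ => A.adjugate i j *
          (K (z j) (circlePoint θ) * K (circlePoint θ) (z i) * ρ θ) := fun i j =>
      continuous_const.mul (((hKc continuous_const continuous_circlePoint).mul
        (hKc continuous_circlePoint continuous_const)).mul hρ)
    simp only [h1]
    rw [integral_sub ((hint hc1).const_mul _) (hint (continuous_finsetSum _ fun i _ =>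
      continuous_finsetSum _ fun j _ => hc2 i j)), integral_const_mul, htr,
      integral_finsetSum _ fun i _ => hint (continuous_finsetSum _ fun j _ => hc2 i j)]
    have h3 : ∀ i, ∫ θ, ∑ j, A.adjugate i j *
          (K (z j) (circlePoint θ) * K (circlePoint θ) (z i) * ρ θ) ∂AddCircle.haarAddCircle =
        A.det := fun i => by
      rw [integral_finsetSum _ fun j _ => hint (hc2 i j)]
      simp only [integral_const_mul, hrep]
      have := congrFun (congrFun (Matrix.adjugate_mul A) i) i
      rw [Matrix.mul_apply] at this
      simpa [hA] using this
    simp only [h3, Finset.sum_const, Finset.card_univ, nsmul_eq_mul]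
    ring
  induction n with
  | zero =>
    intro ι _ _ z
    have h1 : ∀ x : Fin 0 → UnitAddCircle, (Matrix.of fun s t : ι ⊕ Fin 0 =>
        K (Sum.elim z (circlePoint ∘ x) s) (Sum.elim z (circlePoint ∘ x) t)).det =
        (Matrix.of fun s t => K (z s) (z t)).det := fun x => by
      rw [← Matrix.det_submatrix_equiv_self (Equiv.sumEmpty ι (Fin 0)).symm]
      rfl
    simp [h1]
  | succ n ih =>
    intro ι _ _ z
    have hcont : Continuous fun x : Fin (n + 1) → UnitAddCircle =>
        (Matrix.of fun s t : ι ⊕ Fin (n + 1) => K (Sum.elim z (circlePoint ∘ x) s)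
          (Sum.elim z (circlePoint ∘ x) t)).det * ∏ r, ρ (x r) := by
      have h0 : ∀ s : ι ⊕ Fin (n + 1), Continuous fun x : Fin (n + 1) → UnitAddCircle =>
          Sum.elim z (circlePoint ∘ x) s := fun s => by
        rcases s with s | s
        · exact continuous_const
        · exact continuous_circlePoint.comp (continuous_apply s)
      refine Continuous.mul (Continuous.matrix_det (continuous_matrix fun s t => ?_))
        (continuous_finsetProd _ fun r _ => hρ.comp (continuous_apply r))
      exact hKc (h0 s) (h0 t)
    rw [integral_torus_succ hcont]
    -- The first circle variable joins the frozen points, which is why the claim ranges over all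
    -- finite index types.
    let e : (ι ⊕ Unit) ⊕ Fin n ≃ ι ⊕ Fin (n + 1) :=
      (Equiv.sumAssoc ι Unit (Fin n)).trans (Equiv.sumCongr (Equiv.refl ι)
        ((Equiv.sumComm Unit (Fin n)).trans
          ((Equiv.optionEquivSumPUnit (Fin n)).symm.trans (finSuccEquiv n).symm)))
    have h1 : ∀ (θ : UnitAddCircle) (x : Fin n → UnitAddCircle),
        (Matrix.of fun s t : ι ⊕ Fin (n + 1) =>
          K (Sum.elim z (circlePoint ∘ (Fin.cons θ x : Fin (n + 1) → UnitAddCircle)) s)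
          (Sum.elim z (circlePoint ∘ (Fin.cons θ x : Fin (n + 1) → UnitAddCircle)) t)).det *
            ∏ r, ρ ((Fin.cons θ x : Fin (n + 1) → UnitAddCircle) r) =
        ρ θ * ((Matrix.of fun s t : (ι ⊕ Unit) ⊕ Fin n =>
          K (Sum.elim (Sum.elim z fun _ => circlePoint θ) (circlePoint ∘ x) s)
          (Sum.elim (Sum.elim z fun _ => circlePoint θ) (circlePoint ∘ x) t)).det *
            ∏ r, ρ (x r)) := fun θ x => by
      have h2 : ∀ s, Sum.elim z (circlePoint ∘ (Fin.cons θ x : Fin (n + 1) → UnitAddCircle)) (e s) =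
          Sum.elim (Sum.elim z fun _ => circlePoint θ) (circlePoint ∘ x) s := by
        rintro ((s | s) | s) <;> simp [e]
      rw [Fin.prod_univ_succ, ← Matrix.det_submatrix_equiv_self e]
      simp only [Fin.cons_zero, Fin.cons_succ, Matrix.submatrix, Matrix.of_apply, h2]
      ring
    -- The inner `n` variables are integrated with `|ι| + 1` frozen points; the outer one then
    -- supplies the leading factor `M - |ι|`.
    simp only [h1, integral_const_mul, ih]
    have h3 : ∀ θ, ρ θ * ((∏ j ∈ Finset.range n, (M - Fintype.card (ι ⊕ Unit) - j)) *
        (Matrix.of fun s t : ι ⊕ Unit => K (Sum.elim z (fun _ => circlePoint θ) s)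
        (Sum.elim z (fun _ => circlePoint θ) t)).det) =
        (∏ j ∈ Finset.range n, (M - Fintype.card (ι ⊕ Unit) - j)) *
        ((Matrix.of fun s t : ι ⊕ Unit => K (Sum.elim z (fun _ => circlePoint θ) s)
        (Sum.elim z (fun _ => circlePoint θ) t)).det * ρ θ) := fun θ => by ring
    simp only [h3, integral_const_mul, hone]
    rw [Finset.prod_range_succ', ← mul_assoc]
    simp only [Fintype.card_sum, Fintype.card_unit]
    push_cast
    simp only [sub_zero, sub_add_eq_sub_sub, sub_right_comm _ (1 : ℂ)]

end Mehta

/-! ### Bernstein–Szegő weights on the circle and their kernels -/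

section Szego

open Matrix

theorem integral_circlePoint (f : ℂ → ℂ) :
    ∫ θ, f (circlePoint θ) ∂AddCircle.haarAddCircle = Real.circleAverage f 0 1 := by
  have h := fourierCoeff_eq_intervalIntegral (T := 1) (fun θ => f (circlePoint θ)) 0 0
  simp only [fourierCoeff, neg_zero, fourier_zero, one_smul, zero_add, div_one] at h
  rw [h, Real.circleAverage]
  have h1 : ∀ t : ℝ, f (circlePoint (t : UnitAddCircle)) = f (circleMap 0 1 (2 * Real.pi * t)) :=
    fun t => by
      rw [circlePoint, AddCircle.toCircle_apply_mk, div_one, Circle.coe_exp, circleMap]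
      simp
  simp only [h1]
  rw [intervalIntegral.integral_comp_mul_left (fun s => f (circleMap 0 1 s))
    (by positivity : 2 * Real.pi ≠ 0)]
  simp

theorem integral_circlePoint_of_diffContOnCl {f : ℂ → ℂ} (hf : DiffContOnCl ℂ f (Metric.ball 0 1)) :
    ∫ θ, f (circlePoint θ) ∂AddCircle.haarAddCircle = f 0 := by
  rw [integral_circlePoint]
  exact DiffContOnCl.circleAverage (by simpa using hf)

theorem integral_circlePoint_cauchy {f : ℂ → ℂ} (hf : DiffContOnCl ℂ f (Metric.ball 0 1)) {w : ℂ}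
    (hw : ‖w‖ < 1) : ∫ θ, f (circlePoint θ) * (1 - w * (circlePoint θ)⁻¹)⁻¹
      ∂AddCircle.haarAddCircle = f w := by
  have h := DiffContOnCl.circleAverage_smul_div (f := f) (c := 0) (R := 1) (w := w)
    (by simpa using hf) (by simpa using hw)
  rw [← h, ← integral_circlePoint]
  refine integral_congr_ae (Filter.Eventually.of_forall fun θ => ?_)
  have h0 := circlePoint_ne_zero θ
  have h1 : circlePoint θ - w ≠ 0 := fun h => by
    have := norm_circlePoint θ
    rw [sub_eq_zero.1 h] at this
    exact hw.ne this
  have h2 : 1 - w * (circlePoint θ)⁻¹ = (circlePoint θ - w) * (circlePoint θ)⁻¹ := by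
    rw [sub_mul, mul_inv_cancel₀ h0]
  simp only [sub_zero, smul_eq_mul, h2, mul_inv, inv_inv]
  rw [div_eq_mul_inv]
  ring

variable {κ : Type*} [Fintype κ]

/-- The polynomial `∏ (1 - conj β_j z)`. -/
noncomputable def szegoPoly (β : κ → ℂ) (z : ℂ) : ℂ := ∏ j, (1 - conj (β j) * z)

/-- The numerator of the kernel of the Bernstein–Szegő weight. -/
noncomputable def szegoNum (β : κ → ℂ) (n : ℕ) (z w : ℂ) : ℂ :=
  szegoPoly β z * conj (szegoPoly β w) -
    (z ^ n * ∏ j, (z - β j)) * conj (w ^ n * ∏ j, (w - β j))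

/-- The Bernstein–Szegő weight. -/
noncomputable def szegoWeight (β : κ → ℂ) (θ : UnitAddCircle) : ℂ :=
  (szegoPoly β (circlePoint θ) * conj (szegoPoly β (circlePoint θ)))⁻¹

theorem one_sub_ne_zero_of_norm {a b : ℂ} (ha : ‖a‖ < 1) (hb : ‖b‖ ≤ 1) : 1 - a * b ≠ 0 := by
  intro h
  have h2 : ‖a * b‖ = 1 := by rw [← sub_eq_zero.1 h, norm_one]
  rw [norm_mul] at h2
  nlinarith [norm_nonneg a, norm_nonneg b]

theorem szegoPoly_ne_zero {β : κ → ℂ} (hβ : ∀ j, ‖β j‖ < 1) {z : ℂ} (hz : ‖z‖ ≤ 1) :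
    szegoPoly β z ≠ 0 :=
  Finset.prod_ne_zero_iff.2 fun j _ =>
    one_sub_ne_zero_of_norm (by rw [Complex.norm_conj]; exact hβ j) hz

theorem differentiable_szegoPoly (β : κ → ℂ) : Differentiable ℂ (szegoPoly β) := by
  unfold szegoPoly
  fun_prop

theorem continuous_szegoWeight {β : κ → ℂ} (hβ : ∀ j, ‖β j‖ < 1) :
    Continuous (szegoWeight β) := by
  have h1 := (differentiable_szegoPoly β).continuous.comp continuous_circlePoint
  refine (h1.mul (Complex.continuous_conj.comp h1)).inv₀ fun θ => mul_ne_zero ?_ ?_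
  · exact szegoPoly_ne_zero hβ (norm_circlePoint θ).le
  · exact (map_ne_zero _).2 (szegoPoly_ne_zero hβ (norm_circlePoint θ).le)

theorem diffContOnCl_pow_mul_inv {f : ℂ → ℂ} (hf : Differentiable ℂ f)
    (h0 : ∀ z, ‖z‖ ≤ 1 → f z ≠ 0) (a : ℕ) :
    DiffContOnCl ℂ (fun z => z ^ a * (f z)⁻¹) (Metric.ball 0 1) := by
  refine DifferentiableOn.diffContOnCl fun z hz => ?_
  rw [closure_ball _ one_ne_zero, mem_closedBall_zero_iff] at hz
  exact ((differentiableAt_id.pow a).mul ((hf z).inv (h0 z hz))).differentiableWithinAt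

/-- The reproducing property of the kernel of the Bernstein–Szegő weight. -/
theorem integral_pow_mul_conj_szego {β : κ → ℂ} (hβ : ∀ j, ‖β j‖ < 1) {n a : ℕ}
    (ha : a < n + Fintype.card κ) {w : ℂ} (hw : ‖w‖ < 1) {R : ℂ → ℂ}
    (hR : ∀ z, (1 - z * conj w) * R z = szegoNum β n z w) :
    ∫ θ, circlePoint θ ^ a * conj (R (circlePoint θ)) * szegoWeight β θ ∂AddCircle.haarAddCircle =
      w ^ a := by
  set q := szegoPoly β with hq
  set b := n + Fintype.card κ - a with hb
  set c := w ^ n * ∏ j, (w - β j) with hc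
  have hf := diffContOnCl_pow_mul_inv (differentiable_szegoPoly β)
    (fun z hz => szegoPoly_ne_zero hβ hz) a
  have hg := diffContOnCl_pow_mul_inv (f := fun z => q z * (1 - conj w * z))
    ((differentiable_szegoPoly β).mul (by fun_prop))
    (fun z hz => mul_ne_zero (szegoPoly_ne_zero hβ hz)
      (one_sub_ne_zero_of_norm (by rwa [Complex.norm_conj]) hz)) b
  -- On the circle, conjugating `∏ (x - β_j)` gives `x⁻¹ ^ card κ * q x`, and the weight cancels one
  -- factor `q` or its conjugate. This leaves a holomorphic function times a Cauchy kernel,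
  -- evaluated at `w`, and the conjugate of a holomorphic function vanishing at 0 because `b ≥ 1`.
  have hpt : ∀ θ, circlePoint θ ^ a * conj (R (circlePoint θ)) * szegoWeight β θ =
      q w * ((circlePoint θ ^ a * (q (circlePoint θ))⁻¹) * (1 - w * (circlePoint θ)⁻¹)⁻¹) -
      c * conj (circlePoint θ ^ b *
        (q (circlePoint θ) * (1 - conj w * circlePoint θ))⁻¹) := fun θ => by
    have hx0 := circlePoint_ne_zero θ
    have hcx := conj_circlePoint θ
    have hnx := norm_circlePoint θ
    set x := circlePoint θ
    have hQ : q x ≠ 0 := szegoPoly_ne_zero hβ hnx.le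
    have hQ' : conj (q x) ≠ 0 := (map_ne_zero _).2 hQ
    have hD : 1 - w * x⁻¹ ≠ 0 := one_sub_ne_zero_of_norm hw (by rw [norm_inv, hnx, inv_one])
    have h1 : (1 - w * x⁻¹) * conj (R x) = conj (q x) * q w - (x⁻¹ ^ n * ∏ j, (x⁻¹ - conj (β j))) * c := by
      have := congrArg conj (hR x)
      simp only [szegoNum, map_mul, map_sub, map_one, map_pow, map_prod, Complex.conj_conj,
        hcx] at this
      rw [hc]
      linear_combination this
    have h2 : ∏ j, (x⁻¹ - conj (β j)) = x⁻¹ ^ Fintype.card κ * q x := by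
      rw [hq, szegoPoly, Fintype.card, ← Finset.prod_const, ← Finset.prod_mul_distrib]
      refine Finset.prod_congr rfl fun j _ => ?_
      field_simp
    have h3 : conj (R x) = (conj (q x) * q w - x⁻¹ ^ (n + Fintype.card κ) * q x * c) *
        (1 - w * x⁻¹)⁻¹ := by
      rw [eq_mul_inv_iff_mul_eq₀ hD, mul_comm, h1, h2, pow_add]
      ring
    have h4 : x ^ a * x⁻¹ ^ (n + Fintype.card κ) = x⁻¹ ^ b := by
      have h5 : n + Fintype.card κ = a + b := by omega
      rw [h5, pow_add, ← mul_assoc, ← mul_pow, mul_inv_cancel₀ hx0, one_pow, one_mul]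
    have h6 : szegoWeight β θ = (q x * conj (q x))⁻¹ := rfl
    rw [h3, h6]
    simp only [map_mul, map_inv₀, map_sub, map_pow, map_one, Complex.conj_conj, hcx]
    rw [← h4, mul_inv, mul_inv]
    have e1 : q x * (q x)⁻¹ = 1 := mul_inv_cancel₀ hQ
    have e2 : conj (q x) * (conj (q x))⁻¹ = 1 := mul_inv_cancel₀ hQ'
    linear_combination (x ^ a * q w * (1 - w * x⁻¹)⁻¹ * (q x)⁻¹) * e2 -
      (x ^ a * x⁻¹ ^ (n + Fintype.card κ) * c * (1 - w * x⁻¹)⁻¹ * (conj (q x))⁻¹) * e1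
  have hcont : ∀ {f : ℂ → ℂ}, DiffContOnCl ℂ f (Metric.ball 0 1) →
      Continuous fun θ => f (circlePoint θ) := fun hf => by
    have := hf.continuousOn
    rw [closure_ball _ one_ne_zero] at this
    exact this.comp_continuous continuous_circlePoint fun θ => by simp [norm_circlePoint]
  have hint : ∀ {f : UnitAddCircle → ℂ}, Continuous f → Integrable f AddCircle.haarAddCircle :=
    fun hf => hf.integrable_of_hasCompactSupport (HasCompactSupport.of_compactSpace _)
  have hD : Continuous fun θ => (1 - w * (circlePoint θ)⁻¹)⁻¹ :=
    (continuous_const.sub (continuous_const.mul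
      (continuous_circlePoint.inv₀ circlePoint_ne_zero))).inv₀ fun θ =>
      one_sub_ne_zero_of_norm hw (by simp [norm_circlePoint])
  simp only [hpt]
  rw [integral_sub, integral_const_mul, integral_const_mul, integral_circlePoint_cauchy hf hw,
    integral_conj, integral_circlePoint_of_diffContOnCl hg]
  · have : b ≠ 0 := by omega
    simp only [zero_pow this, zero_mul, map_zero, mul_zero, sub_zero]
    rw [mul_left_comm, mul_inv_cancel₀ (szegoPoly_ne_zero hβ hw.le), mul_one]
  · exact (hint ((hcont hf).mul hD)).const_mul _
  · exact (hint (Complex.continuous_conj.comp (hcont hg))).const_mul _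

/-- In `z` the numerator has degree at most `n + card κ` and vanishes at the reflected point `1 /
conj w`, where its two products coincide; dividing out this root leaves degree below `n + card κ`.
At `w = 0` there is no reflected point, but `n ≠ 0` kills the second product, and the first already
has small degree. -/
theorem exists_szego_coeff (β : κ → ℂ) {n : ℕ} (hn : n ≠ 0) (w : ℂ) :
    ∃ r : Fin (n + Fintype.card κ) → ℂ,
      ∀ z, (1 - z * conj w) * ∑ c, r c * z ^ (c : ℕ) = szegoNum β n z w := by
  open Polynomial in
  set P : ℂ[X] := (∏ j, (1 - C (conj (β j)) * X)) * C (conj (szegoPoly β w)) -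
    (X ^ n * ∏ j, (X - C (β j))) * C (conj (w ^ n * ∏ j, (w - β j))) with hP
  have hPe : ∀ z, P.eval z = szegoNum β n z w := fun z => by
    simp [hP, szegoNum, szegoPoly, Polynomial.eval_prod]
  have hd1 : (∏ j, (1 - Polynomial.C (conj (β j)) * Polynomial.X)).natDegree ≤ Fintype.card κ := by
    refine (Polynomial.natDegree_prod_le _ _).trans ?_
    refine (Finset.sum_le_card_nsmul _ _ 1 fun j _ => ?_).trans (by simp)
    refine (Polynomial.natDegree_sub_le _ _).trans ?_
    simpa using (Polynomial.natDegree_C_mul_le (conj (β j)) Polynomial.X)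
  have hd2 : (Polynomial.X ^ n * ∏ j, (Polynomial.X - Polynomial.C (β j))).natDegree ≤
      n + Fintype.card κ := by
    refine Polynomial.natDegree_mul_le.trans (add_le_add (Polynomial.natDegree_X_pow_le n) ?_)
    refine (Polynomial.natDegree_prod_le _ _).trans ?_
    simp
  have hlift : ∀ Q : Polynomial ℂ, Q.natDegree < n + Fintype.card κ →
      ∃ r : Fin (n + Fintype.card κ) → ℂ, ∀ z, ∑ c, r c * z ^ (c : ℕ) = Q.eval z := fun Q hQ =>
    ⟨fun c => Q.coeff c, fun z => by
      rw [Polynomial.eval_eq_sum_range' hQ, Finset.sum_range]⟩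
  by_cases hw : w = 0
  · have hPd : P.natDegree < n + Fintype.card κ := by
      have : P = ∏ j, (1 - Polynomial.C (conj (β j)) * Polynomial.X) := by
        simp [hP, hw, hn, szegoPoly]
      rw [this]
      omega
    obtain ⟨r, hr⟩ := hlift P hPd
    exact ⟨r, fun z => by rw [hr, hPe, hw]; simp⟩
  · have hcw : conj w ≠ 0 := (_root_.map_ne_zero _).2 hw
    have hroot : P.IsRoot (conj w)⁻¹ := by
      rw [Polynomial.IsRoot, hPe, szegoNum, szegoPoly]
      simp only [szegoPoly, map_prod, map_mul, map_sub, map_one, map_pow, Complex.conj_conj]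
      rw [show ∀ a b c d : ℂ, a * b - c * d = b * a - d * c from fun _ _ _ _ => by ring,
        show ∀ a b c d : ℂ, (a * b) * (c * d) = (a * c) * (b * d) from fun _ _ _ _ => by ring,
        ← mul_pow, mul_inv_cancel₀ hcw, one_pow, one_mul, ← Finset.prod_mul_distrib,
        ← Finset.prod_mul_distrib, sub_eq_zero]
      refine Finset.prod_congr rfl fun j _ => ?_
      field_simp
    obtain ⟨Q, hQ⟩ := Polynomial.dvd_iff_isRoot.2 hroot
    -- The scalar comes from `1 - z conj w = -conj w (z - (conj w)⁻¹)`.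
    have hQd : (Polynomial.C (-(conj w)⁻¹) * Q).natDegree < n + Fintype.card κ := by
      by_cases hQ0 : Q = 0
      · simp only [hQ0, mul_zero, Polynomial.natDegree_zero]
        omega
      have h1 : P.natDegree ≤ n + Fintype.card κ := by
        refine (Polynomial.natDegree_sub_le _ _).trans (max_le ?_ ?_)
        · exact (Polynomial.natDegree_mul_C_le _ _).trans (hd1.trans (by omega))
        · exact (Polynomial.natDegree_mul_C_le _ _).trans hd2
      rw [hQ, Polynomial.natDegree_mul (Polynomial.X_sub_C_ne_zero _) hQ0,
        Polynomial.natDegree_X_sub_C] at h1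
      have := Polynomial.natDegree_C_mul_le (-(conj w)⁻¹) Q
      omega
    obtain ⟨r, hr⟩ := hlift _ hQd
    refine ⟨r, fun z => ?_⟩
    rw [hr, ← hPe, hQ]
    simp only [Polynomial.eval_mul, Polynomial.eval_C, Polynomial.eval_sub, Polynomial.eval_X]
    have h1 : conj w * (conj w)⁻¹ = 1 := mul_inv_cancel₀ hcw
    linear_combination (z * Polynomial.eval z Q) * h1

/-- The Gram matrix of the monomials for the Bernstein–Szegő weight. -/
noncomputable def szegoGram (β : κ → ℂ) (M : ℕ) : Matrix (Fin M) (Fin M) ℂ :=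
  Matrix.of fun a b => ∫ θ, circlePoint θ ^ (a : ℕ) * conj (circlePoint θ ^ (b : ℕ)) *
    szegoWeight β θ ∂AddCircle.haarAddCircle

theorem integrable_szego {β : κ → ℂ} (hβ : ∀ j, ‖β j‖ < 1) (a b : ℕ) :
    Integrable (fun θ => circlePoint θ ^ a * conj (circlePoint θ ^ b) * szegoWeight β θ)
      AddCircle.haarAddCircle := by
  refine Continuous.integrable_of_hasCompactSupport ?_ (HasCompactSupport.of_compactSpace _)
  exact ((continuous_circlePoint.pow a).mul (Complex.continuous_conj.comp
    (continuous_circlePoint.pow b))).mul (continuous_szegoWeight hβ)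

theorem szegoGram_mulVec {β : κ → ℂ} (hβ : ∀ j, ‖β j‖ < 1) {n : ℕ} {w : ℂ} (hw : ‖w‖ < 1)
    {r : Fin (n + Fintype.card κ) → ℂ}
    (hr : ∀ z, (1 - z * conj w) * ∑ c, r c * z ^ (c : ℕ) = szegoNum β n z w) :
    szegoGram β (n + Fintype.card κ) *ᵥ (fun c => conj (r c)) =
      fun a : Fin (n + Fintype.card κ) => w ^ (a : ℕ) := by
  ext a
  rw [← integral_pow_mul_conj_szego hβ a.2 hw hr]
  simp only [Matrix.mulVec, dotProduct, szegoGram, Matrix.of_apply, ← integral_mul_const]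
  rw [← integral_finsetSum _ fun c _ => (integrable_szego hβ _ _).mul_const _]
  refine integral_congr_ae (Filter.Eventually.of_forall fun θ => ?_)
  simp only [map_sum, map_mul, Finset.mul_sum, Finset.sum_mul]
  exact Finset.sum_congr rfl fun c _ => by ring

/-- Applied at `M` distinct points of the disc, the reproducing property exhibits an invertible
Vandermonde matrix as the Gram matrix times another square matrix. The points `1 / (i + 2)` are one
arbitrary choice. -/
theorem isUnit_det_szegoGram {β : κ → ℂ} (hβ : ∀ j, ‖β j‖ < 1) {n : ℕ} (hn : n ≠ 0) :
    IsUnit (szegoGram β (n + Fintype.card κ)).det := by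
  set M := n + Fintype.card κ with hM
  let w : Fin M → ℂ := fun i => ((((i : ℕ) : ℝ) + 2)⁻¹ : ℝ)
  have hw : ∀ i, ‖w i‖ < 1 := fun i => by
    have h1 : (1 : ℝ) < (i : ℕ) + 2 := by have := Nat.cast_nonneg (α := ℝ) (i : ℕ); linarith
    simp only [w, Complex.norm_real, Real.norm_eq_abs, abs_inv]
    rw [abs_of_pos (by linarith)]
    exact inv_lt_one_of_one_lt₀ h1
  have hinj : Function.Injective w := fun i j hij => by
    have h1 := Complex.ofReal_injective hij
    have h2 := inv_injective h1
    have h3 : ((i : ℕ) : ℝ) = (j : ℕ) := by linarith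
    exact Fin.ext (by exact_mod_cast h3)
  choose r hr using fun i => exists_szego_coeff β hn (w i)
  have h1 : szegoGram β M * (Matrix.of fun c i => conj (r i c)) = (Matrix.vandermonde w)ᵀ := by
    ext a i
    exact congrFun (szegoGram_mulVec hβ (hw i) (hr i)) a
  have h2 := congrArg Matrix.det h1
  rw [Matrix.det_mul, Matrix.det_transpose] at h2
  exact isUnit_iff_ne_zero.2 fun h => Matrix.det_vandermonde_ne_zero_iff.2 hinj
    (by rw [← h2, h, zero_mul])

/-- The reproducing kernel of polynomials of degree less than `M` for the Bernstein–Szegő weight. -/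
noncomputable def szegoKernel (β : κ → ℂ) (M : ℕ) (p r : ℂ) : ℂ :=
  ∑ a : Fin M, ∑ b : Fin M, p ^ (a : ℕ) * (szegoGram β M)⁻¹ b a * conj (r ^ (b : ℕ))

theorem continuous_szegoKernel (β : κ → ℂ) (M : ℕ) :
    Continuous fun q : ℂ × ℂ => szegoKernel β M q.1 q.2 :=
  continuous_finsetSum _ fun _ _ => continuous_finsetSum _ fun _ _ =>
    ((continuous_fst.pow _).mul continuous_const).mul
      (Complex.continuous_conj.comp (continuous_snd.pow _))

/-- Christoffel–Darboux formula for this weight. The definition by the inverse Gram matrix makes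
sense on the circle, where the quotient degenerates on the diagonal; the closed form is needed only
inside the disc. -/
theorem szegoKernel_eq {β : κ → ℂ} (hβ : ∀ j, ‖β j‖ < 1) {n : ℕ} (hn : n ≠ 0) {w z : ℂ}
    (hw : ‖w‖ < 1) (hz : ‖z‖ < 1) :
    szegoKernel β (n + Fintype.card κ) w z = szegoNum β n w z / (1 - w * conj z) := by
  obtain ⟨r, hr⟩ := exists_szego_coeff β hn w
  have h1 : (szegoGram β (n + Fintype.card κ))⁻¹ *ᵥ
      (fun a : Fin (n + Fintype.card κ) => w ^ (a : ℕ)) =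
      fun c => conj (r c) := by
    rw [← szegoGram_mulVec hβ hw hr, Matrix.mulVec_mulVec,
      Matrix.nonsing_inv_mul _ (isUnit_det_szegoGram hβ hn), Matrix.one_mulVec]
  have h2 : szegoKernel β (n + Fintype.card κ) w z = ∑ c, conj (r c) * conj (z ^ (c : ℕ)) := by
    rw [szegoKernel, Finset.sum_comm]
    refine Finset.sum_congr rfl fun b _ => ?_
    rw [← congrFun h1 b]
    simp only [Matrix.mulVec, dotProduct, Finset.sum_mul]
    exact Finset.sum_congr rfl fun a _ => by ring
  have h3 := congrArg conj (hr z)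
  simp only [map_mul, map_sub, map_one, map_sum, Complex.conj_conj, szegoNum] at h3
  have h4 : 1 - w * conj z ≠ 0 := one_sub_ne_zero_of_norm hw (by rw [Complex.norm_conj]; exact hz.le)
  rw [eq_div_iff h4, h2, szegoNum]
  simp only [map_mul]
  linear_combination h3

/-- In coordinates this is `G⁻¹ G G⁻¹ = G⁻¹`. -/
theorem integral_szegoKernel_mul {β : κ → ℂ} (hβ : ∀ j, ‖β j‖ < 1) {n : ℕ} (hn : n ≠ 0) (p r : ℂ) :
    ∫ θ, szegoKernel β (n + Fintype.card κ) p (circlePoint θ) *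
      szegoKernel β (n + Fintype.card κ) (circlePoint θ) r * szegoWeight β θ
      ∂AddCircle.haarAddCircle = szegoKernel β (n + Fintype.card κ) p r := by
  set M := n + Fintype.card κ
  set G := szegoGram β M with hG
  have h1 : ∀ θ, szegoKernel β M p (circlePoint θ) * szegoKernel β M (circlePoint θ) r *
      szegoWeight β θ = ∑ a : Fin M, ∑ d : Fin M, ∑ b : Fin M, ∑ c : Fin M,
        (p ^ (a : ℕ) * G⁻¹ b a * G⁻¹ d c * conj (r ^ (d : ℕ))) *
        (circlePoint θ ^ (c : ℕ) * conj (circlePoint θ ^ (b : ℕ)) * szegoWeight β θ) := fun θ => by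
    rw [szegoKernel, szegoKernel, Finset.sum_comm (f := fun c d : Fin M =>
      circlePoint θ ^ (c : ℕ) * G⁻¹ d c * conj (r ^ (d : ℕ)))]
    rw [Finset.sum_mul_sum, Finset.sum_mul]
    refine Finset.sum_congr rfl fun a _ => ?_
    rw [Finset.sum_mul]
    refine Finset.sum_congr rfl fun d _ => ?_
    rw [Finset.sum_mul_sum, Finset.sum_mul]
    refine Finset.sum_congr rfl fun b _ => ?_
    rw [Finset.sum_mul]
    exact Finset.sum_congr rfl fun c _ => by ring
  simp only [h1]
  have hint : ∀ a d b c : Fin M, Integrable (fun θ =>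
      (p ^ (a : ℕ) * G⁻¹ b a * G⁻¹ d c * conj (r ^ (d : ℕ))) *
        (circlePoint θ ^ (c : ℕ) * conj (circlePoint θ ^ (b : ℕ)) * szegoWeight β θ))
        AddCircle.haarAddCircle := fun a d b c => (integrable_szego hβ _ _).const_mul _
  rw [integral_finsetSum _ fun a _ => integrable_finsetSum _ fun d _ => integrable_finsetSum _
    fun b _ => integrable_finsetSum _ fun c _ => hint a d b c, szegoKernel]
  refine Finset.sum_congr rfl fun a _ => ?_
  rw [integral_finsetSum _ fun d _ => integrable_finsetSum _
    fun b _ => integrable_finsetSum _ fun c _ => hint a d b c]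
  refine Finset.sum_congr rfl fun d _ => ?_
  rw [integral_finsetSum _ fun b _ => integrable_finsetSum _ fun c _ => hint a d b c]
  have h2 : ∀ b, ∫ θ, ∑ c : Fin M, (p ^ (a : ℕ) * G⁻¹ b a * G⁻¹ d c * conj (r ^ (d : ℕ))) *
        (circlePoint θ ^ (c : ℕ) * conj (circlePoint θ ^ (b : ℕ)) * szegoWeight β θ)
        ∂AddCircle.haarAddCircle = p ^ (a : ℕ) * ((G⁻¹ * G) d b * G⁻¹ b a) * conj (r ^ (d : ℕ)) := by
    intro b
    rw [integral_finsetSum _ fun c _ => hint a d b c, Matrix.mul_apply]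
    simp only [integral_const_mul, Finset.mul_sum, Finset.sum_mul]
    refine Finset.sum_congr rfl fun c _ => ?_
    have : G c b = ∫ θ, circlePoint θ ^ (c : ℕ) * conj (circlePoint θ ^ (b : ℕ)) *
      szegoWeight β θ ∂AddCircle.haarAddCircle := rfl
    rw [this]
    ring
  simp only [h2, ← Finset.sum_mul, ← Finset.mul_sum]
  rw [← Matrix.mul_apply, Matrix.nonsing_inv_mul _ (isUnit_det_szegoGram hβ hn), Matrix.one_mul]

/-- The integral is the trace of `G⁻¹ G = 1`. -/
theorem integral_szegoKernel_self {β : κ → ℂ} (hβ : ∀ j, ‖β j‖ < 1) {n : ℕ} (hn : n ≠ 0) :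
    ∫ θ, szegoKernel β (n + Fintype.card κ) (circlePoint θ) (circlePoint θ) * szegoWeight β θ
      ∂AddCircle.haarAddCircle = ((n + Fintype.card κ : ℕ) : ℂ) := by
  set M := n + Fintype.card κ
  set G := szegoGram β M with hG
  have h1 : ∀ θ, szegoKernel β M (circlePoint θ) (circlePoint θ) * szegoWeight β θ =
      ∑ b : Fin M, ∑ a : Fin M, G⁻¹ b a *
        (circlePoint θ ^ (a : ℕ) * conj (circlePoint θ ^ (b : ℕ)) * szegoWeight β θ) := fun θ => by
    simp only [szegoKernel, Finset.sum_mul]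
    rw [Finset.sum_comm]
    exact Finset.sum_congr rfl fun b _ => Finset.sum_congr rfl fun a _ => by ring
  simp only [h1]
  have hint : ∀ b a : Fin M, Integrable (fun θ => G⁻¹ b a *
      (circlePoint θ ^ (a : ℕ) * conj (circlePoint θ ^ (b : ℕ)) * szegoWeight β θ))
      AddCircle.haarAddCircle := fun b a => (integrable_szego hβ _ _).const_mul _
  rw [integral_finsetSum _ fun b _ => integrable_finsetSum _ fun a _ => hint b a]
  have h2 : ∀ b, ∫ θ, ∑ a : Fin M, G⁻¹ b a *
      (circlePoint θ ^ (a : ℕ) * conj (circlePoint θ ^ (b : ℕ)) * szegoWeight β θ)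
      ∂AddCircle.haarAddCircle = (G⁻¹ * G) b b := fun b => by
    rw [integral_finsetSum _ fun a _ => hint b a, Matrix.mul_apply]
    simp only [integral_const_mul]
    rfl
  have h3 : G⁻¹ * G = 1 := Matrix.nonsing_inv_mul _ (isUnit_det_szegoGram hβ hn)
  rw [Finset.sum_congr rfl fun b _ => h2 b, h3]
  simp

end Szego

/-! ### The Cauchy matrix of points of the disc -/

section CauchyMatrix

open Matrix

/-- Lagrange interpolation of `∏_{l ≠ i} (1 - X z_l)` at the nodes `u_j`, evaluated at `1 / y` and
multiplied by `y ^ (card ι - 1)`; the value `y = 0` follows by continuity. -/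
theorem sum_lagrange_homogeneous {ι : Type*} [Fintype ι] [DecidableEq ι] {u : ι → ℂ}
    (hu : Function.Injective u) (z : ι → ℂ) (i : ι) (y : ℂ) :
    ∑ j, (∏ l ∈ Finset.univ.erase i, (1 - u j * z l)) *
      ∏ l ∈ Finset.univ.erase j, ((1 - y * u l) / (u j - u l)) =
      ∏ l ∈ Finset.univ.erase i, (y - z l) := by
  have hne : ∀ y : ℂ, y ≠ 0 → ∑ j, (∏ l ∈ Finset.univ.erase i, (1 - u j * z l)) *
      ∏ l ∈ Finset.univ.erase j, ((1 - y * u l) / (u j - u l)) =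
      ∏ l ∈ Finset.univ.erase i, (y - z l) := by
    intro y hy
    set f : Polynomial ℂ := ∏ l ∈ Finset.univ.erase i, (1 - Polynomial.X * Polynomial.C (z l)) with hf
    have hcard : (Finset.univ.erase i).card < (Finset.univ : Finset ι).card :=
      Finset.card_erase_lt_of_mem (Finset.mem_univ i)
    have hdeg : f.degree < (Finset.univ : Finset ι).card := by
      refine lt_of_le_of_lt ((Polynomial.degree_prod_le _ _).trans
        (Finset.sum_le_card_nsmul _ _ 1 fun l _ => ?_)) ?_
      · refine (Polynomial.degree_sub_le _ _).trans (max_le ?_ ?_)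
        · exact Polynomial.degree_one_le.trans zero_le_one
        · refine (Polynomial.degree_mul_le _ _).trans ?_
          exact (add_le_add Polynomial.degree_X_le Polynomial.degree_C_le).trans (by simp)
      · rw [nsmul_eq_mul, mul_one]
        exact_mod_cast hcard
    have h1 := congrArg (Polynomial.eval y⁻¹)
      (Lagrange.eq_interpolate (s := Finset.univ) (v := u) (f := f) hu.injOn hdeg)
    simp only [Lagrange.interpolate_apply, Polynomial.eval_finsetSum, Polynomial.eval_mul,
      Polynomial.eval_C, Lagrange.basis, Polynomial.eval_prod, Lagrange.basisDivisor, hf,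
      Polynomial.eval_sub, Polynomial.eval_one, Polynomial.eval_X] at h1
    have h2 : ∀ j : ι, y ^ ((Finset.univ : Finset ι).card - 1) *
        ∏ l ∈ Finset.univ.erase j, ((u j - u l)⁻¹ * (y⁻¹ - u l)) =
        ∏ l ∈ Finset.univ.erase j, ((1 - y * u l) / (u j - u l)) := fun j => by
      rw [← Finset.card_erase_of_mem (Finset.mem_univ j), ← Finset.prod_const,
        ← Finset.prod_mul_distrib]
      refine Finset.prod_congr rfl fun l _ => ?_
      rw [div_eq_mul_inv]
      linear_combination (u j - u l)⁻¹ * mul_inv_cancel₀ hy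
    have h3 : y ^ ((Finset.univ : Finset ι).card - 1) *
        ∏ l ∈ Finset.univ.erase i, (1 - y⁻¹ * z l) = ∏ l ∈ Finset.univ.erase i, (y - z l) := by
      rw [← Finset.card_erase_of_mem (Finset.mem_univ i), ← Finset.prod_const,
        ← Finset.prod_mul_distrib]
      refine Finset.prod_congr rfl fun l _ => ?_
      linear_combination -z l * mul_inv_cancel₀ hy
    rw [← h3, h1, Finset.mul_sum]
    refine Finset.sum_congr rfl fun j _ => ?_
    rw [← h2]
    ring
  refine congrFun (Continuous.ext_on (dense_compl_singleton (0 : ℂ)) ?_ ?_ hne) y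
  · exact continuous_finsetSum _ fun j _ => continuous_const.mul
      (continuous_finsetProd _ fun l _ => by fun_prop)
  · exact continuous_finsetProd _ fun l _ => by fun_prop

variable {ι : Type*} [Fintype ι] [DecidableEq ι]

/-- The matrix `1 / (1 - ζ_i conj ζ_j)`. -/
noncomputable def cauchyMatrix (ζ : ι → ℂ) : Matrix ι ι ℂ :=
  Matrix.of fun i j => (1 - ζ i * conj (ζ j))⁻¹

/-- The residues of the inverse of `cauchyMatrix`. -/
noncomputable def cauchyWeight (ζ : ι → ℂ) (i : ι) : ℂ :=
  (∏ m, (1 - ζ i * conj (ζ m))) / ∏ m ∈ Finset.univ.erase i, (ζ i - ζ m)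

theorem one_sub_mul_conj_ne_zero {a b : ℂ} (ha : ‖a‖ < 1) (hb : ‖b‖ < 1) : 1 - a * conj b ≠ 0 :=
  one_sub_ne_zero_of_norm ha (by rw [Complex.norm_conj]; exact hb.le)

/-- The explicit inverse of the Cauchy matrix. -/
theorem cauchyMatrix_mul_eq_one {ζ : ι → ℂ} (hζ : ∀ i, ‖ζ i‖ < 1) (hinj : Function.Injective ζ) :
    cauchyMatrix ζ * (Matrix.diagonal (fun i => conj (cauchyWeight ζ i)) * (cauchyMatrix ζ).map conj *
      Matrix.diagonal (cauchyWeight ζ)) = 1 := by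
  ext i m
  have hu : Function.Injective fun j => conj (ζ j) := (starRingEnd ℂ).injective.comp hinj
  -- With nodes `conj ζ_j` and `y = ζ_m`, the right-hand side `∏_{l ≠ i} (ζ_m - ζ_l)` vanishes
  -- unless `m = i`, so it produces the identity matrix.
  have h := sum_lagrange_homogeneous hu ζ i (ζ m)
  have hterm : ∀ j, cauchyMatrix ζ i j * (conj (cauchyWeight ζ j) * conj (cauchyMatrix ζ j m) *
      cauchyWeight ζ m) = cauchyWeight ζ m / (∏ l, (1 - ζ m * conj (ζ l))) *
      ((∏ l ∈ Finset.univ.erase i, (1 - conj (ζ j) * ζ l)) *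
      ∏ l ∈ Finset.univ.erase j, ((1 - ζ m * conj (ζ l)) / (conj (ζ j) - conj (ζ l)))) := fun j => by
    have h1 : conj (cauchyWeight ζ j) = ((1 - conj (ζ j) * ζ i) *
        ∏ l ∈ Finset.univ.erase i, (1 - conj (ζ j) * ζ l)) /
        ∏ l ∈ Finset.univ.erase j, (conj (ζ j) - conj (ζ l)) := by
      rw [Finset.mul_prod_erase Finset.univ (fun l => 1 - conj (ζ j) * ζ l) (Finset.mem_univ i)]
      simp [cauchyWeight]
    have h2 := Finset.mul_prod_erase Finset.univ (fun l => 1 - ζ m * conj (ζ l)) (Finset.mem_univ j)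
    have h3 : ∏ l ∈ Finset.univ.erase j, (1 - ζ m * conj (ζ l)) ≠ 0 :=
      Finset.prod_ne_zero_iff.2 fun l _ => one_sub_mul_conj_ne_zero (hζ m) (hζ l)
    have h4 := one_sub_mul_conj_ne_zero (hζ i) (hζ j)
    have h5 := one_sub_mul_conj_ne_zero (hζ m) (hζ j)
    have h6 : ∏ l ∈ Finset.univ.erase j, (conj (ζ j) - conj (ζ l)) ≠ 0 :=
      Finset.prod_ne_zero_iff.2 fun l hl => sub_ne_zero.2 fun h =>
        (Finset.ne_of_mem_erase hl) (hu h).symm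
    rw [h1, Finset.prod_div_distrib, ← h2]
    simp only [cauchyMatrix, Matrix.of_apply, map_inv₀, map_sub, map_one, map_mul, Complex.conj_conj]
    rw [mul_comm (conj (ζ j)) (ζ i), mul_comm (conj (ζ j)) (ζ m)]
    field_simp
  rw [Matrix.mul_apply]
  simp only [Matrix.mul_diagonal, Matrix.diagonal_mul, Matrix.map_apply, hterm, ← Finset.mul_sum, h]
  have hP : ∏ l, (1 - ζ m * conj (ζ l)) ≠ 0 :=
    Finset.prod_ne_zero_iff.2 fun l _ => one_sub_mul_conj_ne_zero (hζ m) (hζ l)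
  by_cases him : i = m
  · subst him
    have h6 : ∏ l ∈ Finset.univ.erase i, (ζ i - ζ l) ≠ 0 :=
      Finset.prod_ne_zero_iff.2 fun l hl => sub_ne_zero.2 fun h =>
        (Finset.ne_of_mem_erase hl) (hinj h).symm
    rw [Matrix.one_apply_eq, cauchyWeight]
    field_simp
  · rw [Matrix.one_apply_ne him, Finset.prod_eq_zero (s := Finset.univ.erase i)
      (Finset.mem_erase.2 ⟨Ne.symm him, Finset.mem_univ m⟩) (sub_self _), mul_zero]

open scoped ComplexOrder in
-- By the geometric series, the Cauchy matrix is the limit of the positive semidefinite matrices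
-- `V_n V_nᴴ` of truncated power vectors.
theorem det_cauchyMatrix_nonneg {ζ : ι → ℂ} (hζ : ∀ i, ‖ζ i‖ < 1) : 0 ≤ (cauchyMatrix ζ).det := by
  let V : (n : ℕ) → Matrix ι (Fin n) ℂ := fun n => Matrix.of fun i a => ζ i ^ (a : ℕ)
  have h1 : ∀ n, 0 ≤ (V n * (V n)ᴴ).det := fun n =>
    (Matrix.posSemidef_self_mul_conjTranspose (V n)).det_nonneg
  refine ge_of_tendsto' (f := fun n => (V n * (V n)ᴴ).det) (x := Filter.atTop) ?_ h1
  refine (continuous_id.matrix_det.tendsto _).comp ?_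
  refine tendsto_pi_nhds.2 fun i => tendsto_pi_nhds.2 fun j => ?_
  have h2 : ‖ζ i * conj (ζ j)‖ < 1 := by
    rw [norm_mul, Complex.norm_conj]
    exact mul_lt_one_of_nonneg_of_lt_one_left (norm_nonneg _) (hζ i) (hζ j).le
  refine (hasSum_geometric_of_norm_lt_one h2).tendsto_sum_nat.congr fun n => ?_
  rw [Matrix.mul_apply, Finset.sum_range]
  exact Finset.sum_congr rfl fun a _ => by simp [V, mul_pow]

theorem norm_det_vandermonde {k : ℕ} (v : Fin k → ℂ) :
    ‖(Matrix.vandermonde v).det‖ = ∏ i, ∏ j, if i < j then ‖v i - v j‖ else 1 := by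
  rw [Matrix.det_vandermonde, norm_prod]
  refine Finset.prod_congr rfl fun i _ => ?_
  rw [norm_prod, ← Finset.prod_filter]
  refine Finset.prod_congr (by ext; simp) fun j _ => norm_sub_rev _ _

theorem norm_det_vandermonde_sq {k : ℕ} (v : Fin k → ℂ) :
    ‖(Matrix.vandermonde v).det‖ ^ 2 = ∏ i, ∏ j ∈ Finset.univ.erase i, ‖v i - v j‖ := by
  have h1 : ‖(Matrix.vandermonde v).det‖ = ∏ i, ∏ j, if j < i then ‖v i - v j‖ else 1 := by
    rw [norm_det_vandermonde, Finset.prod_comm]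
    simp only [norm_sub_rev]
  rw [sq]
  nth_rw 1 [norm_det_vandermonde]
  rw [h1, ← Finset.prod_mul_distrib]
  refine Finset.prod_congr rfl fun i _ => ?_
  rw [← Finset.prod_mul_distrib, ← Finset.mul_prod_erase Finset.univ _ (Finset.mem_univ i)]
  simp only [lt_self_iff_false, if_false, one_mul]
  refine Finset.prod_congr rfl fun j hj => ?_
  rcases lt_or_gt_of_ne (Finset.ne_of_mem_erase hj) with h | h
  · simp [h, h.le.not_gt]
  · simp [h, (show i < j from h).le.not_gt]

/-- The Cauchy determinant. -/
theorem det_cauchyMatrix {k : ℕ} {ζ : Fin k → ℂ} (hζ : ∀ i, ‖ζ i‖ < 1)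
    (hinj : Function.Injective ζ) :
    (cauchyMatrix ζ).det = ((‖(Matrix.vandermonde ζ).det‖ ^ 2 /
      ∏ i, ∏ j, ‖1 - ζ i * conj (ζ j)‖ : ℝ) : ℂ) := by
  have h1 : (cauchyMatrix ζ).det = (‖(cauchyMatrix ζ).det‖ : ℂ) :=
    Complex.eq_coe_norm_of_nonneg (det_cauchyMatrix_nonneg hζ)
  -- Moduli in the inverse formula determine `|det C|`, since the weights multiply to known
  -- products; nonnegativity of the determinant fixes its phase.
  have h2 := congrArg (fun A => ‖A.det‖) (cauchyMatrix_mul_eq_one hζ hinj)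
  have h3 : ((cauchyMatrix ζ).map conj).det = conj (cauchyMatrix ζ).det :=
    ((starRingEnd ℂ).map_det (cauchyMatrix ζ)).symm
  simp only [Matrix.det_mul, Matrix.det_diagonal, h3, norm_mul, norm_prod, Complex.norm_conj,
    Matrix.det_one, norm_one] at h2
  have h4 : ∏ i, ‖cauchyWeight ζ i‖ = (∏ i, ∏ j, ‖1 - ζ i * conj (ζ j)‖) /
      ‖(Matrix.vandermonde ζ).det‖ ^ 2 := by
    simp only [norm_det_vandermonde_sq, cauchyWeight, norm_div, norm_prod, Finset.prod_div_distrib]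
  have h5 : ‖(cauchyMatrix ζ).det‖ * ∏ i, ‖cauchyWeight ζ i‖ = 1 := by
    rw [← sq_eq_sq₀ (by positivity) zero_le_one]
    linear_combination h2
  have hP : ∏ i, ∏ j, ‖1 - ζ i * conj (ζ j)‖ ≠ 0 := Finset.prod_ne_zero_iff.2 fun i _ =>
    Finset.prod_ne_zero_iff.2 fun j _ => norm_ne_zero_iff.2 (one_sub_mul_conj_ne_zero (hζ i) (hζ j))
  have hV : ‖(Matrix.vandermonde ζ).det‖ ≠ 0 :=
    norm_ne_zero_iff.2 (Matrix.det_vandermonde_ne_zero_iff.2 hinj)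
  rw [h1]
  congr 1
  rw [h4] at h5
  field_simp at h5 ⊢
  exact h5

end CauchyMatrix

/-! ### Averages of ratios on the torus -/

section TorusRatio

open Matrix

theorem norm_circlePoint_sub (a : ℂ) (θ : UnitAddCircle) :
    ‖circlePoint θ - a‖ = ‖1 - conj a * circlePoint θ‖ := by
  rw [← Complex.norm_conj (1 - _), map_sub, map_mul, map_one, Complex.conj_conj, conj_circlePoint]
  have h : 1 - a * (circlePoint θ)⁻¹ = (circlePoint θ - a) * (circlePoint θ)⁻¹ := by
    rw [sub_mul, mul_inv_cancel₀ (circlePoint_ne_zero _)]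
  rw [h, norm_mul, norm_inv, norm_circlePoint, inv_one, mul_one]

theorem weylDensityReal_eq {N : ℕ} (x : Fin N → UnitAddCircle) :
    weylDensityReal x = ‖(Matrix.vandermonde (circlePoint ∘ x)).det‖ ^ 2 := by
  rw [norm_det_vandermonde, weylDensityReal, ltPairs, Finset.prod_filter, ← Finset.prod_pow,
    ← Finset.univ_product_univ, Finset.prod_product]
  refine Finset.prod_congr rfl fun i _ => ?_
  rw [← Finset.prod_pow]
  refine Finset.prod_congr rfl fun j _ => ?_
  split_ifs <;> simp

theorem norm_det_vandermonde_append {k N : ℕ} (ζ : Fin k → ℂ) (c : Fin N → ℂ) :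
    ‖(Matrix.vandermonde (Fin.append ζ c)).det‖ = ‖(Matrix.vandermonde ζ).det‖ *
      (∏ r, ∏ i, ‖c r - ζ i‖) * ‖(Matrix.vandermonde c).det‖ := by
  simp only [norm_det_vandermonde, Fin.prod_univ_add, Fin.append_left, Fin.append_right]
  have h1 : ∀ (i : Fin k) (r : Fin N), Fin.castAdd N i < Fin.natAdd k r := fun i r => by
    rw [Fin.lt_def]
    simp only [Fin.val_castAdd, Fin.val_natAdd]
    omega
  have h2 : ∀ (i : Fin k) (r : Fin N), ¬ Fin.natAdd k r < Fin.castAdd N i := fun i r =>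
    (h1 i r).le.not_gt
  have h3 : ∀ i j : Fin k, Fin.castAdd N i < Fin.castAdd N j ↔ i < j := fun i j => Iff.rfl
  have h4 : ∀ i j : Fin N, Fin.natAdd k i < Fin.natAdd k j ↔ i < j := fun i j => by
    rw [Fin.lt_def, Fin.lt_def]
    simp
  simp only [h1, h2, h3, h4, if_true, if_false, Finset.prod_const_one, one_mul,
    Finset.prod_mul_distrib]
  rw [Finset.prod_comm (f := fun (i : Fin k) (r : Fin N) => ‖ζ i - c r‖)]
  simp only [norm_sub_rev]

variable {κ : Type*} [Fintype κ]

theorem szegoWeight_eq (β : κ → ℂ) (θ : UnitAddCircle) :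
    szegoWeight β θ = ((∏ j, ‖1 - conj (β j) * circlePoint θ‖ ^ 2 : ℝ) : ℂ)⁻¹ := by
  rw [szegoWeight, Complex.mul_conj, Complex.normSq_eq_norm_sq, szegoPoly, norm_prod,
    Finset.prod_pow]

/-- The kernel matrix is `V G⁻ᵀ Vᴴ` with `V` the Vandermonde matrix of all points, which is square
because the polynomial space has dimension `k + N`. -/
theorem det_szegoKernel_append (β : κ → ℂ) {k N : ℕ} (ζ : Fin k → ℂ) (c : Fin N → ℂ) :
    (Matrix.of fun s t : Fin k ⊕ Fin N => szegoKernel β (k + N) (Sum.elim ζ c s)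
      (Sum.elim ζ c t)).det = (szegoGram β (k + N)).det⁻¹ *
      ((‖(Matrix.vandermonde (Fin.append ζ c)).det‖ ^ 2 : ℝ) : ℂ) := by
  set V := Matrix.vandermonde (Fin.append ζ c) with hV
  have h1 : (Matrix.of fun s t : Fin k ⊕ Fin N => szegoKernel β (k + N) (Sum.elim ζ c s)
      (Sum.elim ζ c t)) = (V * ((szegoGram β (k + N))⁻¹)ᵀ * Vᴴ).submatrix finSumFinEquiv
        finSumFinEquiv := by
    have h2 : ∀ s, Sum.elim ζ c s = Fin.append ζ c (finSumFinEquiv s) := by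
      rintro (s | s) <;> simp
    ext s t
    rw [Matrix.of_apply, h2, h2, Matrix.submatrix_apply, Matrix.mul_apply, szegoKernel,
      Finset.sum_comm]
    refine Finset.sum_congr rfl fun b _ => ?_
    rw [Matrix.mul_apply, Finset.sum_mul]
    refine Finset.sum_congr rfl fun a _ => ?_
    simp [hV, Matrix.vandermonde_apply]
  rw [h1, Matrix.det_submatrix_equiv_self, Matrix.det_mul, Matrix.det_mul, Matrix.det_transpose,
    Matrix.det_conjTranspose, Matrix.det_nonsing_inv, Ring.inverse_eq_inv',
    ← Complex.normSq_eq_norm_sq, ← Complex.mul_conj]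
  simp only [RCLike.star_def]
  ring

theorem prod_range_natCast_sub (N : ℕ) :
    ∏ j ∈ Finset.range N, ((N : ℂ) - (j : ℂ)) = (N.factorial : ℂ) := by
  rw [← Nat.descFactorial_self, Nat.descFactorial_eq_prod_range, Nat.cast_prod]
  refine Finset.prod_congr rfl fun j hj => ?_
  rw [Nat.cast_sub (Finset.mem_range.1 hj).le]

/-- The average of a ratio of polynomials on the torus as a determinant. -/
theorem integral_torus_ratio_eq_det {β : κ → ℂ} (hβ : ∀ j, ‖β j‖ < 1) {n k N : ℕ} (hn : n ≠ 0)
    (hkN : k + N = n + Fintype.card κ) (ζ : Fin k → ℂ) :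
    ((∫ x, (∏ r, ((∏ i, ‖circlePoint (x r) - ζ i‖ ^ 2) /
        ∏ j, ‖1 - conj (β j) * circlePoint (x r)‖ ^ 2)) * weylDensityReal x ∂torusMeasure N : ℝ) : ℂ) *
      ((‖(Matrix.vandermonde ζ).det‖ ^ 2 : ℝ) : ℂ) =
      (szegoGram β (k + N)).det * N.factorial *
        (Matrix.of fun i j => szegoKernel β (k + N) (ζ i) (ζ j)).det := by
  have hG : (szegoGram β (k + N)).det ≠ 0 := by
    rw [hkN]
    exact (isUnit_det_szegoGram hβ hn).ne_zero
  have h := integral_det_kernel (continuous_szegoWeight hβ) (continuous_szegoKernel β (k + N))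
    (M := ((k + N : ℕ) : ℂ)) (fun p r => by rw [hkN]; exact integral_szegoKernel_mul hβ hn p r)
    (by rw [hkN]; exact integral_szegoKernel_self hβ hn) N ζ
  have h1 : ∀ x : Fin N → UnitAddCircle, (Matrix.of fun s t : Fin k ⊕ Fin N =>
      szegoKernel β (k + N) (Sum.elim ζ (circlePoint ∘ x) s) (Sum.elim ζ (circlePoint ∘ x) t)).det *
      ∏ r, szegoWeight β (x r) = (szegoGram β (k + N)).det⁻¹ *
      ((‖(Matrix.vandermonde ζ).det‖ ^ 2 : ℝ) : ℂ) *
      (((∏ r, ((∏ i, ‖circlePoint (x r) - ζ i‖ ^ 2) /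
        ∏ j, ‖1 - conj (β j) * circlePoint (x r)‖ ^ 2)) * weylDensityReal x : ℝ) : ℂ) := fun x => by
    rw [det_szegoKernel_append, norm_det_vandermonde_append, weylDensityReal_eq]
    simp only [szegoWeight_eq, Finset.prod_div_distrib, Function.comp_apply, Finset.prod_inv_distrib,
      Finset.prod_pow]
    push_cast
    simp only [Finset.prod_pow]
    ring
  -- With rank `k + N` and `k` frozen points, the factors of the successive integrations are `N -
  -- j`, with product `N!`.
  have h2 : ∀ j : ℕ, ((k + N : ℕ) : ℂ) - (Fintype.card (Fin k) : ℂ) - (j : ℂ) = (N : ℂ) - j :=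
    fun j => by
      rw [Fintype.card_fin]
      push_cast
      ring
  simp only [h1, h2, integral_const_mul, integral_complex_ofReal, prod_range_natCast_sub] at h
  rw [mul_assoc, ← h]
  field_simp

theorem szegoGram_of_isEmpty [IsEmpty κ] (β : κ → ℂ) (M : ℕ) : szegoGram β M = 1 := by
  have h1 : ∀ m : ℕ, ∫ θ, circlePoint θ ^ m ∂AddCircle.haarAddCircle = (0 : ℂ) ^ m := fun m =>
    integral_circlePoint_of_diffContOnCl (f := fun z => z ^ m)
      (differentiable_pow m).diffContOnCl
  have h2 : ∀ a b : ℕ, b ≤ a → ∀ θ, circlePoint θ ^ a * conj (circlePoint θ ^ b) =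
      circlePoint θ ^ (a - b) := fun a b hab θ => by
    rw [map_pow, conj_circlePoint, inv_pow, pow_sub₀ _ (circlePoint_ne_zero θ) hab]
  have h3 : ∀ a b : ℕ, b ≤ a → ∫ θ, circlePoint θ ^ a * conj (circlePoint θ ^ b)
      ∂AddCircle.haarAddCircle = if a = b then 1 else 0 := fun a b hab => by
    simp only [h2 a b hab, h1]
    split_ifs with h
    · simp [h]
    · exact zero_pow (by omega)
  ext a b
  rw [szegoGram, Matrix.of_apply, Matrix.one_apply]
  simp only [szegoWeight, szegoPoly, Finset.univ_eq_empty, Finset.prod_empty, map_one, mul_one,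
    inv_one, Fin.ext_iff]
  rcases le_total (b : ℕ) a with hab | hab
  · exact h3 a b hab
  · have h4 := congrArg conj (h3 b a hab)
    rw [← integral_conj] at h4
    simp only [map_mul, Complex.conj_conj] at h4
    simp only [mul_comm (circlePoint _ ^ (a : ℕ)), h4, eq_comm (a := (b : ℕ))]
    split_ifs <;> simp

/-- The determinant formula with no frozen points and no poles. -/
theorem integral_weylDensityReal {N : ℕ} (hN : N ≠ 0) :
    ∫ x, weylDensityReal x ∂torusMeasure N = N.factorial := by
  have h := integral_torus_ratio_eq_det (κ := Fin 0) (β := ![]) (fun j => j.elim0) (n := N)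
    (k := 0) (N := N) hN (by simp) ![]
  simp only [szegoGram_of_isEmpty, Finset.univ_eq_empty, Finset.prod_empty, div_one,
    Finset.prod_const_one, one_mul, Matrix.det_isEmpty, Matrix.det_one, norm_one, one_pow,
    Complex.ofReal_one, mul_one] at h
  exact_mod_cast h

/-- Evaluate the torus formula at `ζ = β`: the ratio is identically 1, so the left side is known. On
the right the second product of `szegoNum` vanishes at each `β_i`, which leaves a rescaled Cauchy
determinant; the formula is then solved for the Gram determinant. -/
theorem det_szegoGram {l n : ℕ} (hn : n ≠ 0) {β : Fin l → ℂ} (hβ : ∀ j, ‖β j‖ < 1)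
    (hinj : Function.Injective β) :
    (szegoGram β (n + l)).det = ((∏ i, ∏ j, ‖1 - β i * conj (β j)‖ : ℝ) : ℂ)⁻¹ := by
  have h := integral_torus_ratio_eq_det hβ (k := l) (N := n) hn (by simp [add_comm]) β
  have h1 : ∀ x : Fin n → UnitAddCircle, (∏ r, ((∏ i, ‖circlePoint (x r) - β i‖ ^ 2) /
        ∏ j, ‖1 - conj (β j) * circlePoint (x r)‖ ^ 2)) = 1 := fun x => by
    refine Finset.prod_eq_one fun r _ => ?_
    rw [← Finset.prod_div_distrib]
    refine Finset.prod_eq_one fun j _ => ?_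
    rw [norm_circlePoint_sub, div_self]
    refine pow_ne_zero 2 (norm_ne_zero_iff.2 (one_sub_ne_zero_of_norm ?_ (norm_circlePoint _).le))
    rw [Complex.norm_conj]
    exact hβ j
  have h4 : (Matrix.of fun i j => szegoKernel β (l + n) (β i) (β j)) =
      Matrix.diagonal (fun i => szegoPoly β (β i)) * cauchyMatrix β *
        Matrix.diagonal (fun i => conj (szegoPoly β (β i))) := by
    ext i j
    have h5 := szegoKernel_eq hβ hn (hβ i) (hβ j)
    rw [Fintype.card_fin, add_comm n l] at h5
    have h6 : ∏ m, (β i - β m) = 0 := Finset.prod_eq_zero (Finset.mem_univ i) (sub_self _)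
    rw [Matrix.of_apply, h5, szegoNum, h6, Matrix.mul_diagonal, Matrix.diagonal_mul, cauchyMatrix,
      Matrix.of_apply]
    ring
  simp only [h1, one_mul, integral_weylDensityReal hn, h4, Matrix.det_mul, Matrix.det_diagonal,
    det_cauchyMatrix hβ hinj] at h
  have h7 : (∏ i, szegoPoly β (β i)) * ∏ i, conj (szegoPoly β (β i)) =
      ((∏ i, ∏ j, ‖1 - β i * conj (β j)‖ : ℝ) : ℂ) ^ 2 := by
    rw [← map_prod, Complex.mul_conj, Complex.normSq_eq_norm_sq, norm_prod]
    push_cast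
    simp only [szegoPoly, norm_prod, mul_comm (conj _)]
    push_cast
    rfl
  rw [add_comm n l]
  set D := (szegoGram β (l + n)).det
  set P := ∏ i, ∏ j, ‖1 - β i * conj (β j)‖ with hP
  set W := ‖(Matrix.vandermonde β).det‖
  have hP0 : P ≠ 0 := Finset.prod_ne_zero_iff.2 fun i _ =>
    Finset.prod_ne_zero_iff.2 fun j _ => norm_ne_zero_iff.2 (one_sub_mul_conj_ne_zero (hβ i) (hβ j))
  have hW : W ≠ 0 := norm_ne_zero_iff.2 (Matrix.det_vandermonde_ne_zero_iff.2 hinj)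
  have hP1 : (P : ℂ) ≠ 0 := by exact_mod_cast hP0
  have hW1 : (W : ℂ) ≠ 0 := by exact_mod_cast hW
  have hN : (n.factorial : ℂ) ≠ 0 := by exact_mod_cast n.factorial_ne_zero
  push_cast at h h7
  have h8 : (n.factorial : ℂ) * W ^ 2 = (n.factorial * W ^ 2) * (D * P) := by
    refine h.trans ?_
    field_simp
    linear_combination D * h7
  rw [eq_comm, mul_eq_left₀ (mul_ne_zero hN (pow_ne_zero 2 hW1))] at h8
  exact eq_inv_of_mul_eq_one_left h8

end TorusRatio

/-! ### Exponential moments of the two fields -/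

section ExponentialMoments

theorem bias_eq_sum (z y : Finset Complex.UnitDisc) (F : Complex.UnitDisc → ℝ) :
    bias z y F = ∑ a ∈ z ∪ y, ((if a ∈ z then 2 else 0) - if a ∈ y then 2 else 0) * F a := by
  simp only [sub_mul, ite_mul, zero_mul, Finset.sum_sub_distrib, Finset.sum_ite_mem, bias]
  rw [Finset.inter_eq_right.2 Finset.subset_union_left,
    Finset.inter_eq_right.2 Finset.subset_union_right]

variable {Ω : Type*} [MeasurableSpace Ω] {P : Measure Ω} {G : Complex.UnitDisc → Ω → ℝ}

theorem IsFieldG.hasGaussianLaw_bias (hG : IsFieldG G P) (z y : Finset Complex.UnitDisc) :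
    HasGaussianLaw (fun ω => bias z y fun a => G a ω) P := by
  simp only [bias_eq_sum]
  exact (hG.isGaussianProcess.smul
    fun a => (if a ∈ z then 2 else 0) - if a ∈ y then 2 else 0).hasGaussianLaw_fun_sum

theorem IsFieldG.integral_bias (hG : IsFieldG G P) (z y : Finset Complex.UnitDisc) :
    ∫ ω, bias z y (fun a => G a ω) ∂P = 0 := by
  simp only [bias_eq_sum]
  rw [integral_finsetSum _ fun a _ =>
    (hG.isGaussianProcess.hasGaussianLaw_eval a).integrable.const_mul _]
  simp only [integral_const_mul, hG.integral_eq_zero, mul_zero, Finset.sum_const_zero]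

theorem IsFieldG.integral_bias_sq (hG : IsFieldG G P) (z y : Finset Complex.UnitDisc) :
    ∫ ω, (bias z y fun a => G a ω) ^ 2 ∂P = bias z y fun a => bias z y fun b =>
      -Real.log ‖1 - (a : ℂ) * conj (b : ℂ)‖ / 2 := by
  have hint : ∀ a b, Integrable (fun ω => G a ω * G b ω) P := fun a b =>
    (hG.isGaussianProcess.hasGaussianLaw_eval a).memLp_two.integrable_mul
      (hG.isGaussianProcess.hasGaussianLaw_eval b).memLp_two
  set c : Complex.UnitDisc → ℝ := fun a => (if a ∈ z then 2 else 0) - if a ∈ y then 2 else 0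
  have h1 : ∀ ω, (bias z y fun a => G a ω) ^ 2 =
      ∑ a ∈ z ∪ y, ∑ b ∈ z ∪ y, c a * c b * (G a ω * G b ω) := fun ω => by
    rw [bias_eq_sum, sq, Finset.sum_mul_sum]
    exact Finset.sum_congr rfl fun a _ => Finset.sum_congr rfl fun b _ => by ring
  simp only [h1]
  rw [integral_finsetSum _ fun a _ => integrable_finsetSum _ fun b _ => (hint a b).const_mul _,
    bias_eq_sum]
  refine Finset.sum_congr rfl fun a _ => ?_
  rw [integral_finsetSum _ fun b _ => (hint a b).const_mul _, bias_eq_sum, Finset.mul_sum]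
  refine Finset.sum_congr rfl fun b _ => ?_
  rw [integral_const_mul, hG.integral_mul, mul_assoc]

theorem one_sub_mul_conj_unitDisc_ne_zero (a b : Complex.UnitDisc) :
    1 - (a : ℂ) * conj (b : ℂ) ≠ 0 :=
  one_sub_mul_conj_ne_zero a.norm_lt_one b.norm_lt_one

theorem exp_bias_bias (z y : Finset Complex.UnitDisc) :
    Real.exp ((bias z y fun a => bias z y fun b =>
      -Real.log ‖1 - (a : ℂ) * conj (b : ℂ)‖ / 2) / 2) =
      (∏ a ∈ z, ∏ b ∈ y, ‖1 - (a : ℂ) * conj (b : ℂ)‖ ^ 2) /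
        ((∏ a ∈ z, ∏ b ∈ z, ‖1 - (a : ℂ) * conj (b : ℂ)‖) *
          ∏ a ∈ y, ∏ b ∈ y, ‖1 - (a : ℂ) * conj (b : ℂ)‖) := by
  have hp : ∀ s t : Finset Complex.UnitDisc,
      Real.exp (∑ a ∈ s, ∑ b ∈ t, Real.log ‖1 - (a : ℂ) * conj (b : ℂ)‖) =
        ∏ a ∈ s, ∏ b ∈ t, ‖1 - (a : ℂ) * conj (b : ℂ)‖ := fun s t => by
    simp only [Real.exp_sum]
    exact Finset.prod_congr rfl fun a _ => Finset.prod_congr rfl fun b _ =>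
      Real.exp_log (norm_pos_iff.2 (one_sub_mul_conj_unitDisc_ne_zero a b))
  set L : Finset Complex.UnitDisc → Finset Complex.UnitDisc → ℝ := fun s t =>
    ∑ a ∈ s, ∑ b ∈ t, Real.log ‖1 - (a : ℂ) * conj (b : ℂ)‖ with hL
  have hsymm : L y z = L z y := by
    simp only [hL]
    rw [Finset.sum_comm]
    refine Finset.sum_congr rfl fun a _ => Finset.sum_congr rfl fun b _ => ?_
    rw [← Complex.norm_conj]
    simp [mul_comm]
  have h1 : (bias z y fun a => bias z y fun b => -Real.log ‖1 - (a : ℂ) * conj (b : ℂ)‖ / 2) / 2 =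
      2 * L z y - L z z - L y y := by
    have h2 : (bias z y fun a => bias z y fun b => -Real.log ‖1 - (a : ℂ) * conj (b : ℂ)‖ / 2) =
        -2 * L z z + 2 * L z y + 2 * L y z - 2 * L y y := by
      simp only [bias, hL, ← Finset.mul_sum, ← Finset.sum_div, Finset.sum_neg_distrib,
        Finset.sum_sub_distrib]
      ring
    rw [h2, hsymm]
    ring
  rw [h1, sub_sub, Real.exp_sub, Real.exp_add, two_mul, Real.exp_add, hp, hp, hp]
  simp only [sq, Finset.prod_mul_distrib]

/-- The exponential moments of the Gaussian field. -/
theorem IsFieldG.integral_exp_bias (hG : IsFieldG G P) (z y : Finset Complex.UnitDisc) :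
    ∫ ω, Real.exp (bias z y fun a => G a ω) ∂P =
      (∏ a ∈ z, ∏ b ∈ y, ‖1 - (a : ℂ) * conj (b : ℂ)‖ ^ 2) /
        ((∏ a ∈ z, ∏ b ∈ z, ‖1 - (a : ℂ) * conj (b : ℂ)‖) *
          ∏ a ∈ y, ∏ b ∈ y, ‖1 - (a : ℂ) * conj (b : ℂ)‖) := by
  have hlaw := hG.hasGaussianLaw_bias z y
  have h1 := mgf_gaussianReal hlaw.map_eq_gaussianReal 1
  rw [hG.integral_bias, Real.coe_toNNReal _ (variance_nonneg _ _),
    variance_of_integral_eq_zero hlaw.aemeasurable (hG.integral_bias z y)] at h1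
  simp only [mgf, one_mul, zero_add, one_pow, mul_one, hG.integral_bias_sq z y,
    exp_bias_bias] at h1
  exact h1

theorem IsFieldG.integrable_exp_bias (hG : IsFieldG G P) (z y : Finset Complex.UnitDisc) :
    Integrable (fun ω => Real.exp (bias z y fun a => G a ω)) P := by
  -- A non-integrable function has integral 0 by convention, whereas the moment just computed is
  -- positive.
  refine Integrable.of_integral_ne_zero ?_
  rw [hG.integral_exp_bias, ← exp_bias_bias]
  exact Real.exp_ne_zero _

theorem exp_bias_fieldU {N : ℕ} (z y : Finset Complex.UnitDisc)
    (A : Matrix.unitaryGroup (Fin N) ℂ) :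
    Real.exp (bias z y fun a => fieldU N a A) =
      (∏ a : z, ‖(1 - (a : ℂ) • (A : Matrix (Fin N) (Fin N) ℂ)).det‖ ^ 2) /
        ∏ b : y, ‖(1 - (b : ℂ) • (A : Matrix (Fin N) (Fin N) ℂ)).det‖ ^ 2 := by
  have h : ∀ a : Complex.UnitDisc, Real.exp (2 * fieldU N a A) =
      ‖(1 - (a : ℂ) • (A : Matrix (Fin N) (Fin N) ℂ)).det‖ ^ 2 := fun a => by
    rw [two_mul, Real.exp_add, fieldU,
      Real.exp_log (norm_pos_iff.2 (det_one_sub_smul_ne_zero a.norm_lt_one A)), sq]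
  rw [bias, Real.exp_sub, Real.exp_sum, Real.exp_sum]
  simp only [h]
  rw [← Finset.prod_coe_sort z, ← Finset.prod_coe_sort y]

theorem integrable_exp_bias_fieldU (N : ℕ) (z y : Finset Complex.UnitDisc) :
    Integrable (fun A => Real.exp (bias z y fun a => fieldU N a A)) (haarUnitary N) := by
  simp only [exp_bias_fieldU]
  exact (continuous_ratio_unitary fun b : y => b.1.norm_lt_one).integrable_of_hasCompactSupport
    (HasCompactSupport.of_compactSpace _)

end ExponentialMoments

/-! ### The ratio of the exponential moments as a determinant -/

section RatioDeterminant

open Matrix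

variable {ι : Type*} [Fintype ι] [DecidableEq ι]

/-- The normalized Szegő kernel at the points `ζ_i`. -/
noncomputable def szegoCorrelation (ζ : ι → ℂ) : Matrix ι ι ℂ :=
  Matrix.of fun i j => (√(1 - ‖ζ i‖ ^ 2) : ℂ) * (1 - ζ i * conj (ζ j))⁻¹ * (√(1 - ‖ζ j‖ ^ 2) : ℂ)

/-- The inverse of the Blaschke product of the other points at `ζ_i`. -/
noncomputable def invBlaschke (ζ : ι → ℂ) (i : ι) : ℂ :=
  ∏ m ∈ Finset.univ.erase i, (1 - ζ i * conj (ζ m)) / (ζ i - ζ m)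

/-- The matrix `conj(Ĉ) E Ĉ conj(E)` with `Ĉ` the normalized Szegő kernel and `E = diag(e)`. -/
noncomputable def perturbationMatrix (ζ e : ι → ℂ) : Matrix ι ι ℂ :=
  (szegoCorrelation ζ).map conj * Matrix.diagonal e * szegoCorrelation ζ *
    Matrix.diagonal fun i => conj (e i)

theorem cauchyWeight_eq {ζ : ι → ℂ} (hζ : ∀ i, ‖ζ i‖ < 1) (i : ι) :
    cauchyWeight ζ i = (√(1 - ‖ζ i‖ ^ 2) : ℂ) * (√(1 - ‖ζ i‖ ^ 2) : ℂ) * invBlaschke ζ i := by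
  have h1 : (0 : ℝ) ≤ 1 - ‖ζ i‖ ^ 2 := by nlinarith [norm_nonneg (ζ i), hζ i]
  rw [← Complex.ofReal_mul, Real.mul_self_sqrt h1, cauchyWeight, invBlaschke,
    Finset.prod_div_distrib, ← Finset.mul_prod_erase Finset.univ _ (Finset.mem_univ i),
    Complex.mul_conj, Complex.normSq_eq_norm_sq]
  push_cast
  ring

/-- Factor `C` out of `C - Φ C conj(Φ)` with its explicit inverse. Each residue in that inverse is
`1 - |ζ_i|^2` times `invBlaschke`; its two square roots are distributed to both sides of `C` and
`conj C`, using `det (1 - XY) = det (1 - YX)` twice, which normalizes both to `szegoCorrelation`. -/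
theorem det_cauchyMatrix_sub {ζ : ι → ℂ} (hζ : ∀ i, ‖ζ i‖ < 1) (hinj : Function.Injective ζ)
    (φ : ι → ℂ) :
    (Matrix.of fun i j => (1 - φ i * conj (φ j)) * (1 - ζ i * conj (ζ j))⁻¹).det =
      (cauchyMatrix ζ).det *
        (1 - perturbationMatrix ζ fun i => invBlaschke ζ i * φ i).det := by
  set C := cauchyMatrix ζ with hC
  set S : Matrix ι ι ℂ := Matrix.diagonal fun i => (√(1 - ‖ζ i‖ ^ 2) : ℂ) with hS
  set g := invBlaschke ζ with hg
  set E : Matrix ι ι ℂ := Matrix.diagonal fun i => g i * φ i with hE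
  set E' : Matrix ι ι ℂ := Matrix.diagonal fun i => conj (g i * φ i) with hE'
  set D' : Matrix ι ι ℂ := Matrix.diagonal fun i => conj (cauchyWeight ζ i) with hD'
  have hinv := cauchyMatrix_mul_eq_one hζ hinj
  have h1 : (Matrix.of fun i j => (1 - φ i * conj (φ j)) * (1 - ζ i * conj (ζ j))⁻¹) =
      C - Matrix.diagonal φ * C * Matrix.diagonal fun i => conj (φ i) := by
    ext i j
    rw [Matrix.sub_apply, Matrix.mul_diagonal, Matrix.diagonal_mul, hC, cauchyMatrix,
      Matrix.of_apply, Matrix.of_apply]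
    ring
  have h2 : C - Matrix.diagonal φ * C * (Matrix.diagonal fun i => conj (φ i)) =
      C * (1 - D' * (C.map conj * Matrix.diagonal (cauchyWeight ζ) *
        (Matrix.diagonal φ * C * Matrix.diagonal fun i => conj (φ i)))) := by
    rw [Matrix.mul_sub, Matrix.mul_one]
    congr 1
    calc _ = (1 : Matrix ι ι ℂ) * (Matrix.diagonal φ * C * Matrix.diagonal fun i => conj (φ i)) :=
          (Matrix.one_mul _).symm
      _ = _ := by
        rw [← hinv]
        simp only [Matrix.mul_assoc]
        rfl
  have h3 : Matrix.diagonal (cauchyWeight ζ) * Matrix.diagonal φ = S * E * S := by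
    rw [hS, hE, Matrix.diagonal_mul_diagonal, Matrix.diagonal_mul_diagonal,
      Matrix.diagonal_mul_diagonal]
    congr 1
    ext i
    rw [cauchyWeight_eq hζ]
    ring
  have h4 : (Matrix.diagonal fun i => conj (φ i)) * D' = S * E' * S := by
    rw [hS, hE', hD', Matrix.diagonal_mul_diagonal, Matrix.diagonal_mul_diagonal,
      Matrix.diagonal_mul_diagonal]
    congr 1
    ext i
    rw [cauchyWeight_eq hζ]
    simp only [map_mul, Complex.conj_ofReal]
    ring
  have h5 : szegoCorrelation ζ = S * C * S := by
    ext i j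
    rw [hS, Matrix.mul_diagonal, Matrix.diagonal_mul]
    rfl
  have h6 : (szegoCorrelation ζ).map conj = S * C.map conj * S := by
    ext i j
    rw [hS, Matrix.mul_diagonal, Matrix.diagonal_mul, Matrix.map_apply, Matrix.map_apply,
      szegoCorrelation, Matrix.of_apply, map_mul, map_mul, Complex.conj_ofReal, Complex.conj_ofReal]
    rfl
  have h7 : (C.map conj * Matrix.diagonal (cauchyWeight ζ) *
        (Matrix.diagonal φ * C * Matrix.diagonal fun i => conj (φ i))) * D' =
      (C.map conj * S * E * S * C * S * E') * S := by
    calc _ = C.map conj * (Matrix.diagonal (cauchyWeight ζ) * Matrix.diagonal φ) * C *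
          ((Matrix.diagonal fun i => conj (φ i)) * D') := by simp only [Matrix.mul_assoc]
      _ = _ := by
        rw [h3, h4]
        simp only [Matrix.mul_assoc]
  rw [h1, h2, Matrix.det_mul, Matrix.det_one_sub_mul_comm, h7, Matrix.det_one_sub_mul_comm]
  congr 3
  rw [perturbationMatrix, h6, h5]
  simp only [Matrix.mul_assoc]
  rfl

/-- The Blaschke product `ζ^n ∏ (ζ - β_j) / (1 - conj β_j ζ)`. -/
noncomputable def blaschke {κ : Type*} [Fintype κ] (β : κ → ℂ) (n : ℕ) (w : ℂ) : ℂ :=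
  w ^ n * ∏ j, ((w - β j) / (1 - conj (β j) * w))

/-- Pulling `q` out of rows and its conjugate out of columns turns the two products of `szegoNum`
into `1` and the Blaschke product. -/
theorem det_szegoKernel {k l n : ℕ} (hn : n ≠ 0) {ζ : Fin k → ℂ} {β : Fin l → ℂ}
    (hζ : ∀ i, ‖ζ i‖ < 1) (hβ : ∀ j, ‖β j‖ < 1) (hinj : Function.Injective ζ) :
    (Matrix.of fun i j => szegoKernel β (n + l) (ζ i) (ζ j)).det =
      ((∏ i, ‖szegoPoly β (ζ i)‖ ^ 2 : ℝ) : ℂ) * ((cauchyMatrix ζ).det *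
        (1 - perturbationMatrix ζ fun i => invBlaschke ζ i * blaschke β n (ζ i)).det) := by
  have h : (Matrix.of fun i j => szegoKernel β (n + l) (ζ i) (ζ j)) =
      Matrix.diagonal (fun i => szegoPoly β (ζ i)) *
        (Matrix.of fun i j => (1 - blaschke β n (ζ i) * conj (blaschke β n (ζ j))) *
          (1 - ζ i * conj (ζ j))⁻¹) * Matrix.diagonal (fun i => conj (szegoPoly β (ζ i))) := by
    ext i j
    have h5 := szegoKernel_eq hβ hn (hζ i) (hζ j)
    rw [Fintype.card_fin] at h5
    have hb : ∀ i, ζ i ^ n * ∏ m, (ζ i - β m) = szegoPoly β (ζ i) * blaschke β n (ζ i) := fun i => by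
      rw [blaschke, Finset.prod_div_distrib]
      have := szegoPoly_ne_zero hβ (hζ i).le
      change _ = _ * (_ * (_ / szegoPoly β (ζ i)))
      field_simp
    rw [Matrix.of_apply, h5, szegoNum, hb, hb, Matrix.mul_diagonal, Matrix.diagonal_mul,
      Matrix.of_apply, map_mul]
    ring
  rw [h, Matrix.det_mul, Matrix.det_mul, Matrix.det_diagonal, Matrix.det_diagonal,
    det_cauchyMatrix_sub hζ hinj, ← map_prod, mul_right_comm, Complex.mul_conj,
    Complex.normSq_eq_norm_sq, norm_prod, Finset.prod_pow]

/-- The average of a ratio of characteristic polynomials of a Haar unitary matrix, divided by its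
Gaussian prediction, is a Fredholm-type determinant. -/
theorem integral_haarUnitary_ratio_eq_det {k l N n : ℕ} (hN : N ≠ 0) (hn : n ≠ 0)
    (hkN : k + N = n + l) {z : Fin k → ℂ} {b : Fin l → ℂ} (hz : ∀ i, ‖z i‖ < 1)
    (hb : ∀ j, ‖b j‖ < 1) (hzinj : Function.Injective z) (hbinj : Function.Injective b) :
    ((∫ A : Matrix.unitaryGroup (Fin N) ℂ,
        (∏ i, ‖(1 - z i • (A : Matrix (Fin N) (Fin N) ℂ)).det‖ ^ 2) /
          ∏ j, ‖(1 - b j • (A : Matrix (Fin N) (Fin N) ℂ)).det‖ ^ 2 ∂haarUnitary N : ℝ) : ℂ) =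
      (((∏ i, ∏ j, ‖1 - z i * conj (b j)‖ ^ 2) / ((∏ i, ∏ j, ‖1 - z i * conj (z j)‖) *
        ∏ i, ∏ j, ‖1 - b i * conj (b j)‖) : ℝ) : ℂ) *
      (1 - perturbationMatrix (fun i => conj (z i)) fun i =>
        invBlaschke (fun i => conj (z i)) i * blaschke (fun j => conj (b j)) n (conj (z i))).det := by
  -- On the circle `|1 - z x| = |x - conj z|`, so the Vandermonde is completed by the conjugate
  -- points.
  set ζ : Fin k → ℂ := fun i => conj (z i) with hζd
  set β : Fin l → ℂ := fun j => conj (b j) with hβd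
  have hζ : ∀ i, ‖ζ i‖ < 1 := fun i => by simpa [hζd] using hz i
  have hβ : ∀ j, ‖β j‖ < 1 := fun i => by simpa [hβd] using hb i
  have hζinj : Function.Injective ζ := (starRingEnd ℂ).injective.comp hzinj
  have hβinj : Function.Injective β := (starRingEnd ℂ).injective.comp hbinj
  have h1 := integral_haarUnitary_ratio (N := N) hz hb
  have h2 := integral_torus_ratio_eq_det hβ (k := k) (N := N) hn (by simpa using hkN) ζ
  rw [integral_weylDensityReal hN] at h1
  simp only [norm_circlePoint_sub] at h2
  simp only [hζd, hβd, Complex.conj_conj] at h2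
  rw [← h1, ← hβd, ← hζd, hkN, det_szegoGram hn hβ hβinj, det_szegoKernel hn hζ hβ hζinj,
    det_cauchyMatrix hζ hζinj] at h2
  have hconj : ∀ u v : ℂ, ‖1 - conj u * conj (conj v)‖ = ‖1 - u * conj v‖ := fun u v => by
    rw [← Complex.norm_conj]
    simp
  have h3 : ∏ i, ‖szegoPoly β (ζ i)‖ ^ 2 = ∏ i, ∏ j, ‖1 - z i * conj (b j)‖ ^ 2 := by
    refine Finset.prod_congr rfl fun i _ => ?_
    rw [szegoPoly, norm_prod, ← Finset.prod_pow]
    refine Finset.prod_congr rfl fun j _ => ?_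
    rw [← hconj (z i) (b j), mul_comm (conj (z i))]
  simp only [h3] at h2
  simp only [hζd, hβd, hconj] at h2
  set I := ∫ A : Matrix.unitaryGroup (Fin N) ℂ,
        (∏ i, ‖(1 - z i • (A : Matrix (Fin N) (Fin N) ℂ)).det‖ ^ 2) /
          ∏ j, ‖(1 - b j • (A : Matrix (Fin N) (Fin N) ℂ)).det‖ ^ 2 ∂haarUnitary N
  set W := ‖(Matrix.vandermonde ζ).det‖ with hW
  set D := (1 - perturbationMatrix (fun i => conj (z i)) fun i =>
        invBlaschke (fun i => conj (z i)) i * blaschke (fun j => conj (b j)) n (conj (z i))).det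
  set P := ∏ i, ∏ j, ‖1 - z i * conj (z j)‖
  set Q := ∏ i, ∏ j, ‖1 - b i * conj (b j)‖
  set X := ∏ i, ∏ j, ‖1 - z i * conj (b j)‖ ^ 2
  have hP : (P : ℂ) ≠ 0 := by
    exact_mod_cast Finset.prod_ne_zero_iff.2 fun i _ => Finset.prod_ne_zero_iff.2 fun j _ =>
      norm_ne_zero_iff.2 (one_sub_mul_conj_ne_zero (hz i) (hz j))
  have hQ : (Q : ℂ) ≠ 0 := by
    exact_mod_cast Finset.prod_ne_zero_iff.2 fun i _ => Finset.prod_ne_zero_iff.2 fun j _ =>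
      norm_ne_zero_iff.2 (one_sub_mul_conj_ne_zero (hb i) (hb j))
  have hW0 : (W : ℂ) ≠ 0 := by
    exact_mod_cast norm_ne_zero_iff.2 (Matrix.det_vandermonde_ne_zero_iff.2 hζinj)
  have hNf : (N.factorial : ℂ) ≠ 0 := by exact_mod_cast N.factorial_ne_zero
  push_cast at h2 ⊢
  refine mul_right_cancel₀ (mul_ne_zero hNf (pow_ne_zero 2 hW0)) ?_
  rw [← mul_assoc, h2]
  field_simp

end RatioDeterminant

/-! ### Bounds for the perturbation determinant -/

section PerturbationBounds

open Matrix

theorem norm_prod_sub_prod_le {α : Type*} {s : Finset α} {a b : α → ℂ} {m ε : ℝ} (hm : 0 ≤ m)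
    (ha : ∀ i ∈ s, ‖a i‖ ≤ m) (hb : ∀ i ∈ s, ‖b i‖ ≤ m) (hab : ∀ i ∈ s, ‖a i - b i‖ ≤ ε) :
    ‖∏ i ∈ s, a i - ∏ i ∈ s, b i‖ ≤ s.card * m ^ (s.card - 1) * ε := by
  classical
  induction s using Finset.induction_on with
  | empty => simp
  | insert i s hi ih =>
    have h1 := ih (fun j hj => ha j (Finset.mem_insert_of_mem hj))
      (fun j hj => hb j (Finset.mem_insert_of_mem hj))
      (fun j hj => hab j (Finset.mem_insert_of_mem hj))
    have h2 : ‖∏ j ∈ s, a j‖ ≤ m ^ s.card := by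
      rw [norm_prod]
      exact (Finset.prod_le_prod (fun _ _ => norm_nonneg _)
        fun j hj => ha j (Finset.mem_insert_of_mem hj)).trans_eq (Finset.prod_const m)
    have hε : 0 ≤ ε := (norm_nonneg _).trans (hab i (Finset.mem_insert_self i s))
    have h3 : (s.card : ℝ) * (m * m ^ (s.card - 1)) = s.card * m ^ s.card := by
      rcases Nat.eq_zero_or_pos s.card with h | h
      · simp [h]
      · rw [mul_pow_sub_one h.ne']
    rw [Finset.prod_insert hi, Finset.prod_insert hi, Finset.card_insert_of_notMem hi]
    calc ‖a i * ∏ j ∈ s, a j - b i * ∏ j ∈ s, b j‖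
        = ‖(a i - b i) * ∏ j ∈ s, a j + b i * (∏ j ∈ s, a j - ∏ j ∈ s, b j)‖ := by
          congr 1
          ring
      _ ≤ ε * m ^ s.card + m * (s.card * m ^ (s.card - 1) * ε) := by
          refine (norm_add_le _ _).trans (add_le_add ?_ ?_)
          · rw [norm_mul]
            exact mul_le_mul (hab i (Finset.mem_insert_self i s)) h2 (norm_nonneg _) hε
          · rw [norm_mul]
            exact mul_le_mul (hb i (Finset.mem_insert_self i s)) h1 (norm_nonneg _) hm
      _ = (s.card + 1 : ℕ) * m ^ (s.card + 1 - 1) * ε := by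
          rw [Nat.add_sub_cancel]
          push_cast
          linear_combination ε * h3

/-- `(1 - a ^ 2) (1 - b ^ 2) ≤ (1 - a b) ^ 2` for the moduli `a, b`, together with the reverse
triangle inequality. -/
theorem norm_szegoCorrelation_le {ι : Type*} {ζ : ι → ℂ} (hζ : ∀ i, ‖ζ i‖ < 1) (i j : ι) :
    ‖szegoCorrelation ζ i j‖ ≤ 1 := by
  have hi := hζ i
  have hj := hζ j
  have hi0 := norm_nonneg (ζ i)
  have hj0 := norm_nonneg (ζ j)
  have h1 : 1 - ‖ζ i‖ * ‖ζ j‖ ≤ ‖1 - ζ i * conj (ζ j)‖ := by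
    have := norm_sub_norm_le (1 : ℂ) (ζ i * conj (ζ j))
    rwa [norm_one, norm_mul, Complex.norm_conj] at this
  have h2 : 0 < 1 - ‖ζ i‖ * ‖ζ j‖ := by nlinarith
  have h3 : √(1 - ‖ζ i‖ ^ 2) * √(1 - ‖ζ j‖ ^ 2) ≤ 1 - ‖ζ i‖ * ‖ζ j‖ := by
    rw [← Real.sqrt_mul (by nlinarith)]
    exact Real.sqrt_le_iff.2 ⟨h2.le, by nlinarith [sq_nonneg (‖ζ i‖ - ‖ζ j‖)]⟩
  rw [szegoCorrelation, Matrix.of_apply, norm_mul, norm_mul, Complex.norm_real, Complex.norm_real,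
    Real.norm_of_nonneg (Real.sqrt_nonneg _), Real.norm_of_nonneg (Real.sqrt_nonneg _), norm_inv,
    mul_right_comm]
  exact mul_inv_le_one_of_le₀ (h3.trans h1) (norm_nonneg _)

theorem szegoCorrelation_self {ι : Type*} {ζ : ι → ℂ} (hζ : ∀ i, ‖ζ i‖ < 1) (i : ι) :
    szegoCorrelation ζ i i = 1 := by
  have h1 : (0 : ℝ) < 1 - ‖ζ i‖ ^ 2 := by nlinarith [norm_nonneg (ζ i), hζ i]
  rw [szegoCorrelation, Matrix.of_apply, mul_right_comm, ← Complex.ofReal_mul,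
    Real.mul_self_sqrt h1.le, Complex.mul_conj, Complex.normSq_eq_norm_sq]
  have h2 : ((1 - ‖ζ i‖ ^ 2 : ℝ) : ℂ) ≠ 0 := by exact_mod_cast h1.ne'
  push_cast at h2 ⊢
  exact mul_inv_cancel₀ h2

variable {ι : Type*} [Fintype ι] [DecidableEq ι]

theorem norm_det_sub_det_le {A B : Matrix ι ι ℂ} {m ε : ℝ} (hm : 0 ≤ m) (hA : ∀ i j, ‖A i j‖ ≤ m)
    (hB : ∀ i j, ‖B i j‖ ≤ m) (hAB : ∀ i j, ‖A i j - B i j‖ ≤ ε) :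
    ‖A.det - B.det‖ ≤ (Fintype.card ι).factorial *
      (Fintype.card ι * m ^ (Fintype.card ι - 1) * ε) := by
  rw [Matrix.det_apply', Matrix.det_apply', ← Finset.sum_sub_distrib]
  refine (norm_sum_le _ _).trans ((Finset.sum_le_card_nsmul _ _
    (Fintype.card ι * m ^ (Fintype.card ι - 1) * ε) fun σ _ => ?_).trans_eq ?_)
  · rw [← mul_sub, norm_mul, Complex.norm_intCast]
    have h1 : |((Equiv.Perm.sign σ : ℤ) : ℝ)| = 1 := by
      rcases Int.units_eq_one_or (Equiv.Perm.sign σ) with h | h <;> simp [h]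
    rw [h1, one_mul]
    exact norm_prod_sub_prod_le hm (fun i _ => hA _ _) (fun i _ => hB _ _) fun i _ => hAB _ _
  · rw [Finset.card_univ, Fintype.card_perm, nsmul_eq_mul]

theorem perturbationMatrix_apply (ζ e : ι → ℂ) (i j : ι) :
    perturbationMatrix ζ e i j =
      ∑ m, conj (szegoCorrelation ζ i m) * szegoCorrelation ζ m j * (e m * conj (e j)) := by
  rw [perturbationMatrix, Matrix.mul_diagonal, Matrix.mul_apply, Finset.sum_mul]
  refine Finset.sum_congr rfl fun m _ => ?_
  rw [Matrix.mul_diagonal, Matrix.map_apply]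
  ring

theorem norm_perturbationMatrix_sub_le {ζ : ι → ℂ} (hζ : ∀ i, ‖ζ i‖ < 1) {e e' : ι → ℂ} {ε : ℝ}
    (hε : ∀ m j, ‖e m * conj (e j) - e' m * conj (e' j)‖ ≤ ε) (i j : ι) :
    ‖perturbationMatrix ζ e i j - perturbationMatrix ζ e' i j‖ ≤ Fintype.card ι * ε := by
  rw [perturbationMatrix_apply, perturbationMatrix_apply, ← Finset.sum_sub_distrib]
  refine (norm_sum_le _ _).trans ((Finset.sum_le_card_nsmul _ _ ε fun m _ => ?_).trans_eq ?_)
  · rw [← mul_sub, norm_mul, norm_mul, Complex.norm_conj]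
    have h1 := mul_le_one₀ (norm_szegoCorrelation_le hζ i m) (norm_nonneg _)
      (norm_szegoCorrelation_le hζ m j)
    exact (mul_le_of_le_one_left (norm_nonneg _) h1).trans (hε m j)
  · rw [Finset.card_univ, nsmul_eq_mul]

theorem perturbationMatrix_zero (ζ : ι → ℂ) : perturbationMatrix ζ 0 = 0 := by
  ext i j
  simp [perturbationMatrix_apply]

/-- The matrix depends on `e` only through the products `e_m conj e_j`, with coefficients of modulus
at most 1; the determinants are then compared through their Leibniz expansions. -/
theorem norm_det_one_sub_perturbationMatrix_sub_le {ζ : ι → ℂ} (hζ : ∀ i, ‖ζ i‖ < 1)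
    {e e' : ι → ℂ} {δ ε : ℝ} (he : ∀ i, ‖e i‖ ≤ δ) (he' : ∀ i, ‖e' i‖ ≤ δ)
    (hε : ∀ m j, ‖e m * conj (e j) - e' m * conj (e' j)‖ ≤ ε) :
    ‖(1 - perturbationMatrix ζ e).det - (1 - perturbationMatrix ζ e').det‖ ≤
      (Fintype.card ι).factorial * (Fintype.card ι *
        (1 + Fintype.card ι * δ ^ 2) ^ (Fintype.card ι - 1) * (Fintype.card ι * ε)) := by
  have hbound : ∀ {e : ι → ℂ}, (∀ i, ‖e i‖ ≤ δ) → ∀ i j,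
      ‖(1 - perturbationMatrix ζ e) i j‖ ≤ 1 + Fintype.card ι * δ ^ 2 := fun {e} he i j => by
    have h1 := norm_perturbationMatrix_sub_le hζ (e := e) (e' := 0) (ε := δ ^ 2) (fun m j => by
      rw [Pi.zero_apply, zero_mul, sub_zero, norm_mul, Complex.norm_conj, sq]
      exact mul_le_mul (he m) (he j) (norm_nonneg _) ((norm_nonneg _).trans (he m))) i j
    rw [perturbationMatrix_zero, Matrix.zero_apply, sub_zero] at h1
    rw [Matrix.sub_apply]
    refine (norm_sub_le _ _).trans (add_le_add ?_ h1)
    rw [Matrix.one_apply]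
    split_ifs <;> simp
  refine norm_det_sub_det_le (by positivity) (hbound he) (hbound he') fun i j => ?_
  rw [Matrix.sub_apply, Matrix.sub_apply, sub_sub_sub_cancel_left, norm_sub_rev]
  exact norm_perturbationMatrix_sub_le hζ hε i j

/-- Only column `w` of the perturbation survives, so it has rank one, and its diagonal entry there
is `|c|^2` because `szegoCorrelation` is 1 on the diagonal. -/
theorem det_one_sub_perturbationMatrix_single {ζ : ι → ℂ} (hζ : ∀ i, ‖ζ i‖ < 1) (w : ι) (c : ℂ) :
    (1 - perturbationMatrix ζ (Pi.single w c)).det = ((1 - ‖c‖ ^ 2 : ℝ) : ℂ) := by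
  have h1 : 1 - perturbationMatrix ζ (Pi.single w c) = 1 +
      Matrix.replicateCol Unit (fun i => -(conj (szegoCorrelation ζ i w) * c)) *
        Matrix.replicateRow Unit (Pi.single w (conj c)) := by
    rw [sub_eq_add_neg]
    congr 1
    ext i j
    rw [Matrix.neg_apply, perturbationMatrix_apply, Finset.sum_eq_single w]
    · rw [Matrix.mul_apply, Fintype.sum_unique]
      by_cases hj : j = w
      · subst hj
        simp [szegoCorrelation_self hζ]
        ring
      · simp [hj]
    · intro m _ hm
      simp [hm]
    · simp
  rw [h1, Matrix.det_one_add_replicateCol_mul_replicateRow]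
  simp only [single_dotProduct, szegoCorrelation_self hζ, map_one, one_mul]
  rw [mul_neg, Complex.conj_mul']
  push_cast
  ring

theorem norm_det_one_sub_perturbationMatrix_sub_one_le {ζ : ι → ℂ} (hζ : ∀ i, ‖ζ i‖ < 1)
    {e : ι → ℂ} {δ : ℝ} (hδ : 0 ≤ δ) (he : ∀ i, ‖e i‖ ≤ δ) :
    ‖(1 - perturbationMatrix ζ e).det - 1‖ ≤
      (Fintype.card ι).factorial * (Fintype.card ι *
        (1 + Fintype.card ι * δ ^ 2) ^ (Fintype.card ι - 1) * (Fintype.card ι * δ ^ 2)) := by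
  have h := norm_det_one_sub_perturbationMatrix_sub_le hζ (e' := 0) (ε := δ ^ 2) he
    (fun _ => by simpa using hδ) fun m j => by
      rw [Pi.zero_apply, zero_mul, sub_zero, norm_mul, Complex.norm_conj, sq]
      exact mul_le_mul (he m) (he j) (norm_nonneg _) hδ
  rwa [perturbationMatrix_zero, sub_zero, Matrix.det_one] at h

/-- Compare with `e` truncated to its coordinate `w`: the products differ only when some index is
not `w`, and then one factor is at most `δ'` and the other at most `δ`. -/
theorem norm_det_one_sub_perturbationMatrix_sub_single_le {ζ : ι → ℂ} (hζ : ∀ i, ‖ζ i‖ < 1)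
    {e : ι → ℂ} {δ δ' : ℝ} (hδ : 0 ≤ δ) (hδ' : 0 ≤ δ') (he : ∀ i, ‖e i‖ ≤ δ) (w : ι)
    (he' : ∀ i, i ≠ w → ‖e i‖ ≤ δ') :
    ‖(1 - perturbationMatrix ζ e).det - ((1 - ‖e w‖ ^ 2 : ℝ) : ℂ)‖ ≤
      (Fintype.card ι).factorial * (Fintype.card ι *
        (1 + Fintype.card ι * δ ^ 2) ^ (Fintype.card ι - 1) * (Fintype.card ι * (δ * δ'))) := by
  rw [← det_one_sub_perturbationMatrix_single hζ w (e w)]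
  refine norm_det_one_sub_perturbationMatrix_sub_le hζ he (fun i => ?_) fun m j => ?_
  · by_cases hi : i = w
    · subst hi
      simpa using he i
    · simpa [hi] using hδ
  · by_cases hm : m = w
    · by_cases hj : j = w
      · subst hm hj
        simp only [Pi.single_eq_same, sub_self, norm_zero]
        positivity
      · rw [Pi.single_eq_of_ne hj, map_zero, mul_zero, sub_zero, norm_mul, Complex.norm_conj]
        exact mul_le_mul (he m) (he' j hj) (norm_nonneg _) hδ
    · rw [Pi.single_eq_of_ne hm, zero_mul, sub_zero, norm_mul, Complex.norm_conj, mul_comm δ]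
      exact mul_le_mul (he' m hm) (he j) (norm_nonneg _) hδ'

end PerturbationBounds

/-! ### Hyperbolic distance -/

section Hyperbolic

theorem norm_moebius_lt_one (y z : Complex.UnitDisc) :
    ‖((z : ℂ) - y) / (1 - (z : ℂ) * conj (y : ℂ))‖ < 1 := by
  have h1 : ‖1 - (z : ℂ) * conj (y : ℂ)‖ ^ 2 - ‖(z : ℂ) - y‖ ^ 2 =
      (1 - ‖(z : ℂ)‖ ^ 2) * (1 - ‖(y : ℂ)‖ ^ 2) := by
    simp only [← Complex.normSq_eq_norm_sq, Complex.normSq_apply, Complex.sub_re, Complex.sub_im,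
      Complex.mul_re, Complex.mul_im, Complex.one_re, Complex.one_im, Complex.conj_re,
      Complex.conj_im]
    ring
  have h2 : 0 < (1 - ‖(z : ℂ)‖ ^ 2) * (1 - ‖(y : ℂ)‖ ^ 2) :=
    mul_pos (sub_pos.2 z.sq_norm_lt_one) (sub_pos.2 y.sq_norm_lt_one)
  rw [norm_div, div_lt_one (norm_pos_iff.2 (one_sub_mul_conj_unitDisc_ne_zero z y))]
  exact lt_of_pow_lt_pow_left₀ 2 (norm_nonneg _) (by linarith)

theorem tanh_hypDist_div_two (y z : Complex.UnitDisc) :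
    Real.tanh (hypDist y z / 2) = ‖((z : ℂ) - y) / (1 - (z : ℂ) * conj (y : ℂ))‖ := by
  set r := ‖((z : ℂ) - y) / (1 - (z : ℂ) * conj (y : ℂ))‖ with hr
  have h0 : 0 ≤ r := norm_nonneg _
  have h1 : r < 1 := norm_moebius_lt_one y z
  have h2 : hypDist y z / 2 = Real.artanh r := by
    rw [Real.artanh_eq_half_log ⟨by linarith, h1.le⟩, hypDist]
    ring
  rw [h2, Real.tanh_artanh ⟨by linarith, h1⟩]

theorem coth_hypDist_div_two (y z : Complex.UnitDisc) :
    coth (hypDist y z / 2) = ‖1 - (z : ℂ) * conj (y : ℂ)‖ / ‖(z : ℂ) - y‖ := by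
  rw [coth, ← inv_div, ← Real.tanh_eq_sinh_div_cosh, tanh_hypDist_div_two, norm_div, inv_div]

/-- With `r = |a|`, `exp (-d(0, a)) = (1 - r) / (1 + r) ≤ 1 - r`, and `1 - t ≤ exp (-t)`. -/
theorem norm_pow_le_exp (a : Complex.UnitDisc) (N : ℕ) :
    ‖(a : ℂ)‖ ^ N ≤ Real.exp (-(N : ℝ) * Real.exp (-hypDist 0 a)) := by
  set r := ‖(a : ℂ)‖ with hr
  have h0 : 0 ≤ r := norm_nonneg _
  have h1 : r < 1 := a.norm_lt_one
  have h2 : Real.exp (-hypDist 0 a) = (1 - r) / (1 + r) := by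
    rw [hypDist, Real.exp_neg]
    simp only [Complex.UnitDisc.coe_zero, sub_zero, map_zero, mul_zero, div_one]
    rw [← hr, Real.exp_log (div_pos (by linarith) (by linarith)), inv_div]
  have h3 : r ≤ Real.exp (-((1 - r) / (1 + r))) := by
    have h4 := Real.add_one_le_exp (-((1 - r) / (1 + r)))
    have h5 : (1 - r) / (1 + r) ≤ 1 - r := div_le_self (by linarith) (by linarith)
    linarith
  rw [h2, neg_mul, ← mul_neg, Real.exp_nat_mul]
  exact pow_le_pow_left₀ h0 h3 N

end Hyperbolic

/-! ### Comparison of the exponential moments -/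

section Comparison

theorem prod_erase_equiv {α ι : Type*} [Fintype ι] [DecidableEq ι] [DecidableEq α] {s : Finset α}
    (σ : ι ≃ s) (i : ι) (f : α → ℝ) :
    ∏ x ∈ s.erase (σ i : α), f x = ∏ m ∈ Finset.univ.erase i, f (σ m) := by
  set g : α → ℝ := fun x => if x = (σ i : α) then 1 else f x with hg
  have h1 : ∏ x ∈ s.erase (σ i : α), f x = ∏ x ∈ s, g x := by
    rw [← Finset.prod_erase s (show g (σ i) = 1 by simp [hg])]
    exact Finset.prod_congr rfl fun x hx => (if_neg (Finset.ne_of_mem_erase hx)).symm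
  have h2 : ∏ m ∈ Finset.univ.erase i, f (σ m) = ∏ m, g (σ m) := by
    rw [← Finset.prod_erase Finset.univ (f := fun m => g (σ m)) (a := i) (by simp [hg])]
    refine Finset.prod_congr rfl fun m hm => (if_neg fun h => ?_).symm
    exact Finset.ne_of_mem_erase hm (σ.injective (Subtype.ext h))
  rw [h1, h2, ← Finset.prod_coe_sort s]
  exact (σ.prod_comp fun x : s => g x).symm

theorem coth_hypDist_div_two_eq_inv_tanh (x w : Complex.UnitDisc) :
    coth (hypDist x w / 2) = (Real.tanh (hypDist w x / 2))⁻¹ := by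
  rw [coth_hypDist_div_two, tanh_hypDist_div_two, norm_div, inv_div, norm_sub_rev (w : ℂ),
    ← Complex.norm_conj (1 - _)]
  simp [mul_comm]

/-- The modulus of the Blaschke factor attached to the point `a` of `𝐳`. -/
noncomputable def pointFactor (n : ℕ) (z y : Finset Complex.UnitDisc) (a : Complex.UnitDisc) : ℝ :=
  (∏ x ∈ z.erase a, coth (hypDist x a / 2)) *
    (‖(a : ℂ)‖ ^ n * ∏ b ∈ y, Real.tanh (hypDist a b / 2))

theorem tanh_hypDist_nonneg (a b : Complex.UnitDisc) : 0 ≤ Real.tanh (hypDist a b / 2) := by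
  rw [tanh_hypDist_div_two]
  exact norm_nonneg _

theorem prod_coth_nonneg (z : Finset Complex.UnitDisc) (a : Complex.UnitDisc) :
    0 ≤ ∏ x ∈ z.erase a, coth (hypDist x a / 2) :=
  Finset.prod_nonneg fun x _ => by
    rw [coth_hypDist_div_two_eq_inv_tanh]
    exact inv_nonneg.2 (tanh_hypDist_nonneg a x)

theorem weight_nonneg (N : ℕ) (z : Finset Complex.UnitDisc) (a : Complex.UnitDisc) :
    0 ≤ weight N z a := mul_nonneg (Real.exp_nonneg _) (prod_coth_nonneg z a)

theorem pointFactor_le_weight {N n : ℕ} (hNn : N ≤ n) (z y : Finset Complex.UnitDisc)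
    (a : Complex.UnitDisc) : pointFactor n z y a ≤ weight N z a := by
  rw [pointFactor, weight, mul_comm]
  refine mul_le_mul_of_nonneg_right ?_ (prod_coth_nonneg z a)
  have h1 : ∏ b ∈ y, Real.tanh (hypDist a b / 2) ≤ 1 :=
    Finset.prod_le_one (fun b _ => tanh_hypDist_nonneg a b) fun b _ => by
      rw [tanh_hypDist_div_two]
      exact (norm_moebius_lt_one a b).le
  calc ‖(a : ℂ)‖ ^ n * ∏ b ∈ y, Real.tanh (hypDist a b / 2) ≤ ‖(a : ℂ)‖ ^ n :=
        mul_le_of_le_one_right (by positivity) h1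
    _ ≤ ‖(a : ℂ)‖ ^ N := pow_le_pow_of_le_one (norm_nonneg _) a.norm_lt_one.le hNn
    _ ≤ _ := norm_pow_le_exp a N

theorem pointFactor_sq (n : ℕ) (z y : Finset Complex.UnitDisc) (w : Complex.UnitDisc) :
    pointFactor n z y w ^ 2 = ‖(w : ℂ)‖ ^ (2 * n) * (∏ b ∈ y, Real.tanh (hypDist w b / 2) ^ 2) /
      ∏ a ∈ z.erase w, Real.tanh (hypDist w a / 2) ^ 2 := by
  simp only [pointFactor, coth_hypDist_div_two_eq_inv_tanh, Finset.prod_inv_distrib,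
    Finset.prod_pow]
  ring

/-- All that the estimates need: the determinant formula with the moduli of `e`. The phases of `e`
play no role afterwards. -/
theorem exists_integral_exp_bias_eq_det {N : ℕ} (hN : N ≠ 0) {z y : Finset Complex.UnitDisc}
    (hcard : y.card ≤ z.card) {Ω : Type*} [MeasurableSpace Ω] {P : Measure Ω}
    {G : Complex.UnitDisc → Ω → ℝ} (hG : IsFieldG G P) :
    ∃ (σ : Fin z.card ≃ z) (ζ e : Fin z.card → ℂ), (∀ i, ‖ζ i‖ < 1) ∧
      (∀ i, ‖e i‖ = pointFactor (N + (z.card - y.card)) z y (σ i)) ∧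
      ((∫ A, Real.exp (bias z y fun a => fieldU N a A) ∂haarUnitary N : ℝ) : ℂ) =
        ((∫ ω, Real.exp (bias z y fun a => G a ω) ∂P : ℝ) : ℂ) *
          (1 - perturbationMatrix ζ e).det := by
  set σ : Fin z.card ≃ z := z.equivFin.symm
  set τ : Fin y.card ≃ y := y.equivFin.symm
  -- The truncated subtraction is exact because `y.card ≤ z.card`; it makes both counts of the
  -- polynomial dimension, `k + N` and `n + l`, agree.
  set n := N + (z.card - y.card)
  have h := integral_haarUnitary_ratio_eq_det (N := N) (n := n) hN (by omega) (by omega)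
    (z := fun i => ((σ i : Complex.UnitDisc) : ℂ)) (b := fun j => ((τ j : Complex.UnitDisc) : ℂ))
    (fun i => (σ i).1.norm_lt_one) (fun j => (τ j).1.norm_lt_one)
    (Complex.UnitDisc.coe_injective.comp (Subtype.val_injective.comp σ.injective))
    (Complex.UnitDisc.coe_injective.comp (Subtype.val_injective.comp τ.injective))
  refine ⟨σ, fun i => conj ((σ i : Complex.UnitDisc) : ℂ),
    fun i => invBlaschke (fun i => conj ((σ i : Complex.UnitDisc) : ℂ)) i *
      blaschke (fun j => conj ((τ j : Complex.UnitDisc) : ℂ)) n (conj ((σ i : Complex.UnitDisc) : ℂ)),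
    fun i => ?_, fun i => ?_, Eq.trans ?_ (h.trans ?_)⟩
  · rw [Complex.norm_conj]
    exact (σ i).1.norm_lt_one
  · rw [norm_mul, pointFactor, prod_erase_equiv σ i fun x => coth (hypDist x (σ i) / 2),
      invBlaschke, blaschke, norm_prod, norm_mul, norm_pow, Complex.norm_conj, norm_prod]
    congr 1
    · refine Finset.prod_congr rfl fun m _ => ?_
      rw [coth_hypDist_div_two, norm_div, ← map_sub, Complex.norm_conj, ← map_mul,
        ← map_one (starRingEnd ℂ), ← map_sub, Complex.norm_conj]
      simp
    · congr 1
      rw [← Finset.prod_coe_sort y, ← τ.prod_comp]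
      refine Finset.prod_congr rfl fun j _ => ?_
      rw [tanh_hypDist_div_two, norm_div, norm_div, ← map_sub, Complex.norm_conj, norm_sub_rev,
        Complex.conj_conj]
  · simp only [exp_bias_fieldU]
    congr 2
    ext A
    rw [← σ.prod_comp, ← τ.prod_comp]
  · rw [hG.integral_exp_bias]
    simp only [← Finset.prod_coe_sort z, ← Finset.prod_coe_sort y, ← σ.prod_comp, ← τ.prod_comp]

theorem weight_le_maxWeight (N : ℕ) (z : Finset Complex.UnitDisc) {s : Finset Complex.UnitDisc}
    {a : Complex.UnitDisc} (ha : a ∈ s) : weight N z a ≤ maxWeight N z s :=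
  le_ciSup (f := fun a : s => weight N z a) (Set.finite_range _).bddAbove ⟨a, ha⟩

theorem maxWeight_nonneg (N : ℕ) (z s : Finset Complex.UnitDisc) : 0 ≤ maxWeight N z s :=
  Real.iSup_nonneg fun a => weight_nonneg N z a

/-- With `x = δ ^ 2`, bound `1 + k x` by `2 k` if `x ≤ 1` and by `2 k x` otherwise; the two cases
account for the two powers of `δ`. -/
theorem one_add_mul_pow_mul_sq_le {k : ℕ} (hk : 1 ≤ k) {δ : ℝ} :
    (1 + k * δ ^ 2) ^ (k - 1) * δ ^ 2 ≤ (2 * k) ^ (k - 1) * (δ ^ 2 + δ ^ (2 * k)) := by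
  have hk' : (1 : ℝ) ≤ k := by exact_mod_cast hk
  have hx : 0 ≤ δ ^ 2 := sq_nonneg δ
  rw [pow_mul]
  set x := δ ^ 2
  rcases le_total x 1 with h | h
  · have h1 : (1 + k * x) ^ (k - 1) ≤ (2 * (k : ℝ)) ^ (k - 1) :=
      pow_le_pow_left₀ (by positivity) (by nlinarith) _
    calc (1 + k * x) ^ (k - 1) * x ≤ (2 * (k : ℝ)) ^ (k - 1) * x := mul_le_mul_of_nonneg_right h1 hx
      _ ≤ _ := mul_le_mul_of_nonneg_left (le_add_of_nonneg_right (by positivity)) (by positivity)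
  · have h1 : (1 + k * x) ^ (k - 1) ≤ (2 * (k : ℝ) * x) ^ (k - 1) :=
      pow_le_pow_left₀ (by positivity) (by nlinarith) _
    calc (1 + k * x) ^ (k - 1) * x ≤ (2 * (k : ℝ) * x) ^ (k - 1) * x :=
          mul_le_mul_of_nonneg_right h1 hx
      _ = (2 * (k : ℝ)) ^ (k - 1) * x ^ k := by
          rw [mul_pow, mul_assoc, pow_sub_one_mul (by omega)]
      _ ≤ _ := mul_le_mul_of_nonneg_left (le_add_of_nonneg_left hx) (by positivity)

/-- Use `1 + k δ ^ 2 ≤ 2 k (1 + δ) ^ 2` and `δ ≤ 1 + δ`; the exponent is `2 (k - 1) + 1`. -/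
theorem one_add_mul_pow_mul_le {k : ℕ} (hk : 1 ≤ k) {δ δ' : ℝ} (hδ : 0 ≤ δ) (hδ' : 0 ≤ δ') :
    (1 + k * δ ^ 2) ^ (k - 1) * (δ * δ') ≤ (2 * k) ^ (k - 1) * (δ' * (1 + δ) ^ (2 * k - 1)) := by
  have hk' : (1 : ℝ) ≤ k := by exact_mod_cast hk
  have h1 : (1 + k * δ ^ 2) ^ (k - 1) ≤ (2 * (k : ℝ) * (1 + δ) ^ 2) ^ (k - 1) := by
    refine pow_le_pow_left₀ (by positivity) ?_ _
    nlinarith [mul_nonneg (zero_le_one.trans hk') hδ, mul_nonneg (zero_le_one.trans hk') (sq_nonneg δ)]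
  have h2 : 2 * k - 1 = 2 * (k - 1) + 1 := by omega
  calc (1 + k * δ ^ 2) ^ (k - 1) * (δ * δ')
      ≤ (2 * (k : ℝ) * (1 + δ) ^ 2) ^ (k - 1) * ((1 + δ) * δ') :=
        mul_le_mul h1 (mul_le_mul_of_nonneg_right (by linarith) hδ') (by positivity) (by positivity)
    _ = _ := by
        rw [h2, mul_pow, ← pow_mul, pow_succ]
        ring

end Comparison

end CUEField

/-! ### Conclusion: both estimates from the determinant formula -/

theorem corollary3 (k : ℕ) (hk : 1 ≤ k) :
    ∃ C : ℝ, ∀ N : ℕ, 1 ≤ N → ∀ z y : Finset Complex.UnitDisc,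
      Disjoint z y → z.card = k → y.card ≤ k →
      ∀ {Ω : Type*} [MeasurableSpace Ω] (P : Measure Ω) [IsProbabilityMeasure P]
        (G : Complex.UnitDisc → Ω → ℝ), CUEField.IsFieldG G P →
      -- both exponential moments are finite
      Integrable (fun A => Real.exp (CUEField.bias z y fun a => CUEField.fieldU N a A))
          (CUEField.haarUnitary N) ∧
      Integrable (fun ω => Real.exp (CUEField.bias z y fun a => G a ω)) P ∧
      -- the lower bound
      (∫ ω, Real.exp (CUEField.bias z y fun a => G a ω) ∂P) *
          (1 - C * (CUEField.maxWeight N z z ^ 2 + CUEField.maxWeight N z z ^ (2 * k))) ≤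
        ∫ A, Real.exp (CUEField.bias z y fun a => CUEField.fieldU N a A)
          ∂(CUEField.haarUnitary N) ∧
      -- the expansion of the ratio around a distinguished point
      ∀ w ∈ z,
        |(∫ A, Real.exp (CUEField.bias z y fun a => CUEField.fieldU N a A)
              ∂(CUEField.haarUnitary N)) /
            (∫ ω, Real.exp (CUEField.bias z y fun a => G a ω) ∂P) -
          (1 - ‖(w : ℂ)‖ ^ (2 * (N + (k - y.card))) *
            (∏ b ∈ y, Real.tanh (CUEField.hypDist w b / 2) ^ 2) /
            (∏ a ∈ z.erase w, Real.tanh (CUEField.hypDist w a / 2) ^ 2))| ≤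
        C * CUEField.maxWeight N z (z.erase w) *
          (1 + CUEField.maxWeight N z z) ^ (2 * k - 1) := by
  -- Here `k!` counts the Leibniz terms, one `k` the factors of each product, the other `k` the sum
  -- defining a matrix entry; `(2k)^(k-1)` comes from the two scalar inequalities.
  refine ⟨k.factorial * (k * (2 * k) ^ (k - 1) * k), fun N hN z y _ hz hy Ω _ P _ G hG => ?_⟩
  subst hz
  obtain ⟨σ, ζ, e, hζ, he, hdet⟩ :=
    CUEField.exists_integral_exp_bias_eq_det (N := N) (by omega) hy hG
  have hpos : 0 < ∫ ω, Real.exp (CUEField.bias z y fun a => G a ω) ∂P := by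
    rw [hG.integral_exp_bias, ← CUEField.exp_bias_bias]
    exact Real.exp_pos _
  have hle : ∀ i, ‖e i‖ ≤ CUEField.weight N z (σ i) := fun i =>
    (he i).trans_le (CUEField.pointFactor_le_weight (Nat.le_add_right _ _) z y _)
  have hΔ := CUEField.maxWeight_nonneg N z z
  have hK : (0 : ℝ) ≤ z.card.factorial * (z.card * z.card) := by positivity
  have hleΔ : ∀ i, ‖e i‖ ≤ CUEField.maxWeight N z z := fun i =>
    (hle i).trans (CUEField.weight_le_maxWeight N z (σ i).2)
  refine ⟨CUEField.integrable_exp_bias_fieldU N z y, hG.integrable_exp_bias z y, ?_, fun w hw => ?_⟩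
  · set Δ := CUEField.maxWeight N z z
    set IU := ∫ A, Real.exp (CUEField.bias z y fun a => CUEField.fieldU N a A)
      ∂(CUEField.haarUnitary N)
    set IG := ∫ ω, Real.exp (CUEField.bias z y fun a => G a ω) ∂P
    have h1 := CUEField.norm_det_one_sub_perturbationMatrix_sub_one_le hζ hΔ hleΔ
    have h2 := mul_le_mul_of_nonneg_left (CUEField.one_add_mul_pow_mul_sq_le hk (δ := Δ)) hK
    have h3 := (abs_le.1 (Complex.abs_re_le_norm ((1 - CUEField.perturbationMatrix ζ e).det - 1))).1
    -- Both moments are real, so the determinant may be replaced by its real part.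
    have h4 : IU = IG * (1 - CUEField.perturbationMatrix ζ e).det.re := by
      have := congrArg Complex.re hdet
      rwa [Complex.re_ofReal_mul, Complex.ofReal_re] at this
    rw [h4]
    refine mul_le_mul_of_nonneg_left ?_ hpos.le
    rw [Complex.sub_re, Complex.one_re] at h3
    rw [Fintype.card_fin] at h1
    linarith
  · obtain ⟨i, hi⟩ := σ.surjective ⟨w, hw⟩
    have hiw : (σ i : Complex.UnitDisc) = w := congrArg Subtype.val hi
    have hle' : ∀ j, j ≠ i → ‖e j‖ ≤ CUEField.maxWeight N z (z.erase w) := fun j hj =>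
      (hle j).trans (CUEField.weight_le_maxWeight N z (Finset.mem_erase.2 ⟨fun h => hj
        (σ.injective (Subtype.ext (h.trans hiw.symm))), (σ j).2⟩))
    have hΔ' := CUEField.maxWeight_nonneg N z (z.erase w)
    have h1 := CUEField.norm_det_one_sub_perturbationMatrix_sub_single_le hζ hΔ hΔ' hleΔ i hle'
    have h2 := mul_le_mul_of_nonneg_left (CUEField.one_add_mul_pow_mul_le hk hΔ hΔ') hK
    rw [he i, hiw, CUEField.pointFactor_sq, Fintype.card_fin] at h1
    set Δ := CUEField.maxWeight N z z
    set IU := ∫ A, Real.exp (CUEField.bias z y fun a => CUEField.fieldU N a A)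
      ∂(CUEField.haarUnitary N)
    set IG := ∫ ω, Real.exp (CUEField.bias z y fun a => G a ω) ∂P
    have h4 : (1 - CUEField.perturbationMatrix ζ e).det = ((IU / IG : ℝ) : ℂ) := by
      have : (IG : ℂ) ≠ 0 := Complex.ofReal_ne_zero.2 hpos.ne'
      rw [Complex.ofReal_div, hdet, mul_div_cancel_left₀ _ this]
    rw [h4, ← Complex.ofReal_sub, Complex.norm_real, Real.norm_eq_abs] at h1
    refine h1.trans (le_trans (le_of_eq ?_) (h2.trans (le_of_eq ?_))) <;> ring
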